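/- Let $\mathfrak g$ be a finite-dimensional simple complex Lie algebra with Cartan subalgebra $\mathfrak h$, root system $R$, simple roots $\{\alpha_i\}_{i\in I}$, positive roots $R^+$, and a Chevalley basis $\{x_\alpha^\pm, h_i:\alpha\in R^+,\ i\in I\}$; put $h_\alpha=[x_\alpha^+,x_\alpha^-]$, so $h_{\alpha_i}=h_i$. Let $A$ be a commutative associative unital $\mathbb C$-algebra and $\mathbf B$ a $\mathbb C$-basis of $A$ closed under multiplication. Let $U$ be the universal enveloping algebra of $\mathfrak g\otimes A$, with bracket $[z\otimes a,z'\otimes b]=[z,z']\otimes ab$. Write $u^{(r)}=u^r/r!$. For a set $S$ let $\mathcal F(S)$ be the set of finitely supported functions $\chi:S\to\mathbb Z_{\ge0}$, with $|\chi|=\sum_s\chi(s)$; regard $\mathcal F(\mathbf B)\subset\mathcal F(A)$. For $\psi\in\mathcal F(A)$ put $\pi(\psi)=\prod_a a^{\psi(a)}$, $m(\psi)=|\psi|!/\prod_a\psi(a)!$ and $x_\alpha^\pm(\psi)=\prod_a(x_\alpha^\pm\otimes a)^{(\psi(a))}$. For $\alpha\in R^+$ define $p_\alpha(\varphi,\chi)\in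 U$ recursively by $p_\alpha(0,0)=1$, $p_\alpha(\varphi,\chi)=0$ if $|\varphi|\ne|\chi|$, and, for $|\varphi|=|\chi|>0$, $$p_\alpha(\varphi,\chi)=-\frac1{|\varphi|}\sum_{0\neq\psi_1\le\varphi,\ 0\ne\psi_2\le\chi}m(\psi_1)m(\psi_2)\,\bigl(h_\alpha\otimes\pi(\psi_1)\pi(\psi_2)\bigr)\,p_\alpha(\varphi-\psi_1,\chi-\psi_2).$$ Put $p_\alpha(\chi)=p_\alpha(\chi,|\chi|\chi_1)$, where $\chi_1$ is the characteristic function of $1\in A$, and $p_i=p_{\alpha_i}$. Let $U_{\mathbb Z}$ be the $\mathbb Z$-subalgebra of $U$ generated by all $(x_\alpha^\pm\otimes b)^{(r)}$ ($\alpha\in R^+$, $b\in\mathbf B$, $r\ge0$), let $U_{\mathbb Z}^\pm$ be the $\mathbb Z$-subalgebra generated by those with the fixed sign $\pm$, and let $U_{\mathbb Z}^0$ be the $\mathbb Z$-subalgebra generated by all $p_i(\chi)$ ($i\in I$, $\chi\in\mathcal F(\mathbf B)$). Fix enumerations $\beta_1,\dots,\beta_m$ of $R^+$ and $1,\dots,n$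 of $I$, and let $\mathcal B$ be the set of all products $$x^-_{\beta_1}(\psi_1)\cdots x^-_{\beta_m}(\psi_m)\;p_1(\chi_1)\cdots p_n(\chi_n)\;x^+_{\beta_1}(\psi_1')\cdots x^+_{\beta_m}(\psi_m'),\qquad \psi_j,\chi_i,\psi'_j\in\mathcal F(\mathbf B).$$ For $u\in U$ let $\deg u$ be the least $j$ such that $u$ lies in the image of $\bigoplus_{k\le j}(\mathfrak g\otimes A)^{\otimes k}$ (so $\deg 0=0$). Then $$U_{\mathbb Z}=U_{\mathbb Z}^-\cdot U_{\mathbb Z}^0\cdot U_{\mathbb Z}^+,$$ where the right-hand side is the $\mathbb Z$-span of the products. Moreover, for all $\alpha\in R^+$, $i\in I$, $a,b\in\mathbf B$, $\chi\in\mathcal F(\mathbf B)$ and $r,s\ge0$: (a) $[(x_\alpha^+\otimes a)^{(r)},(x_\alpha^-\otimes b)^{(s)}]$ lies in the $\mathbb Z$-span of $\mathcal B$ and, if $r+s>0$, has degree less than $r+s$; (b) $[(x_\alpha^+\otimes a)^{(r)},p_i(\chi)]$ lies in the $\mathbb Z$-span of $\mathcal B$ and, if $r+|\chi|>0$, has degree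 less than $r+|\chi|$; (c) $[p_i(\chi),(x_\alpha^-\otimes b)^{(s)}]$ lies in the $\mathbb Z$-span of $\mathcal B$ and, if $s+|\chi|>0$, has degree less than $s+|\chi|$. -/

import Mathlib

open scoped TensorProduct

noncomputable section

namespace MapAlgebra

open LieAlgebra LieAlgebra.IsKilling

/-! ### Chevalley bases -/

section Chevalley

variable {L : Type*} [LieRing L] [LieAlgebra ℂ L] [FiniteDimensional ℂ L] [IsKilling ℂ L]

/-- The root `-α`. -/
def negRoot {H : LieSubalgebra ℂ L} [H.IsCartanSubalgebra] (α : H.root) : H.root :=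
  ⟨-α.1, by
    have h := α.2
    simp only [Finset.mem_filter, Finset.mem_univ, true_and] at h ⊢
    exact LieModule.Weight.IsNonZero.neg h⟩

/-- A family of root vectors `x α` forming, together with the simple coroots, a Chevalley basis of
the semisimple Lie algebra `L` with respect to the Cartan subalgebra `H`:
`⁅x α, x (-α)⁆` is the coroot of `α`, and `⁅x α, x β⁆ = ± (p + 1) x (α + β)` whenever `α + β` is a
root, where `p` is the largest integer such that `β - p α` is a root. (The remaining brackets are
determined by the weights, and `-α` occurs as `negRoot α`.) -/
structure IsChevalleyBasis (H : LieSubalgebra ℂ L) [H.IsCartanSubalgebra] (x : H.root → L) :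
    Prop where
  mem_rootSpace : ∀ α : H.root, x α ∈ rootSpace H α.1
  lie_neg : ∀ α : H.root, ⁅x α, x (negRoot α)⁆ = ((coroot α.1 : H) : L)
  lie_add : ∀ α β γ : H.root,
    (rootSystem H).root γ = (rootSystem H).root α + (rootSystem H).root β →
      ⁅x α, x β⁆ = (((rootSystem H).chainBotCoeff α β : ℂ) + 1) • x γ ∨
      ⁅x α, x β⁆ = -((((rootSystem H).chainBotCoeff α β : ℂ) + 1) • x γ)

end Chevalley

/-! ### Bases of a commutative algebra closed under multiplication -/

/-- `B` is a `ℂ`-basis of `A` that is closed under multiplication. -/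
structure IsMulClosedBasis {A : Type*} [CommRing A] [Algebra ℂ A] (B : Set A) : Prop where
  linearIndepOn : LinearIndepOn ℂ id B
  span_eq_top : Submodule.span ℂ B = ⊤
  mul_mem : ∀ a ∈ B, ∀ b ∈ B, a * b ∈ B

/-! ### The universal enveloping algebra of a map algebra -/

section Enveloping

variable (A L : Type*) [CommRing A] [Algebra ℂ A] [LieRing L] [LieAlgebra ℂ L]

/-- The universal enveloping algebra over `ℂ` of the map algebra of `L` and `A`, that is of the
complex Lie algebra `A ⊗ L` with bracket `⁅a ⊗ z, b ⊗ w⁆ = a b ⊗ ⁅z, w⁆`. -/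
abbrev MapEnv : Type _ := UniversalEnvelopingAlgebra ℂ (A ⊗[ℂ] L)

variable {A L}

/-- The element `z ⊗ a` of the map algebra, inside its universal enveloping algebra. -/
def elt (z : L) (a : A) : MapEnv A L := UniversalEnvelopingAlgebra.ι ℂ (a ⊗ₜ[ℂ] z)

/-- The divided power `u ^ r / r!`. -/
def dpow {U : Type*} [Ring U] [Algebra ℂ U] (u : U) (r : ℕ) : U :=
  ((r.factorial : ℂ)⁻¹) • u ^ r

/-- The subspace of elements of degree at most `j` of the enveloping algebra of a Lie algebra:
the image of the tensors of degree at most `j`. -/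
def degreeLE (𝔞 : Type*) [LieRing 𝔞] [LieAlgebra ℂ 𝔞] (j : ℕ) :
    Submodule ℂ (UniversalEnvelopingAlgebra ℂ 𝔞) :=
  (⨆ k ∈ Finset.range (j + 1), LinearMap.range (TensorAlgebra.ι ℂ (M := 𝔞)) ^ k).map
    (UniversalEnvelopingAlgebra.mkAlgHom ℂ 𝔞).toLinearMap

/-- The degree of an element of an enveloping algebra: the least `j` such that it comes from a
tensor of degree at most `j`. -/
def deg {𝔞 : Type*} [LieRing 𝔞] [LieAlgebra ℂ 𝔞] (u : UniversalEnvelopingAlgebra ℂ 𝔞) : ℕ :=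
  sInf {j : ℕ | u ∈ degreeLE 𝔞 j}

theorem commute_elt (z : L) (a b : A) : Commute (elt z a) (elt z b) := by
  let : LieRing (MapEnv A L) := LieRing.ofAssociativeRing
  have h : ⁅elt z a, elt z b⁆ = (0 : MapEnv A L) := by
    have := (UniversalEnvelopingAlgebra.ι ℂ (L := A ⊗[ℂ] L)).map_lie (a ⊗ₜ[ℂ] z) (b ⊗ₜ[ℂ] z)
    rw [LieAlgebra.ExtendScalars.bracket_tmul, lie_self, TensorProduct.tmul_zero, map_zero] at this
    exact this.symm
  rw [LieRing.of_associative_ring_bracket] at h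
  exact sub_eq_zero.mp h

theorem commute_dpow {U : Type*} [Ring U] [Algebra ℂ U] {u v : U} (h : Commute u v) (r s : ℕ) :
    Commute (dpow u r) (dpow v s) :=
  ((h.pow_pow r s).smul_left _).smul_right _

/-! Finite multisets of elements of `A` are functions `A →₀ ℕ`; the size of `ψ` is `ψ.degree`. -/

/-- The finite multisets of elements of `B`. -/
def multisetsIn (B : Set A) : Set (A →₀ ℕ) := {χ | (χ.support : Set A) ⊆ B}

/-- The product `∏ a ^ ψ(a)` of the elements of a multiset. -/
def multisetProd (ψ : A →₀ ℕ) : A := ψ.prod fun a k => a ^ k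

/-- The product over all `a` of the divided powers `(z ⊗ a)^(ψ(a))`. -/
def dpowProd (z : L) (ψ : A →₀ ℕ) : MapEnv A L :=
  ψ.support.noncommProd (fun a => dpow (elt z a) (ψ a))
    (fun a _ b _ _ => commute_dpow (commute_elt z a b) _ _)

open scoped Classical in
/-- The elements `p(φ, χ)` attached to `h ∈ L`, defined by `p(0, 0) = 1` and
`p(φ, χ) = -(δ_{|φ|,|χ|} / |φ|) ∑ m(ψ₁) m(ψ₂) (h ⊗ π(ψ₁) π(ψ₂)) p(φ - ψ₁, χ - ψ₂)`
over `0 < ψ₁ ≤ φ` and `0 < ψ₂ ≤ χ`, where `m(ψ) = |ψ|! / ∏ ψ(a)!` and `π(ψ) = ∏ a ^ ψ(a)`.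
For `h` the standard Cartan element of `sl₂` these live in the enveloping algebra for `sl₂`; by
`map_pElt` a homomorphism taking every `h ⊗ a` to `h' ⊗ a` takes the elements attached to `h` to
those attached to `h'`. -/
def pElt (h : L) (φ χ : A →₀ ℕ) : MapEnv A L :=
  if φ = 0 ∧ χ = 0 then 1
  else if φ.degree = χ.degree then
    (-(φ.degree : ℂ)⁻¹) • ∑ ψ₁ ∈ (Finset.Ioc 0 φ).attach, ∑ ψ₂ ∈ Finset.Ioc 0 χ,
      ((ψ₁.1.multinomial : ℂ) * (ψ₂.multinomial : ℂ)) •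
        (elt h (multisetProd ψ₁.1 * multisetProd ψ₂) * pElt h (φ - ψ₁.1) (χ - ψ₂))
  else 0
termination_by φ.degree
decreasing_by
  obtain ⟨h0, hle⟩ := Finset.mem_Ioc.mp ψ₁.2
  have h1 : (φ - ψ₁.1 + ψ₁.1).degree = φ.degree := by rw [tsub_add_cancel_of_le hle]
  have h2 : ψ₁.1.degree ≠ 0 := fun h => h0.ne' ((Finsupp.degree_eq_zero_iff _).mp h)
  rw [map_add] at h1
  omega

theorem map_pElt {L' : Type*} [LieRing L'] [LieAlgebra ℂ L'] (F : MapEnv A L →ₐ[ℂ] MapEnv A L')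
    (h : L) (h' : L') (hF : ∀ a : A, F (elt h a) = elt h' a) (φ χ : A →₀ ℕ) :
    F (pElt h φ χ) = pElt h' φ χ := by
  fun_induction pElt h φ χ with
  | case1 φ χ h0 => rw [pElt, if_pos h0, map_one]
  | case2 φ χ h0 h1 ih =>
    rw [pElt, if_neg h0, if_pos h1]
    simp only [map_smul, map_sum, map_mul, hF, ih]
  | case3 φ χ h0 h1 => rw [pElt, if_neg h0, if_neg h1, map_zero]

open scoped Classical in
/-- `p(χ) = p(χ, |χ| χ₁)`, where `χ₁` is the characteristic function of `1 ∈ A`. -/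
def pOne (h : L) (χ : A →₀ ℕ) : MapEnv A L := pElt h χ (Finsupp.single 1 χ.degree)

end Enveloping

/-! ### The integral form and its subalgebras -/

section IntegralForm

variable {A L : Type*} [CommRing A] [Algebra ℂ A] [LieRing L] [LieAlgebra ℂ L]
  [FiniteDimensional ℂ L] [IsKilling ℂ L] {H : LieSubalgebra ℂ L} [H.IsCartanSubalgebra]

/-- `p_α(χ)`, attached to `h_α = ⁅x α, x (-α)⁆`. -/
def pRoot (x : H.root → L) (α : H.root) (χ : A →₀ ℕ) : MapEnv A L :=
  pOne ⁅x α, x (negRoot α)⁆ χ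

/-- The divided powers `(x_α ⊗ b)^(r)` for `α` positive, `b ∈ B` and `r ≥ 0`. -/
def posGen (β : (rootSystem H).Base) (x : H.root → L) (B : Set A) : Set (MapEnv A L) :=
  {u | ∃ α : H.root, β.IsPos α ∧ ∃ b ∈ B, ∃ r : ℕ, u = dpow (elt (x α) b) r}

/-- The divided powers `(x_{-α} ⊗ b)^(r)` for `α` positive, `b ∈ B` and `r ≥ 0`. -/
def negGen (β : (rootSystem H).Base) (x : H.root → L) (B : Set A) : Set (MapEnv A L) :=
  {u | ∃ α : H.root, β.IsPos α ∧ ∃ b ∈ B, ∃ r : ℕ, u = dpow (elt (x (negRoot α)) b) r}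

/-- The elements `p_i(χ)` for `i` simple and `χ` a finite multiset of elements of `B`. -/
def zeroGen (β : (rootSystem H).Base) (x : H.root → L) (B : Set A) : Set (MapEnv A L) :=
  {u | ∃ i ∈ β.support, ∃ χ ∈ multisetsIn B, u = pRoot x i χ}

/-- The `ℤ`-subalgebra `U_ℤ`. -/
def UZ (β : (rootSystem H).Base) (x : H.root → L) (B : Set A) : Subalgebra ℤ (MapEnv A L) :=
  Algebra.adjoin ℤ (posGen β x B ∪ negGen β x B)

/-- The `ℤ`-subalgebra `U_ℤ⁺`. -/
def UZpos (β : (rootSystem H).Base) (x : H.root → L) (B : Set A) : Subalgebra ℤ (MapEnv A L) :=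
  Algebra.adjoin ℤ (posGen β x B)

/-- The `ℤ`-subalgebra `U_ℤ⁻`. -/
def UZneg (β : (rootSystem H).Base) (x : H.root → L) (B : Set A) : Subalgebra ℤ (MapEnv A L) :=
  Algebra.adjoin ℤ (negGen β x B)

/-- The `ℤ`-subalgebra `U_ℤ⁰`. -/
def UZzero (β : (rootSystem H).Base) (x : H.root → L) (B : Set A) : Subalgebra ℤ (MapEnv A L) :=
  Algebra.adjoin ℤ (zeroGen β x B)

/-- The set `𝓑` of ordered monomials `f⁻ f⁰ f⁺`, for an enumeration `e` of the positive roots and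
an enumeration `s` of the simple roots. -/
def pbwSet (β : (rootSystem H).Base) (x : H.root → L) (B : Set A) {m n : ℕ}
    (e : Fin m ≃ {α : H.root // β.IsPos α}) (s : Fin n ≃ β.support) : Set (MapEnv A L) :=
  {u | ∃ ψ ψ' : Fin m → A →₀ ℕ, ∃ χ : Fin n → A →₀ ℕ,
    (∀ j, ψ j ∈ multisetsIn B) ∧ (∀ j, ψ' j ∈ multisetsIn B) ∧ (∀ i, χ i ∈ multisetsIn B) ∧
    u = (List.ofFn fun j => dpowProd (x (negRoot (e j).1)) (ψ j)).prod *
        (List.ofFn fun i => pRoot x (s i).1 (χ i)).prod *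
        (List.ofFn fun j => dpowProd (x (e j).1) (ψ' j)).prod}

end IntegralForm

end MapAlgebra

end

noncomputable section

namespace MapAlgebra

/-! Work in the ring generated by the divided powers of all root vectors `x γ ⊗ b` together with the
`p_i(χ)`. Suppose the commutator of any two of these generators is an integral combination of
products of generators of smaller total degree. Then every product can be sorted into a prescribed
order by induction on the total degree (`prod_mem_span_blocks`), and neighbouring factors of the
same kind merge with integral coefficients. Hence the ordered monomials span this ring, which
contains `U_ℤ`. Since conversely `p_i(χ) ∈ U_ℤ`, the triangular decomposition follows. Parts (a)-(c)
then hold because the commutators lie in `U_ℤ` and because the associated graded algebra is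
commutative.

The commutation formulas are not computed; an integrality criterion,
`IsMonomialFamily.mem_span_int`, replaces them. Let `R` be a subring of an enveloping algebra that
is closed under the coproduct, has integral counit, and carries functionals with integral values on
`R` that vanish at `1` and are dual to a spanning family of the Lie algebra. Contracting the
coproduct with such a functional preserves `R` and acts on symbols as a partial derivative, so
iterated contractions show that the leading coefficients of an element of `R` are integers.
Subtracting the leading part and descending writes the element as an integral combination of divided
power monomials, none of larger degree. Only spanning by monomials is used, not the linear
independence in the PBW theorem. A commutator of elements of `R` of degrees `c` and `d` lies in `R`
and has degree less than `c + d`, so the criterion bounds its expansion as required.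

The coproduct condition holds for the `p(χ)` because their generating series solves a first order
equation for the Euler operator, which makes it group-like. Integral functionals are matrix
coefficients on `A ⊗ V` for a lattice in `V` (`exists_integral_functional`): on a vector of integral
weight `k`, the `p(χ)` act through the coefficients of `(1 - ∑ variables)^k`, which are integers.

The criterion is applied only to small subalgebras, where few representations are needed. Two
generators that do not belong to opposite roots lie over the span of the Cartan subalgebra and a
closed set of roots without opposite pairs; there the adjoint representation detects the root
vectors, and the fundamental weights, which are characters of this subalgebra, detect the coroots.
Opposite roots are treated in `sl₂` with its natural representation.

That `p(χ) ∈ U_ℤ` is also settled in `sl₂`. An explicit integral expression in divided powers of `e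
⊗ b` and `f ⊗ s`, where `b s = b`, has symbol `(h ⊗ b)^(r)` (`exists_sl2Sub_symbol_dpow`). Products
of these have the symbol of `± p(χ)`, and by the criterion the difference involves only `p`'s of
smaller degree, so induction applies. -/

theorem mem_of_sub_mem {M S : Type*} [AddGroup M] [SetLike S M] [AddSubgroupClass S M] {p : S}
    {a b : M} (h : a - b ∈ p) (hb : b ∈ p) : a ∈ p := by
  simpa using add_mem h hb

/-! ### The filtration of an enveloping algebra -/

section Filtration

variable {𝔞 : Type*} [LieRing 𝔞] [LieAlgebra ℂ 𝔞]

/-- The complex enveloping algebra. -/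
abbrev Env (𝔞 : Type*) [LieRing 𝔞] [LieAlgebra ℂ 𝔞] : Type _ := UniversalEnvelopingAlgebra ℂ 𝔞

/-- The canonical linear map to the enveloping algebra. -/
def env : 𝔞 →ₗ[ℂ] Env 𝔞 :=
  (UniversalEnvelopingAlgebra.mkAlgHom ℂ 𝔞).toLinearMap ∘ₗ TensorAlgebra.ι ℂ

theorem env_lie (x y : 𝔞) : env ⁅x, y⁆ = env x * env y - env y * env x := by
  let : LieRing (Env 𝔞) := LieRing.ofAssociativeRing
  exact (UniversalEnvelopingAlgebra.ι ℂ (L := 𝔞)).map_lie x y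

/-- The algebra homomorphism extending a linear map that turns brackets into commutators. -/
def envLift {C : Type*} [Ring C] [Algebra ℂ C] (f : 𝔞 →ₗ[ℂ] C)
    (hf : ∀ x y, f ⁅x, y⁆ = f x * f y - f y * f x) : Env 𝔞 →ₐ[ℂ] C :=
  let : LieRing C := LieRing.ofAssociativeRing
  UniversalEnvelopingAlgebra.lift ℂ { f with map_lie' := fun {x y} => hf x y }

@[simp] theorem envLift_env {C : Type*} [Ring C] [Algebra ℂ C] (f : 𝔞 →ₗ[ℂ] C)
    (hf : ∀ x y, f ⁅x, y⁆ = f x * f y - f y * f x) (x : 𝔞) : envLift f hf (env x) = f x := by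
  let : LieRing C := LieRing.ofAssociativeRing
  exact UniversalEnvelopingAlgebra.lift_ι_apply ℂ
    (({ f with map_lie' := fun {x y} => hf x y } : 𝔞 →ₗ⁅ℂ⁆ C)) x

variable (𝔞) in
/-- The elements of degree at most `d`. -/
def filt (d : ℕ) : Submodule ℂ (Env 𝔞) :=
  (1 ⊔ LinearMap.range (env (𝔞 := 𝔞))) ^ d

variable (𝔞) in
/-- The elements of degree less than `d`. -/
def filtLT : ℕ → Submodule ℂ (Env 𝔞)
  -- With this value, a statement about terms of lower degree becomes an exact identity in degree
  -- zero.
  | 0 => ⊥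
  | d + 1 => filt 𝔞 d

@[simp] theorem filtLT_succ (d : ℕ) : filtLT 𝔞 (d + 1) = filt 𝔞 d := rfl

theorem filtLT_zero : filtLT 𝔞 0 = ⊥ := rfl

theorem filt_mono {i j : ℕ} (h : i ≤ j) : filt 𝔞 i ≤ filt 𝔞 j :=
  pow_le_pow_right' le_sup_left h

theorem filtLT_mono {i j : ℕ} (h : i ≤ j) : filtLT 𝔞 i ≤ filtLT 𝔞 j := by
  cases i with
  | zero => exact bot_le
  | succ i =>
    obtain ⟨j, rfl⟩ : ∃ k, j = k + 1 := ⟨j - 1, by omega⟩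
    exact filt_mono (by omega)

theorem filtLT_le_filt (d : ℕ) : filtLT 𝔞 d ≤ filt 𝔞 d := by
  cases d with
  | zero => exact bot_le
  | succ d => exact filt_mono d.le_succ

theorem filt_le_filtLT {i j : ℕ} (h : i < j) : filt 𝔞 i ≤ filtLT 𝔞 j :=
  filtLT_mono (i := i + 1) h

theorem one_mem_filt (d : ℕ) : (1 : Env 𝔞) ∈ filt 𝔞 d :=
  filt_mono (Nat.zero_le d) (by rw [filt, pow_zero]; exact Submodule.one_le.mp le_rfl)

theorem env_mem_filt (x : 𝔞) : env x ∈ filt 𝔞 1 := by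
  rw [filt, pow_one]
  exact Submodule.mem_sup_right ⟨x, rfl⟩

theorem filt_add (i j : ℕ) : filt 𝔞 (i + j) = filt 𝔞 i * filt 𝔞 j := pow_add _ _ _

theorem mul_mem_filt {i j : ℕ} {u v : Env 𝔞} (hu : u ∈ filt 𝔞 i)
    (hv : v ∈ filt 𝔞 j) : u * v ∈ filt 𝔞 (i + j) := by
  rw [filt_add]
  exact Submodule.mul_mem_mul hu hv

theorem mul_mem_filtLT {i j : ℕ} {u v : Env 𝔞} (hu : u ∈ filt 𝔞 i)
    (hv : v ∈ filtLT 𝔞 j) : u * v ∈ filtLT 𝔞 (i + j) := by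
  cases j with
  | zero => rw [filtLT_zero, Submodule.mem_bot] at hv; simp [hv]
  | succ j => exact mul_mem_filt hu hv

theorem mul_mem_filtLT' {i j : ℕ} {u v : Env 𝔞} (hu : u ∈ filtLT 𝔞 i)
    (hv : v ∈ filt 𝔞 j) : u * v ∈ filtLT 𝔞 (i + j) := by
  cases i with
  | zero => rw [filtLT_zero, Submodule.mem_bot] at hu; simp [hu]
  | succ i => rw [Nat.succ_add]; exact mul_mem_filt hu hv

theorem env_mul_mem_filt {d : ℕ} (x : 𝔞) {v : Env 𝔞}
    (hv : v ∈ filt 𝔞 d) : env x * v ∈ filt 𝔞 (d + 1) := by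
  rw [add_comm]
  exact mul_mem_filt (env_mem_filt x) hv

theorem env_mul_mem_filtLT {d : ℕ} (x : 𝔞) {v : Env 𝔞}
    (hv : v ∈ filtLT 𝔞 d) : env x * v ∈ filtLT 𝔞 (d + 1) := by
  rw [add_comm]
  exact mul_mem_filtLT (env_mem_filt x) hv

theorem pow_mem_filt {u : Env 𝔞} {d : ℕ} (hu : u ∈ filt 𝔞 d) (r : ℕ) :
    u ^ r ∈ filt 𝔞 (d * r) := by
  rw [filt, pow_mul]
  exact Submodule.pow_mem_pow _ hu r

theorem dpow_mem_filt {u : Env 𝔞} (hu : u ∈ filt 𝔞 1) (r : ℕ) :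
    dpow u r ∈ filt 𝔞 r := by
  have := pow_mem_filt hu r
  rw [one_mul] at this
  exact Submodule.smul_mem _ _ this

theorem filt_zero_mem {u : Env 𝔞} (hu : u ∈ filt 𝔞 0) :
    ∃ c : ℂ, u = c • 1 := by
  rw [filt, pow_zero] at hu
  obtain ⟨c, rfl⟩ := Submodule.mem_one.mp hu
  exact ⟨c, Algebra.algebraMap_eq_smul_one c⟩

/-- Induction on the degree of an element of an enveloping algebra. -/
theorem filt_induction {p : (d : ℕ) → Env 𝔞 → Prop}
    (one : p 0 1) (env_mul : ∀ d x u, u ∈ filt 𝔞 d → p d u → p (d + 1) (env x * u))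
    (succ : ∀ d u, u ∈ filt 𝔞 d → p d u → p (d + 1) u)
    (smul : ∀ d (c : ℂ) u, p d u → p d (c • u))
    (add : ∀ d u v, p d u → p d v → p d (u + v)) {d : ℕ}
    {u : Env 𝔞} (hu : u ∈ filt 𝔞 d) : p d u := by
  induction d generalizing u with
  | zero =>
    obtain ⟨c, rfl⟩ := filt_zero_mem hu
    exact smul _ _ _ one
  | succ d ih =>
    rw [filt, pow_succ'] at hu
    refine Submodule.mul_induction_on hu (fun a ha b hb => ?_) (fun a b => add _ a b)
    obtain ⟨y, hy, z, ⟨x, rfl⟩, rfl⟩ := Submodule.mem_sup.mp ha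
    obtain ⟨c, rfl⟩ := Submodule.mem_one.mp hy
    rw [add_mul, Algebra.algebraMap_eq_smul_one, smul_mul_assoc, one_mul]
    exact add _ _ _ (smul _ _ _ (succ _ _ hb (ih hb))) (env_mul _ _ _ hb (ih hb))

/-- Bracketing with `x` is a derivation that maps the Lie algebra to itself, so it does not raise
the degree. -/
theorem env_commutator_mem_filt (x : 𝔞) {d : ℕ} {u : Env 𝔞}
    (hu : u ∈ filt 𝔞 d) : env x * u - u * env x ∈ filt 𝔞 d := by
  refine filt_induction (p := fun d u => env x * u - u * env x ∈ filt 𝔞 d) (by simp) ?_ ?_ ?_ ?_ hu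
  · intro d y u hu h
    have : env x * (env y * u) - env y * u * env x =
        env ⁅x, y⁆ * u + env y * (env x * u - u * env x) := by
      rw [env_lie]; noncomm_ring
    rw [this]
    exact add_mem (env_mul_mem_filt _ hu) (env_mul_mem_filt _ h)
  · exact fun d u _ h => filt_mono d.le_succ h
  · intro d c u h
    simpa only [mul_smul_comm, smul_mul_assoc, ← smul_sub] using Submodule.smul_mem _ c h
  · intro d u v hu hv
    have : env x * (u + v) - (u + v) * env x =
      (env x * u - u * env x) + (env x * v - v * env x) := by noncomm_ring
    rw [this]; exact add_mem hu hv

/-- The associated graded algebra is commutative. Every degree bound on a commutator below comes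
from here. -/
theorem commutator_mem_filtLT {i j : ℕ} {u v : Env 𝔞}
    (hu : u ∈ filt 𝔞 i) (hv : v ∈ filt 𝔞 j) : u * v - v * u ∈ filtLT 𝔞 (i + j) := by
  refine filt_induction (p := fun i u => u * v - v * u ∈ filtLT 𝔞 (i + j)) (by simp) ?_ ?_ ?_ ?_ hu
  · intro i x u hu h
    have : env x * u * v - v * (env x * u) =
        env x * (u * v - v * u) + (env x * v - v * env x) * u := by noncomm_ring
    rw [this]
    have h1 := env_mul_mem_filtLT x h
    have h2 := mul_mem_filt (env_commutator_mem_filt x hv) hu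
    rw [show i + 1 + j = i + j + 1 by omega]
    exact add_mem h1 (by rw [filtLT_succ, add_comm i]; exact h2)
  · exact fun d u _ h => filtLT_mono (by omega) h
  · intro d c u h
    simpa only [mul_smul_comm, smul_mul_assoc, ← smul_sub] using Submodule.smul_mem _ c h
  · intro d a b ha hb
    have : (a + b) * v - v * (a + b) = (a * v - v * a) + (b * v - v * b) := by noncomm_ring
    rw [this]; exact add_mem ha hb

theorem range_pow_le_degreeLE {k d : ℕ} (h : k ≤ d) :
    (LinearMap.range (TensorAlgebra.ι ℂ (M := 𝔞)) ^ k).map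
      (UniversalEnvelopingAlgebra.mkAlgHom ℂ 𝔞).toLinearMap ≤ degreeLE 𝔞 d :=
  Submodule.map_mono (le_iSup₂_of_le k (Finset.mem_range.mpr (by omega)) le_rfl)

/-- This inclusion suffices for the comparison with `deg`: an infimum is bounded above by exhibiting
a member. -/
theorem filt_le_degreeLE (d : ℕ) : filt 𝔞 d ≤ degreeLE 𝔞 d := by
  intro u hu
  refine filt_induction (p := fun d u => u ∈ degreeLE 𝔞 d) ?_ ?_ ?_ ?_ ?_ hu
  · refine range_pow_le_degreeLE le_rfl ⟨1, ?_, (UniversalEnvelopingAlgebra.mkAlgHom ℂ 𝔞).map_one⟩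
    rw [pow_zero]
    exact Submodule.one_le.mp le_rfl
  · rintro d x u - ⟨t, ht, rfl⟩
    refine ⟨TensorAlgebra.ι ℂ x * t, ?_, (UniversalEnvelopingAlgebra.mkAlgHom ℂ 𝔞).map_mul _ _⟩
    have : t ∈ ((⨆ k ∈ Finset.range (d + 1), LinearMap.range (TensorAlgebra.ι ℂ (M := 𝔞)) ^ k) :
        Submodule ℂ (TensorAlgebra ℂ 𝔞)) := ht
    refine (?_ : (⨆ k ∈ Finset.range (d + 1), LinearMap.range (TensorAlgebra.ι ℂ (M := 𝔞)) ^ k) ≤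
      ((⨆ k ∈ Finset.range (d + 1 + 1), LinearMap.range (TensorAlgebra.ι ℂ (M := 𝔞)) ^ k) :
        Submodule ℂ (TensorAlgebra ℂ 𝔞)).comap (LinearMap.mulLeft ℂ (TensorAlgebra.ι ℂ x))) this
    refine iSup₂_le fun k hk t ht => ?_
    refine Submodule.mem_iSup_of_mem (k + 1) (Submodule.mem_iSup_of_mem
      (Finset.mem_range.mpr (by have := Finset.mem_range.mp hk; omega)) ?_)
    rw [pow_succ']
    exact Submodule.mul_mem_mul ⟨x, rfl⟩ ht
  · intro d u _ h
    refine Submodule.map_mono ?_ h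
    exact biSup_mono fun k hk => by
      rw [Finset.mem_range] at hk ⊢; omega
  · exact fun d c u h => Submodule.smul_mem _ _ h
  · exact fun d u v hu hv => add_mem hu hv

theorem deg_lt_of_mem_filtLT {d : ℕ} (hd : 0 < d) {u : Env 𝔞}
    (hu : u ∈ filtLT 𝔞 d) : deg u < d := by
  obtain ⟨d, rfl⟩ : ∃ k, d = k + 1 := ⟨d - 1, by omega⟩
  exact Nat.lt_succ_of_le (Nat.sInf_le (filt_le_degreeLE d hu))

end Filtration

end MapAlgebra

end

noncomputable section

namespace MapAlgebra

/-! ### Coproduct, counit and contractions with functionals -/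

section Coproduct

variable {𝔞 : Type*} [LieRing 𝔞] [LieAlgebra ℂ 𝔞]

variable (𝔞) in
/-- The coproduct of an enveloping algebra. -/
def comul : Env 𝔞 →ₐ[ℂ] Env 𝔞 ⊗[ℂ] Env 𝔞 :=
  envLift ((Algebra.TensorProduct.includeLeft : Env 𝔞 →ₐ[ℂ] Env 𝔞 ⊗[ℂ] Env 𝔞).toLinearMap ∘ₗ env +
    (Algebra.TensorProduct.includeRight : Env 𝔞 →ₐ[ℂ] Env 𝔞 ⊗[ℂ] Env 𝔞).toLinearMap ∘ₗ env) (by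
      intro x y
      simp only [LinearMap.add_apply, LinearMap.comp_apply, AlgHom.toLinearMap_apply, env_lie,
        Algebra.TensorProduct.includeLeft_apply, Algebra.TensorProduct.includeRight_apply,
        add_mul, mul_add, Algebra.TensorProduct.tmul_mul_tmul, one_mul, mul_one,
        TensorProduct.sub_tmul, TensorProduct.tmul_sub]
      abel)

theorem comul_env (x : 𝔞) : comul 𝔞 (env x) = env x ⊗ₜ 1 + 1 ⊗ₜ env x := by
  simp [comul]

variable (𝔞) in
/-- The counit of an enveloping algebra. -/
def counit : Env 𝔞 →ₐ[ℂ] ℂ := envLift 0 (by simp)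

@[simp] theorem counit_env (x : 𝔞) : counit 𝔞 (env x) = 0 := by
  simp [counit]

/-- Contraction of the first factor of the coproduct with a functional. -/
def contract (f : Env 𝔞 →ₗ[ℂ] ℂ) : Env 𝔞 →ₗ[ℂ] Env 𝔞 :=
  (TensorProduct.lid ℂ (Env 𝔞)).toLinearMap ∘ₗ f.rTensor (Env 𝔞) ∘ₗ (comul 𝔞).toLinearMap

theorem contract_one (f : Env 𝔞 →ₗ[ℂ] ℂ) : contract f 1 = f 1 • 1 := by
  simp [contract, Algebra.TensorProduct.one_def]

/-- Since `x` is primitive, the summand `x ⊗ 1` is absorbed into the functional and `1 ⊗ x` stays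
outside. -/
theorem contract_env_mul (f : Env 𝔞 →ₗ[ℂ] ℂ) (x : 𝔞) (u : Env 𝔞) :
    contract f (env x * u) =
      contract (f ∘ₗ LinearMap.mulLeft ℂ (env x)) u + env x * contract f u := by
  simp only [contract, LinearMap.comp_apply, AlgHom.toLinearMap_apply, map_mul, comul_env, add_mul]
  generalize comul 𝔞 u = t
  induction t with
  | zero => simp
  | tmul a b => simp
  | add s t hs ht =>
    simp only [mul_add, map_add] at hs ht ⊢
    rw [add_add_add_comm, hs, ht]
    abel

/-- In each term of the coproduct other than `1 ⊗ u`, part of the degree has moved to the first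
factor and is lost on contraction. A functional that kills `1` therefore lowers the degree. -/
theorem contract_sub_mem_filtLT (f : Env 𝔞 →ₗ[ℂ] ℂ) {d : ℕ} {u : Env 𝔞} (hu : u ∈ filt 𝔞 d) :
    contract f u - f 1 • u ∈ filtLT 𝔞 d := by
  -- The functional has to vary in the induction, since contracting `env x * u` also involves `f`
  -- precomposed with multiplication by `env x`.
  suffices ∀ f : Env 𝔞 →ₗ[ℂ] ℂ, contract f u - f 1 • u ∈ filtLT 𝔞 d from this f
  refine filt_induction (p := fun d u => ∀ f : Env 𝔞 →ₗ[ℂ] ℂ, contract f u - f 1 • u ∈ filtLT 𝔞 d)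
    ?_ ?_ ?_ ?_ ?_ hu
  · intro f
    simp [contract_one]
  · intro d x u hu h f
    rw [contract_env_mul, add_sub_assoc, ← mul_smul_comm, ← mul_sub]
    refine add_mem ?_ (env_mul_mem_filtLT x (h f))
    have h1 := filtLT_le_filt _ (h (f ∘ₗ LinearMap.mulLeft ℂ (env x)))
    exact mem_of_sub_mem h1 (Submodule.smul_mem _ _ hu)
  · exact fun d u _ h f => filtLT_mono d.le_succ (h f)
  · intro d c u h f
    rw [map_smul, smul_comm, ← smul_sub]
    exact Submodule.smul_mem _ _ (h f)
  · intro d u v hu hv f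
    rw [map_add, smul_add, add_sub_add_comm]
    exact add_mem (hu f) (hv f)

theorem contract_mem_filtLT {f : Env 𝔞 →ₗ[ℂ] ℂ} (hf : f 1 = 0) {d : ℕ} {u : Env 𝔞} (hu : u ∈ filt 𝔞 d) :
    contract f u ∈ filtLT 𝔞 d := by
  simpa [hf] using contract_sub_mem_filtLT f hu

theorem contract_mem_filtLT_pred {f : Env 𝔞 →ₗ[ℂ] ℂ} (hf : f 1 = 0) {d : ℕ} {u : Env 𝔞}
    (hu : u ∈ filtLT 𝔞 (d + 1)) : contract f u ∈ filtLT 𝔞 d :=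
  contract_mem_filtLT hf hu

/-- The subring of integers in `ℂ`. -/
abbrev intC : Subring ℂ := (Int.castRingHom ℂ).range

theorem intCast_mem_intC (z : ℤ) : (z : ℂ) ∈ intC := ⟨z, rfl⟩

theorem zsmul_eq_of_mem_intC {M : Type*} [AddCommGroup M] [Module ℂ M] {N : Submodule ℤ M} {c : ℂ}
    (hc : c ∈ intC) {v : M} (hv : v ∈ N) : c • v ∈ N := by
  obtain ⟨z, rfl⟩ := hc
  rw [eq_intCast, Int.cast_smul_eq_zsmul]
  exact N.smul_mem z hv

/-- The `ℤ`-span of the tensors of elements of a subring. -/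
def tensorSpan (R : Subalgebra ℤ (Env 𝔞)) : Submodule ℤ (Env 𝔞 ⊗[ℂ] Env 𝔞) :=
  Submodule.span ℤ {t | ∃ a ∈ R, ∃ b ∈ R, t = a ⊗ₜ b}

theorem tmul_mem_tensorSpan {R : Subalgebra ℤ (Env 𝔞)} {a b : Env 𝔞} (ha : a ∈ R) (hb : b ∈ R) :
    a ⊗ₜ[ℂ] b ∈ tensorSpan R := Submodule.subset_span ⟨a, ha, b, hb, rfl⟩

theorem mul_mem_tensorSpan {R : Subalgebra ℤ (Env 𝔞)} {s t : Env 𝔞 ⊗[ℂ] Env 𝔞} (hs : s ∈ tensorSpan R)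
    (ht : t ∈ tensorSpan R) : s * t ∈ tensorSpan R := by
  induction hs, ht using Submodule.span_induction₂ with
  | mem_mem s t hs ht =>
    obtain ⟨a, ha, b, hb, rfl⟩ := hs
    obtain ⟨a', ha', b', hb', rfl⟩ := ht
    rw [Algebra.TensorProduct.tmul_mul_tmul]
    exact tmul_mem_tensorSpan (mul_mem ha ha') (mul_mem hb hb')
  | zero_left => simp
  | zero_right => simp
  | add_left x y z _ _ _ hx hy => rw [add_mul]; exact add_mem hx hy
  | add_right x y z _ _ _ hx hy => rw [mul_add]; exact add_mem hx hy
  | smul_left r x y _ _ h => rw [smul_mul_assoc]; exact Submodule.smul_mem _ _ h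
  | smul_right r x y _ _ h => rw [mul_smul_comm]; exact Submodule.smul_mem _ _ h

theorem comul_mem_tensorSpan {G : Set (Env 𝔞)}
    (hG : ∀ g ∈ G, comul 𝔞 g ∈ tensorSpan (Algebra.adjoin ℤ G)) {r : Env 𝔞}
    (hr : r ∈ Algebra.adjoin ℤ G) : comul 𝔞 r ∈ tensorSpan (Algebra.adjoin ℤ G) := by
  induction hr using Algebra.adjoin_induction with
  | mem g hg => exact hG g hg
  | algebraMap z =>
    rw [eq_intCast, map_intCast, ← zsmul_one, Algebra.TensorProduct.one_def]
    exact Submodule.smul_mem _ _ (tmul_mem_tensorSpan (one_mem _) (one_mem _))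
  | add x y _ _ hx hy => rw [map_add]; exact add_mem hx hy
  | mul x y _ _ hx hy => rw [map_mul]; exact mul_mem_tensorSpan hx hy

theorem contract_mem {R : Subalgebra ℤ (Env 𝔞)} {f : Env 𝔞 →ₗ[ℂ] ℂ} (hf : ∀ r ∈ R, f r ∈ intC) {r : Env 𝔞}
    (hr : comul 𝔞 r ∈ tensorSpan R) : contract f r ∈ R := by
  rw [contract, LinearMap.comp_apply, LinearMap.comp_apply, AlgHom.toLinearMap_apply]
  refine Submodule.span_induction (p := fun t _ => (TensorProduct.lid ℂ (Env 𝔞)).toLinearMap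
    (f.rTensor (Env 𝔞) t) ∈ R) ?_ ?_ ?_ ?_ hr
  · rintro _ ⟨a, ha, b, hb, rfl⟩
    simp only [LinearMap.rTensor_tmul, LinearEquiv.coe_coe, TensorProduct.lid_tmul]
    exact zsmul_eq_of_mem_intC (N := Subalgebra.toSubmodule R) (hf a ha) hb
  · simp
  · intro s t _ _ hs ht
    rw [map_add, map_add]; exact add_mem hs ht
  · intro z t _ ht
    rw [map_zsmul, map_zsmul]; exact zsmul_mem ht z

end Coproduct

/-! ### An integrality criterion -/

section Criterion

variable {𝔞 : Type*} [LieRing 𝔞] [LieAlgebra ℂ 𝔞] {K : Type*}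

/-- The elements `u n` have the symbols of the monomials `∏ X k ^ n k / (n k)!`. -/
structure IsMonomialFamily (X : K → 𝔞) (u : (K →₀ ℕ) → Env 𝔞) : Prop where
  zero : u 0 = 1
  mem : ∀ n, u n ∈ filt 𝔞 n.degree
  mul_sub_mem : ∀ n k, env (X k) * u n - ((n k : ℂ) + 1) • u (n + Finsupp.single k 1) ∈
    filt 𝔞 n.degree

variable {X : K → 𝔞} {u : (K →₀ ℕ) → Env 𝔞}

theorem degree_add_single (n : K →₀ ℕ) (k : K) :
    (n + Finsupp.single k 1).degree = n.degree + 1 := by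
  rw [map_add, Finsupp.degree_single]

/-- The elementary half of the PBW theorem. The other half is never needed: the dual functionals of
the criterion take its place. -/
theorem IsMonomialFamily.filt_le_span (hu : IsMonomialFamily X u)
    (hX : Submodule.span ℂ (Set.range X) = ⊤) (d : ℕ) :
    filt 𝔞 d ≤ Submodule.span ℂ {v | ∃ n, n.degree ≤ d ∧ v = u n} := by
  induction d with
  | zero =>
    intro v hv
    obtain ⟨c, rfl⟩ := filt_zero_mem hv
    exact Submodule.smul_mem _ _ (Submodule.subset_span ⟨0, by simp, hu.zero.symm⟩)
  | succ d ih =>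
    have mono : Submodule.span ℂ {v | ∃ n, n.degree ≤ d ∧ v = u n} ≤
        Submodule.span ℂ {v | ∃ n, n.degree ≤ d + 1 ∧ v = u n} :=
      Submodule.span_mono fun v ⟨n, hn, h⟩ => ⟨n, by omega, h⟩
    have key : ∀ x : 𝔞, ∀ v ∈ filt 𝔞 d, env x * v ∈
        Submodule.span ℂ {v | ∃ n, n.degree ≤ d + 1 ∧ v = u n} := by
      intro x v hv
      have hx : x ∈ Submodule.span ℂ (Set.range X) := hX ▸ Submodule.mem_top
      induction hx using Submodule.span_induction with
      | zero => simp
      | add x y _ _ hx hy => rw [map_add, add_mul]; exact add_mem hx hy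
      | smul c x _ hx => rw [map_smul, smul_mul_assoc]; exact Submodule.smul_mem _ _ hx
      | mem x hx =>
        obtain ⟨k, rfl⟩ := hx
        refine Submodule.span_induction (p := fun v _ => env (X k) * v ∈
          Submodule.span ℂ {v | ∃ n, n.degree ≤ d + 1 ∧ v = u n}) ?_ (by simp) ?_ ?_ (ih hv)
        · rintro _ ⟨n, hn, rfl⟩
          have h1 := mono (ih (filt_mono hn (hu.mul_sub_mem n k)))
          refine mem_of_sub_mem h1 (Submodule.smul_mem _ _ (Submodule.subset_span ⟨_, ?_, rfl⟩))
          rw [degree_add_single]; omega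
        · intro a b _ _ ha hb
          rw [mul_add]; exact add_mem ha hb
        · intro c a _ ha
          rw [mul_smul_comm]; exact Submodule.smul_mem _ _ ha
    intro v hv
    rw [filt, pow_succ'] at hv
    refine Submodule.mul_induction_on hv (fun a ha b hb => ?_) (fun a b => add_mem)
    obtain ⟨y, hy, z, ⟨x, rfl⟩, rfl⟩ := Submodule.mem_sup.mp ha
    obtain ⟨c, rfl⟩ := Submodule.mem_one.mp hy
    rw [add_mul, Algebra.algebraMap_eq_smul_one, smul_mul_assoc, one_mul]
    exact add_mem (Submodule.smul_mem _ _ (mono (ih hb))) (key x b hb)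

open scoped Classical in
-- On symbols, contraction with a functional dual to `X k` is the partial derivative in `X k`, which
-- sends a divided power monomial to the one with exponent at `k` lowered by one, without a
-- coefficient.
theorem IsMonomialFamily.contract_sub_mem (hu : IsMonomialFamily X u) {k : K} {f : Env 𝔞 →ₗ[ℂ] ℂ}
    (hf1 : f 1 = 0) (hf : ∀ l, f (env (X l)) = if l = k then 1 else 0) (n : K →₀ ℕ) :
    contract f (u n) - (if n k = 0 then 0 else u (n - Finsupp.single k 1)) ∈
      filtLT 𝔞 (n.degree - 1) := by
  generalize hd : n.degree = d
  induction d generalizing n with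
  | zero =>
    obtain rfl := (Finsupp.degree_eq_zero_iff n).mp hd
    simp [hu.zero, contract_one, hf1]
  | succ d ih =>
    obtain ⟨l, hl⟩ : ∃ l, n l ≠ 0 := by
      by_contra! h
      rw [(Finsupp.degree_eq_zero_iff n).mpr (Finsupp.ext h)] at hd
      omega
    obtain ⟨m, rfl⟩ : ∃ m, n = m + Finsupp.single l 1 :=
      ⟨n - Finsupp.single l 1, (tsub_add_cancel_of_le (by
        rw [Finsupp.single_le_iff]; omega)).symm⟩
    rw [degree_add_single] at hd
    obtain rfl : m.degree = d := by omega
    have ihm := ih m rfl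
    set d := m.degree
    have hc : ((m l : ℂ) + 1) ≠ 0 := Nat.cast_add_one_ne_zero _
    refine (Submodule.smul_mem_iff _ hc).mp ?_
    rw [smul_sub, ← map_smul, Nat.add_sub_cancel]
    -- Contract the relation `X l * u m ≡ (m l + 1) u (m + l)`. The left side is evaluated by the
    -- product rule: `h2` gives the term where the functional meets `X l`, and `h3` the term where
    -- it meets `u m`.
    have h1 := contract_mem_filtLT hf1 (hu.mul_sub_mem m l)
    rw [map_sub, contract_env_mul] at h1
    have h2 := contract_sub_mem_filtLT (f ∘ₗ LinearMap.mulLeft ℂ (env (X l))) (hu.mem m)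
    have h3 : env (X l) * (contract f (u m) -
        (if m k = 0 then 0 else u (m - Finsupp.single k 1))) ∈ filtLT 𝔞 d := by
      rcases Nat.eq_zero_or_pos d with h0 | h0
      · rw [h0, Nat.zero_sub, filtLT_zero, Submodule.mem_bot] at ihm
        rw [ihm, mul_zero]; exact zero_mem _
      · have := env_mul_mem_filtLT (X l) ihm
        rwa [Nat.sub_add_cancel h0] at this
    simp only [LinearMap.comp_apply, LinearMap.mulLeft_apply, mul_one, hf] at h2
    -- The product rule for the derivative in `X k` of `X l` times a divided power monomial, checked
    -- on symbols for `l = k` and `l ≠ k`.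
    have h4 : env (X l) * (if m k = 0 then 0 else u (m - Finsupp.single k 1)) +
        ((if l = k then 1 else 0 : ℂ) • u m) - ((m l : ℂ) + 1) •
        (if (m + Finsupp.single l 1 : K →₀ ℕ) k = 0 then 0 else
          u (m + Finsupp.single l 1 - Finsupp.single k 1)) ∈ filtLT 𝔞 d := by
      by_cases hlk : l = k
      · subst hlk
        simp only [Finsupp.add_apply, Finsupp.single_eq_same, add_tsub_cancel_right, if_true,
          Nat.succ_ne_zero, if_false, one_smul]
        by_cases hm : m l = 0
        · simp [hm]
        · rw [if_neg hm]
          have h5 := hu.mul_sub_mem (m - Finsupp.single l 1) l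
          have hle : Finsupp.single l 1 ≤ m := by rw [Finsupp.single_le_iff]; omega
          have hdeg := degree_add_single (m - Finsupp.single l 1) l
          rw [tsub_add_cancel_of_le hle] at h5 hdeg
          have hd' : d = (m - Finsupp.single l 1).degree + 1 := hdeg
          rw [hd', filtLT_succ]
          convert h5 using 1
          rw [Finsupp.tsub_apply, Finsupp.single_eq_same, Nat.cast_sub (by omega)]
          simp only [Nat.cast_one, sub_add_cancel]
          module
      · rw [if_neg hlk, zero_smul, add_zero, Finsupp.add_apply, Finsupp.single_eq_of_ne (Ne.symm hlk),
          add_zero]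
        by_cases hm : m k = 0
        · simp [hm]
        · rw [if_neg hm, if_neg hm]
          have h5 := hu.mul_sub_mem (m - Finsupp.single k 1) l
          have hle : Finsupp.single k 1 ≤ m := by rw [Finsupp.single_le_iff]; omega
          have hdeg := degree_add_single (m - Finsupp.single k 1) k
          rw [tsub_add_cancel_of_le hle] at hdeg
          have hd' : d = (m - Finsupp.single k 1).degree + 1 := hdeg
          rw [hd', filtLT_succ]
          rwa [tsub_add_eq_add_tsub hle, Finsupp.tsub_apply, Finsupp.single_eq_of_ne hlk,
            Nat.sub_zero] at h5
    have h5 := add_mem (add_mem (add_mem (neg_mem h1) h2) h3) h4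
    convert h5 using 1
    rw [mul_sub]
    abel

/-- Successive contractions with the functionals `f k`, for `k` in a list. -/
def pairing (f : K → Env 𝔞 →ₗ[ℂ] ℂ) : List K → Env 𝔞 →ₗ[ℂ] ℂ
  | [] => (counit 𝔞).toLinearMap
  | k :: l => pairing f l ∘ₗ contract (f k)

/-- Each contraction lowers the degree, so after as many contractions as the degree bound only `0`
is left. -/
theorem pairing_eq_zero {f : K → Env 𝔞 →ₗ[ℂ] ℂ} (hf1 : ∀ k, f k 1 = 0) (l : List K) {v : Env 𝔞}
    (hv : v ∈ filtLT 𝔞 l.length) : pairing f l v = 0 := by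
  induction l generalizing v with
  | nil =>
    rw [List.length_nil, filtLT_zero, Submodule.mem_bot] at hv
    rw [hv, map_zero]
  | cons k l ih => exact ih (contract_mem_filtLT_pred (hf1 k) hv)

theorem pairing_mem_intC {f : K → Env 𝔞 →ₗ[ℂ] ℂ} {R : Subalgebra ℤ (Env 𝔞)}
    (hΔ : ∀ r ∈ R, comul 𝔞 r ∈ tensorSpan R) (hε : ∀ r ∈ R, counit 𝔞 r ∈ intC)
    (hfR : ∀ k, ∀ r ∈ R, f k r ∈ intC) (l : List K) {r : Env 𝔞} (hr : r ∈ R) :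
    pairing f l r ∈ intC := by
  induction l generalizing r with
  | nil => exact hε r hr
  | cons k l ih => exact ih (contract_mem (hfR k) (hΔ r hr))

open scoped Classical in
-- Iterated derivatives of total order equal to the degree separate the divided power monomials of
-- that degree.
theorem IsMonomialFamily.pairing_apply (hu : IsMonomialFamily X u) {f : K → Env 𝔞 →ₗ[ℂ] ℂ}
    (hf1 : ∀ k, f k 1 = 0) (hf : ∀ k l, f k (env (X l)) = if l = k then 1 else 0) (l : List K)
    (n : K →₀ ℕ) (hn : n.degree = l.length) :
    pairing f l (u n) = if n = Multiset.toFinsupp (l : Multiset K) then 1 else 0 := by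
  induction l generalizing n with
  | nil =>
    obtain rfl := (Finsupp.degree_eq_zero_iff n).mp hn
    simp [pairing, hu.zero]
  | cons k l ih =>
    rw [List.length_cons] at hn
    have h := pairing_eq_zero hf1 l (v := contract (f k) (u n) -
      (if n k = 0 then 0 else u (n - Finsupp.single k 1)))
      (by simpa [hn] using hu.contract_sub_mem (hf1 k) (hf k) n)
    rw [map_sub, sub_eq_zero] at h
    rw [pairing, LinearMap.comp_apply, h, ← Multiset.cons_coe, ← Multiset.singleton_add, map_add,
      Multiset.toFinsupp_singleton]
    by_cases hk : n k = 0
    · rw [if_pos hk, map_zero, if_neg]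
      rintro rfl
      simp at hk
    · have hle : Finsupp.single k 1 ≤ n := by rw [Finsupp.single_le_iff]; omega
      have hdeg := degree_add_single (n - Finsupp.single k 1) k
      rw [tsub_add_cancel_of_le hle] at hdeg
      rw [if_neg hk, ih _ (by omega)]
      refine if_congr ?_ rfl rfl
      rw [tsub_eq_iff_eq_add_of_le hle, add_comm]

/-- If a subring `R` is closed under the coproduct and carries integral functionals dual to a basis
of the Lie algebra, then its elements are integral combinations of the monomials. -/
theorem IsMonomialFamily.mem_span_int (hu : IsMonomialFamily X u)
    (hX : Submodule.span ℂ (Set.range X) = ⊤) {R : Subalgebra ℤ (Env 𝔞)} (huR : ∀ n, u n ∈ R)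
    (hΔ : ∀ r ∈ R, comul 𝔞 r ∈ tensorSpan R) (hε : ∀ r ∈ R, counit 𝔞 r ∈ intC)
    (hf : ∀ k, ∃ f : Env 𝔞 →ₗ[ℂ] ℂ, f 1 = 0 ∧ f (env (X k)) = 1 ∧ (∀ l, l ≠ k → f (env (X l)) = 0) ∧
      ∀ r ∈ R, f r ∈ intC) {d : ℕ} {r : Env 𝔞} (hr : r ∈ R) (hrd : r ∈ filt 𝔞 d) :
    r ∈ Submodule.span ℤ {v | ∃ n, n.degree ≤ d ∧ v = u n} := by
  classical
  choose f hf1 hfk hfl hfR using hf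
  have hf' : ∀ k l, f k (env (X l)) = if l = k then 1 else 0 := by
    intro k l
    split_ifs with h
    · rw [h, hfk]
    · exact hfl k l h
  -- With strict bounds the base case of the induction is the zero element.
  suffices ∀ d, ∀ r ∈ R, r ∈ filtLT 𝔞 d →
      r ∈ Submodule.span ℤ {v | ∃ n, n.degree < d ∧ v = u n} by
    simpa only [Nat.lt_succ_iff] using this (d + 1) r hr hrd
  clear hrd hr r d
  intro d
  induction d with
  | zero =>
    intro r _ hr
    rw [filtLT_zero, Submodule.mem_bot] at hr
    rw [hr]; exact zero_mem _
  | succ d ih =>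
    intro r hr hrd
    -- Some expression of the leading part of `r` by monomials of degree `d`, with complex
    -- coefficients. Its uniqueness is not assumed.
    obtain ⟨c, hc⟩ : ∃ c : (K →₀ ℕ) →₀ ℂ, r - c.sum (fun n a => a • u n) ∈ filtLT 𝔞 d ∧
        ∀ n ∈ c.support, n.degree = d := by
      refine Submodule.span_induction (p := fun r _ => ∃ c : (K →₀ ℕ) →₀ ℂ,
        r - c.sum (fun n a => a • u n) ∈ filtLT 𝔞 d ∧ ∀ n ∈ c.support, n.degree = d)
        ?_ ?_ ?_ ?_ (hu.filt_le_span hX d hrd)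
      · rintro _ ⟨n, hn, rfl⟩
        rcases hn.lt_or_eq with h | h
        · exact ⟨0, by simpa using filt_le_filtLT h (hu.mem n), by simp⟩
        · refine ⟨Finsupp.single n 1, by simp, fun m hm => ?_⟩
          rw [Finset.mem_singleton.mp (Finsupp.support_single_subset hm), h]
      · exact ⟨0, by simp, by simp⟩
      · rintro x y _ _ ⟨c, hc, hc'⟩ ⟨e, he, he'⟩
        refine ⟨c + e, ?_, fun n hn => ?_⟩
        · rw [Finsupp.sum_add_index' (by simp) (by simp [add_smul]), add_sub_add_comm]
          exact add_mem hc he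
        · rcases Finset.mem_union.mp (Finsupp.support_add hn) with h | h
          exacts [hc' n h, he' n h]
      · rintro a x _ ⟨c, hc, hc'⟩
        refine ⟨a • c, ?_, fun n hn => hc' n (Finsupp.support_smul hn)⟩
        rw [Finsupp.sum_smul_index (by simp)]
        simp only [mul_smul]
        rw [← Finsupp.smul_sum, ← smul_sub]
        exact Submodule.smul_mem _ _ hc
    obtain ⟨hc, hcd⟩ := hc
    -- The pairing attached to the multiset `n` kills the terms of lower degree and all other
    -- leading monomials, so its value on `r` is `c n`. This value is an integer because `r ∈ R`.
    have hint : ∀ n ∈ c.support, c n ∈ intC := by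
      intro n hn
      set l := (Finsupp.toMultiset n).toList with hl
      have hlm : Multiset.toFinsupp (l : Multiset K) = n := by simp [hl]
      have hlen : l.length = d := by
        rw [hl, Multiset.length_toList, Finsupp.card_toMultiset, ← hcd n hn]
        rfl
      have h1 := pairing_eq_zero hf1 l (hlen.symm ▸ hc)
      rw [map_sub, sub_eq_zero] at h1
      have h2 := pairing_mem_intC hΔ hε hfR l hr
      have h3 : pairing f l (c.sum fun n a => a • u n) = c n := by
        rw [Finsupp.sum, map_sum, Finset.sum_eq_single n]
        · rw [map_smul, hu.pairing_apply hf1 hf' l n (by rw [hlen, hcd n hn]), hlm, if_pos rfl,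
            smul_eq_mul, mul_one]
        · intro m hm hmn
          rw [map_smul, hu.pairing_apply hf1 hf' l m (by rw [hlen, hcd m hm]), hlm, if_neg hmn,
            smul_zero]
        · intro h
          rw [Finsupp.notMem_support_iff.mp h, zero_smul, map_zero]
      rwa [h1, h3] at h2
    have hsum : c.sum (fun n a => a • u n) ∈
        Submodule.span ℤ {v | ∃ n, n.degree < d + 1 ∧ v = u n} :=
      sum_mem fun n hn => zsmul_eq_of_mem_intC (hint n hn)
        (Submodule.subset_span ⟨n, by have := hcd n hn; omega, rfl⟩)
    have hsumR : c.sum (fun n a => a • u n) ∈ R :=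
      sum_mem fun n hn => zsmul_eq_of_mem_intC (N := Subalgebra.toSubmodule R) (hint n hn) (huR n)
    have := ih _ (sub_mem hr hsumR) hc
    rw [← sub_add_cancel r (c.sum fun n a => a • u n)]
    refine add_mem (Submodule.span_mono ?_ this) hsum
    rintro v ⟨n, hn, h⟩
    exact ⟨n, by omega, h⟩

end Criterion

end MapAlgebra

end

noncomputable section

namespace MapAlgebra

/-! ### The Euler operator on power series -/

section Euler

variable {σ R : Type*} [Ring R]

/-- The Euler operator, multiplying a coefficient by its degree. -/
def euler (f : MvPowerSeries σ R) : MvPowerSeries σ R :=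
  fun n => n.degree • MvPowerSeries.coeff n f

theorem coeff_euler (f : MvPowerSeries σ R) (n : σ →₀ ℕ) :
    MvPowerSeries.coeff n (euler f) = n.degree • MvPowerSeries.coeff n f := rfl

theorem euler_add (f g : MvPowerSeries σ R) : euler (f + g) = euler f + euler g :=
  MvPowerSeries.ext fun n => by simp [coeff_euler]

theorem euler_neg (f : MvPowerSeries σ R) : euler (-f) = -euler f :=
  MvPowerSeries.ext fun n => by simp [coeff_euler]

theorem euler_one : euler (1 : MvPowerSeries σ R) = 0 :=
  MvPowerSeries.ext fun n => by
    classical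
    rw [coeff_euler, MvPowerSeries.coeff_one]
    split_ifs with h <;> simp [h]

theorem euler_mul (f g : MvPowerSeries σ R) : euler (f * g) = euler f * g + f * euler g :=
  MvPowerSeries.ext fun n => by
    classical
    rw [coeff_euler, map_add, MvPowerSeries.coeff_mul, MvPowerSeries.coeff_mul,
      MvPowerSeries.coeff_mul, Finset.smul_sum, ← Finset.sum_add_distrib]
    refine Finset.sum_congr rfl fun p hp => ?_
    rw [coeff_euler, coeff_euler, ← Finset.HasAntidiagonal.mem_antidiagonal.mp hp, map_add, add_smul,
      smul_mul_assoc, mul_smul_comm]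

/-- As `N` has no constant term, the coefficient of `N * f` at `n` involves only coefficients of `f`
of smaller degree. The equation is thus a recursion, solvable after division by the degree. -/
theorem eq_of_euler_eq [IsAddTorsionFree R] {N f g : MvPowerSeries σ R}
    (hN : MvPowerSeries.coeff 0 N = 0) (hf : euler f = N * f) (hg : euler g = N * g)
    (h0 : MvPowerSeries.coeff 0 f = MvPowerSeries.coeff 0 g) : f = g := by
  classical
  refine MvPowerSeries.ext fun n => ?_
  generalize hd : n.degree = d
  induction d using Nat.strong_induction_on generalizing n with
  | _ d ih =>
    by_cases hn : n = 0
    · rw [hn, h0]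
    have hd0 : n.degree ≠ 0 := fun h => hn ((Finsupp.degree_eq_zero_iff n).mp h)
    refine nsmul_right_injective hd0 ?_
    change n.degree • _ = n.degree • _
    rw [← coeff_euler, ← coeff_euler, hf, hg, MvPowerSeries.coeff_mul, MvPowerSeries.coeff_mul]
    refine Finset.sum_congr rfl fun p hp => ?_
    by_cases hp1 : p.1 = 0
    · rw [hp1, hN, zero_mul, zero_mul]
    · have h1 : p.1.degree ≠ 0 := fun h => hp1 ((Finsupp.degree_eq_zero_iff _).mp h)
      have h2 : p.1.degree + p.2.degree = n.degree := by
        rw [← map_add, Finset.HasAntidiagonal.mem_antidiagonal.mp hp]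
      rw [ih p.2.degree (by omega) p.2 rfl]

theorem mvPowerSeries_commute {f g : MvPowerSeries σ R}
    (h : ∀ m n, Commute (MvPowerSeries.coeff m f) (MvPowerSeries.coeff n g)) : Commute f g :=
  MvPowerSeries.ext fun n => by
    classical
    rw [MvPowerSeries.coeff_mul, MvPowerSeries.coeff_mul]
    refine Finset.sum_nbij' Prod.swap Prod.swap ?_ ?_ (fun _ _ => rfl) (fun _ _ => rfl) ?_
    · simp [add_comm]
    · simp [add_comm]
    · exact fun p _ => h p.1 p.2

theorem sum_antidiagonal_eq_sum_Iic {M : Type*} [AddCommMonoid M] [DecidableEq σ]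
    (n : σ →₀ ℕ) (F : (σ →₀ ℕ) → (σ →₀ ℕ) → M) :
    ∑ p ∈ Finset.HasAntidiagonal.antidiagonal n, F p.1 p.2 = ∑ ψ ∈ Finset.Iic n, F ψ (n - ψ) := by
  refine Finset.sum_nbij' Prod.fst (fun ψ => (ψ, n - ψ)) ?_ ?_ ?_ (fun _ _ => rfl) ?_
  · intro p hp
    rw [Finset.mem_Iic, ← Finset.HasAntidiagonal.mem_antidiagonal.mp hp]
    exact le_self_add
  · intro ψ hψ
    rw [Finset.HasAntidiagonal.mem_antidiagonal]
    exact add_tsub_cancel_of_le (Finset.mem_Iic.mp hψ)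
  · intro p hp
    rw [← Finset.HasAntidiagonal.mem_antidiagonal.mp hp, add_tsub_cancel_left]
  · intro p hp
    rw [← Finset.HasAntidiagonal.mem_antidiagonal.mp hp, add_tsub_cancel_left]

end Euler

/-! ### Multinomial coefficients -/

section Multinomial

variable {σ : Type*}

theorem multinomial_single (a : σ) (k : ℕ) : (Finsupp.single a k).multinomial = 1 := by
  rw [Finsupp.multinomial, Finsupp.sum_single_index rfl, Finsupp.prod_single_index rfl]
  exact Nat.div_self k.factorial_pos

theorem prod_factorial_mul_multinomial (ψ : σ →₀ ℕ) :
    (ψ.prod fun _ k => k.factorial) * ψ.multinomial = ψ.degree.factorial := by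
  rw [Finsupp.multinomial_eq]
  exact Nat.multinomial_spec _ _

theorem prod_factorial_add_single (ψ : σ →₀ ℕ) (a : σ) :
    ((ψ + Finsupp.single a 1).prod fun _ k => k.factorial) =
      (ψ a + 1) * ψ.prod fun _ k => k.factorial := by
  classical
  have h1 : (ψ + Finsupp.single a 1).support ⊆ insert a ψ.support := by
    intro b hb
    by_contra h
    simp only [Finset.mem_insert, not_or, Finsupp.notMem_support_iff] at h
    simp [h.2, Finsupp.single_eq_of_ne h.1] at hb
  rw [Finsupp.prod_of_support_subset _ h1 _ (fun _ _ => rfl),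
    Finsupp.prod_of_support_subset ψ (Finset.subset_insert a _) _ (fun _ _ => rfl),
    ← Finset.mul_prod_erase _ _ (Finset.mem_insert_self a _),
    ← Finset.mul_prod_erase (insert a ψ.support) _ (Finset.mem_insert_self a _), ← mul_assoc,
    Finsupp.add_apply, Finsupp.single_eq_same, Nat.factorial_succ]
  congr 1
  refine Finset.prod_congr rfl fun b hb => ?_
  rw [Finsupp.add_apply, Finsupp.single_eq_of_ne (Finset.ne_of_mem_erase hb), add_zero]

/-- Pascal's rule: count words with prescribed letters by their first letter. -/
theorem multinomial_eq_sum {ψ : σ →₀ ℕ} (h : ψ ≠ 0) :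
    ψ.multinomial = ∑ a ∈ ψ.support, (ψ - Finsupp.single a 1).multinomial := by
  have hpos : 0 < ψ.prod fun _ k => k.factorial :=
    Finset.prod_pos fun _ _ => Nat.factorial_pos _
  refine Nat.eq_of_mul_eq_mul_left hpos ?_
  have hd : ψ.degree ≠ 0 := fun h' => h ((Finsupp.degree_eq_zero_iff ψ).mp h')
  rw [prod_factorial_mul_multinomial, Finset.mul_sum, ← Nat.mul_factorial_pred hd,
    Finsupp.degree_apply, Finset.sum_mul, ← Finsupp.degree_apply]
  refine Finset.sum_congr rfl fun a ha => ?_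
  have hle : Finsupp.single a 1 ≤ ψ := by
    rw [Finsupp.single_le_iff]
    have := Finsupp.mem_support_iff.mp ha
    omega
  obtain ⟨φ, rfl⟩ : ∃ φ, ψ = φ + Finsupp.single a 1 := ⟨_, (tsub_add_cancel_of_le hle).symm⟩
  rw [add_tsub_cancel_right, prod_factorial_add_single, mul_assoc, prod_factorial_mul_multinomial,
    degree_add_single, Nat.add_sub_cancel, Finsupp.add_apply, Finsupp.single_eq_same]

theorem exists_eq_add_single {ψ : σ →₀ ℕ} (h : ψ ≠ 0) :
    ∃ φ : σ →₀ ℕ, ∃ a, ψ = φ + Finsupp.single a 1 := by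
  obtain ⟨a, ha⟩ := Finsupp.ne_iff.mp h
  refine ⟨ψ - Finsupp.single a 1, a, (tsub_add_cancel_of_le ?_).symm⟩
  rw [Finsupp.single_le_iff]
  exact Nat.one_le_iff_ne_zero.mpr ha

theorem eq_single_of_degree_eq_one {ψ : σ →₀ ℕ} (h : ψ.degree = 1) :
    ∃ a, ψ = Finsupp.single a 1 := by
  obtain ⟨φ, a, rfl⟩ := exists_eq_add_single (ψ := ψ) (by rintro rfl; simp at h)
  rw [degree_add_single, Nat.add_eq_right, Finsupp.degree_eq_zero_iff] at h
  exact ⟨a, by rw [h, zero_add]⟩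

variable (σ) in
/-- The sum of the variables. -/
def sumVar : MvPowerSeries σ ℤ := fun ψ => if ψ.degree = 1 then 1 else 0

theorem coeff_sumVar (ψ : σ →₀ ℕ) :
    MvPowerSeries.coeff ψ (sumVar σ) = if ψ.degree = 1 then 1 else 0 := rfl

variable (σ) in
open scoped Classical in
/-- The generating series of the multinomial coefficients, without constant term. -/
def multinomialSeries : MvPowerSeries σ ℤ := fun ψ => if ψ = 0 then 0 else ψ.multinomial

open scoped Classical in
theorem coeff_multinomialSeries (ψ : σ →₀ ℕ) :
    MvPowerSeries.coeff ψ (multinomialSeries σ) = if ψ = 0 then 0 else (ψ.multinomial : ℤ) := rfl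

theorem euler_sumVar : euler (sumVar σ) = sumVar σ :=
  MvPowerSeries.ext fun n => by
    rw [coeff_euler, coeff_sumVar]
    split_ifs with h <;> simp [h]

/-- Writing `s` for the sum of the variables, this is Pascal's rule in the form `1 +
multinomialSeries = (1 - s)⁻¹`. -/
theorem sumVar_mul : sumVar σ * (1 + multinomialSeries σ) = multinomialSeries σ :=
  MvPowerSeries.ext fun n => by
    classical
    have h1 : ∀ ψ : σ →₀ ℕ, MvPowerSeries.coeff ψ (1 + multinomialSeries σ) = (ψ.multinomial : ℤ) := by
      intro ψ
      rw [map_add, MvPowerSeries.coeff_one, coeff_multinomialSeries]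
      by_cases h : ψ = 0
      · subst h
        simp [Finsupp.multinomial]
      · simp [h]
    rw [MvPowerSeries.coeff_mul, sum_antidiagonal_eq_sum_Iic n
      (fun p q => MvPowerSeries.coeff p (sumVar σ) *
        MvPowerSeries.coeff q (1 + multinomialSeries σ))]
    rw [coeff_multinomialSeries]
    simp only [h1]
    have h2 : ∑ a ∈ n.support, ((n - Finsupp.single a 1).multinomial : ℤ) =
        ∑ ψ ∈ Finset.Iic n, MvPowerSeries.coeff ψ (sumVar σ) * (n - ψ).multinomial := by
      rw [← Finset.sum_image (s := n.support) (g := fun a => Finsupp.single a 1)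
        (f := fun ψ : σ →₀ ℕ => ((n - ψ).multinomial : ℤ))
        (fun a _ b _ h => (Finsupp.single_left_inj one_ne_zero).mp h)]
      rw [← Finset.sum_subset (s₁ := n.support.image fun a => Finsupp.single a 1)
        (s₂ := Finset.Iic n)]
      · refine Finset.sum_congr rfl fun ψ hψ => ?_
        obtain ⟨a, ha, rfl⟩ := Finset.mem_image.mp hψ
        simp [coeff_sumVar]
      · intro ψ hψ
        obtain ⟨a, ha, rfl⟩ := Finset.mem_image.mp hψ
        rw [Finset.mem_Iic, Finsupp.single_le_iff]
        have := Finsupp.mem_support_iff.mp ha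
        omega
      · intro ψ hψ hψ'
        rw [coeff_sumVar, if_neg, zero_mul]
        intro hd
        obtain ⟨a, rfl⟩ := eq_single_of_degree_eq_one hd
        refine hψ' (Finset.mem_image.mpr ⟨a, ?_, rfl⟩)
        rw [Finset.mem_Iic, Finsupp.single_le_iff] at hψ
        rw [Finsupp.mem_support_iff]
        omega
    rw [← h2]
    split_ifs with h
    · simp [h]
    · rw [multinomial_eq_sum h]
      push_cast
      rfl

/-- The Euler operator fixes the sum `s` of the variables. Applying it to `s (1 + M) = M` and
multiplying by `1 + M`, the inverse of `1 - s`, isolates `euler M`. -/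
theorem euler_multinomialSeries :
    euler (multinomialSeries σ) = multinomialSeries σ * (1 + multinomialSeries σ) := by
  have h := sumVar_mul (σ := σ)
  have h1 := congrArg euler h
  rw [euler_mul, euler_sumVar, euler_add, euler_one, zero_add, h] at h1
  set M := multinomialSeries σ
  set s := sumVar σ
  calc euler M = (1 + M) * (euler M - s * euler M) + (M - s * (1 + M)) * (- euler M) := by ring
    _ = (1 + M) * M + 0 := by rw [h]; nth_rewrite 1 [← h1]; ring
    _ = _ := by ring

theorem sumVar_eq : multinomialSeries σ * (1 - sumVar σ) = sumVar σ := by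
  linear_combination (norm := ring1) -sumVar_mul (σ := σ)

/-- The powers of one minus the sum of the variables have integral coefficients. -/
theorem exists_euler_eq (k : ℤ) : ∃ z : MvPowerSeries σ ℤ, MvPowerSeries.coeff 0 z = 1 ∧
    euler z = -(k • (multinomialSeries σ * z)) := by
  classical
  have hM0 : MvPowerSeries.coeff 0 (multinomialSeries σ) = 0 := by simp [coeff_multinomialSeries]
  have hs0 : MvPowerSeries.coeff 0 (sumVar σ) = 0 := by simp [coeff_sumVar]
  induction k using Int.induction_on with
  | zero => exact ⟨1, by simp, by simp [euler_one]⟩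
  | succ k ih =>
    obtain ⟨z, hz0, hz⟩ := ih
    -- The solution for `k` is `(1 - s)^k`, with `s` the sum of the variables; one more factor
    -- raises the exponent.
    refine ⟨z * (1 - sumVar σ), ?_, ?_⟩
    · simp only [MvPowerSeries.coeff_zero_eq_constantCoeff, map_mul, map_sub, map_one] at *
      rw [hz0, hs0]; rfl
    · rw [euler_mul, hz, sub_eq_add_neg, euler_add, euler_neg, euler_sumVar, euler_one, zsmul_eq_mul,
        zsmul_eq_mul]
      push_cast
      linear_combination (norm := ring1) (z : MvPowerSeries σ ℤ) * sumVar_eq (σ := σ)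
  | pred k ih =>
    obtain ⟨z, hz0, hz⟩ := ih
    -- `1 + multinomialSeries σ` is the integral inverse of `1 - s`, so the exponent drops by one.
    refine ⟨z * (1 + multinomialSeries σ), ?_, ?_⟩
    · simp only [MvPowerSeries.coeff_zero_eq_constantCoeff, map_mul, map_add, map_one] at *
      rw [hz0, hM0]; rfl
    · rw [euler_mul, hz, euler_add, euler_multinomialSeries, euler_one, zsmul_eq_mul, zsmul_eq_mul]
      push_cast
      ring

end Multinomial

end MapAlgebra

end

noncomputable section

namespace MapAlgebra

/-! ### The elements `p(χ)` -/

section MultisetProd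

variable {A : Type*} [CommRing A]

theorem multisetProd_add (φ ψ : A →₀ ℕ) :
    multisetProd (φ + ψ) = multisetProd φ * multisetProd ψ :=
  Finsupp.prod_add_index' (fun a => pow_zero a) (fun a => pow_add a)

theorem multisetProd_zero : multisetProd (0 : A →₀ ℕ) = 1 := Finsupp.prod_zero_index

theorem multisetProd_single (a : A) (k : ℕ) : multisetProd (Finsupp.single a k) = a ^ k :=
  Finsupp.prod_single_index (pow_zero a)

end MultisetProd

section POne

variable {A 𝔨 : Type*} [CommRing A] [Algebra ℂ A] [LieRing 𝔨] [LieAlgebra ℂ 𝔨]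

theorem elt_eq_env (z : 𝔨) (a : A) : elt z a = env (a ⊗ₜ[ℂ] z) := rfl

theorem elt_mem_filt (z : 𝔨) (a : A) : elt z a ∈ filt (A ⊗[ℂ] 𝔨) 1 := env_mem_filt _

theorem pElt_eq_zero (h : 𝔨) {φ χ : A →₀ ℕ} (hd : φ.degree ≠ χ.degree) : pElt h φ χ = 0 := by
  rw [pElt, if_neg, if_neg hd]
  rintro ⟨rfl, rfl⟩
  exact hd rfl

@[simp] theorem pOne_zero (h : 𝔨) : pOne h (0 : A →₀ ℕ) = 1 := by
  rw [pOne, pElt, if_pos ⟨rfl, by simp⟩]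

open scoped Classical in
-- The second argument is a multiple of the characteristic function of `1`. Its submultisets have
-- multinomial coefficient and product equal to `1`, and all but the one of the size of `ψ` are
-- discarded because `pElt` vanishes on multisets of different sizes.
theorem degree_smul_pOne (h : 𝔨) (χ : A →₀ ℕ) :
    (χ.degree : ℂ) • pOne h χ = -∑ ψ ∈ Finset.Ioc 0 χ,
      (ψ.multinomial : ℂ) • (elt h (multisetProd ψ) * pOne h (χ - ψ)) := by
  by_cases hχ : χ = 0
  · subst hχ
    simp
  have hd : χ.degree ≠ 0 := fun h => hχ ((Finsupp.degree_eq_zero_iff χ).mp h)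
  rw [pOne, pElt, if_neg (fun h => hχ h.1), if_pos (by simp), smul_smul, mul_neg,
    mul_inv_cancel₀ (Nat.cast_ne_zero.mpr hd), neg_smul, one_smul]
  rw [Finset.sum_attach (Finset.Ioc 0 χ) (fun ψ₁ => ∑ ψ₂ ∈ Finset.Ioc 0 (Finsupp.single 1 χ.degree),
    ((ψ₁.multinomial : ℂ) * (ψ₂.multinomial : ℂ)) •
        (elt h (multisetProd ψ₁ * multisetProd ψ₂) *
          pElt h (χ - ψ₁) (Finsupp.single 1 χ.degree - ψ₂)))]
  congr 1
  refine Finset.sum_congr rfl fun ψ hψ => ?_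
  obtain ⟨hψ0, hψχ⟩ := Finset.mem_Ioc.mp hψ
  have hdeg : (χ - ψ).degree + ψ.degree = χ.degree := by
    rw [← map_add, tsub_add_cancel_of_le hψχ]
  have hψd : ψ.degree ≠ 0 := fun h => hψ0.ne' ((Finsupp.degree_eq_zero_iff _).mp h)
  rw [Finset.sum_eq_single (Finsupp.single 1 ψ.degree)]
  · rw [multinomial_single, Nat.cast_one, mul_one, multisetProd_single, one_pow, mul_one,
      ← Finsupp.single_tsub, ← hdeg, Nat.add_sub_cancel, pOne]
  · intro φ hφ hne
    obtain ⟨hφ0, hφχ⟩ := Finset.mem_Ioc.mp hφ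
    have h1 : (Finsupp.single (1 : A) χ.degree - φ).degree + φ.degree = χ.degree := by
      rw [← map_add, tsub_add_cancel_of_le hφχ, Finsupp.degree_single]
    rw [pElt_eq_zero, mul_zero, smul_zero]
    intro h2
    apply hne
    have h3 : φ = Finsupp.single 1 (φ 1) := by
      ext b
      by_cases hb : b = 1
      · rw [hb, Finsupp.single_eq_same]
      · have := hφχ b
        rw [Finsupp.single_eq_of_ne hb] at this ⊢
        omega
    have h4 : φ.degree = φ 1 := by
      conv_lhs => rw [h3, Finsupp.degree_single]
    rw [h3, ← h4]
    congr 1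
    omega
  · intro h'
    refine absurd (Finset.mem_Ioc.mpr ⟨?_, ?_⟩) h'
    · refine pos_iff_ne_zero.mpr fun h => hψd ?_
      rwa [Finsupp.single_eq_zero] at h
    · exact Finsupp.single_le_single.mpr (by omega)

/-- The generating series of the elements `p(χ)`. -/
def pSeries (A : Type*) [CommRing A] [Algebra ℂ A] (h : 𝔨) : MvPowerSeries A (MapEnv A 𝔨) :=
  fun χ => pOne h χ

open scoped Classical in
/-- The generating series of the elements `m(ψ) h ⊗ π(ψ)`. -/
def hSeries (A : Type*) [CommRing A] [Algebra ℂ A] (h : 𝔨) : MvPowerSeries A (MapEnv A 𝔨) :=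
  fun ψ => if ψ = 0 then 0 else (ψ.multinomial : ℂ) • elt h (multisetProd ψ)

theorem coeff_pSeries (h : 𝔨) (χ : A →₀ ℕ) : MvPowerSeries.coeff χ (pSeries A h) = pOne h χ := rfl

open scoped Classical in
theorem coeff_hSeries (h : 𝔨) (ψ : A →₀ ℕ) : MvPowerSeries.coeff ψ (hSeries A h) =
    if ψ = 0 then 0 else (ψ.multinomial : ℂ) • elt h (multisetProd ψ) := rfl

/-- The defining recursion read as a differential equation. Formally, the generating series is the
exponential of `-∑ m(ψ)/|ψ| (h ⊗ π(ψ))` over `ψ ≠ 0`, with the variables suppressed. -/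
theorem euler_pSeries (h : 𝔨) : euler (pSeries A h) = -hSeries A h * pSeries A h :=
  MvPowerSeries.ext fun χ => by
    classical
    rw [coeff_euler, coeff_pSeries, ← Nat.cast_smul_eq_nsmul ℂ, degree_smul_pOne, neg_mul, map_neg,
      MvPowerSeries.coeff_mul, sum_antidiagonal_eq_sum_Iic χ (fun p q =>
        MvPowerSeries.coeff p (hSeries A h) * MvPowerSeries.coeff q (pSeries A h))]
    congr 1
    refine Finset.sum_subset_zero_on_sdiff Finset.Ioc_subset_Iic_self ?_ ?_
    · intro ψ hψ
      obtain ⟨h1, h2⟩ := Finset.mem_sdiff.mp hψ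
      have : ψ = 0 := by
        by_contra h0
        exact h2 (Finset.mem_Ioc.mpr ⟨pos_iff_ne_zero.mpr h0, Finset.mem_Iic.mp h1⟩)
      rw [this, coeff_hSeries, if_pos rfl, zero_mul]
    · intro ψ hψ
      rw [coeff_hSeries, if_neg (Finset.mem_Ioc.mp hψ).1.ne', coeff_pSeries, smul_mul_assoc]

instance {R : Type*} [Ring R] [Algebra ℂ R] : IsAddTorsionFree R :=
  let := Module.compHom R (algebraMap ℚ ℂ)
  IsAddTorsionFree.of_module_rat R

open scoped Classical in
-- The generating series `P` is group-like. As each `h ⊗ a` is primitive, the coproduct of `P` and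
-- the product of its two copies `P ⊗ 1` and `1 ⊗ P` satisfy the same Euler equation with the same
-- constant term.
theorem comul_pOne (h : 𝔨) (χ : A →₀ ℕ) : comul (A ⊗[ℂ] 𝔨) (pOne h χ) =
    ∑ p ∈ Finset.HasAntidiagonal.antidiagonal χ, pOne h p.1 ⊗ₜ pOne h p.2 := by
  set U := MapEnv A 𝔨
  let il : U →+* U ⊗[ℂ] U := (Algebra.TensorProduct.includeLeft : U →ₐ[ℂ] U ⊗[ℂ] U).toRingHom
  let ir : U →+* U ⊗[ℂ] U := (Algebra.TensorProduct.includeRight : U →ₐ[ℂ] U ⊗[ℂ] U).toRingHom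
  let F : U →+* U ⊗[ℂ] U := (comul (A ⊗[ℂ] 𝔨)).toRingHom
  have euler_map : ∀ (g : U →+* U ⊗[ℂ] U) (f : MvPowerSeries A U),
      euler (MvPowerSeries.map g f) = MvPowerSeries.map g (euler f) := by
    intro g f
    ext n
    rw [coeff_euler, MvPowerSeries.coeff_map, MvPowerSeries.coeff_map, coeff_euler, map_nsmul]
  -- Elements of the two tensor factors commute; this lets the product rule bring both copies of
  -- `hSeries` to the left.
  have hcomm : Commute (MvPowerSeries.map ir (hSeries A h)) (MvPowerSeries.map il (pSeries A h)) :=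
    mvPowerSeries_commute fun m n => by
      rw [MvPowerSeries.coeff_map, MvPowerSeries.coeff_map]
      change _ = _
      simp [il, ir]
  have hN : MvPowerSeries.map F (hSeries A h) =
      MvPowerSeries.map il (hSeries A h) + MvPowerSeries.map ir (hSeries A h) := by
    ext n
    rw [map_add, MvPowerSeries.coeff_map, MvPowerSeries.coeff_map, MvPowerSeries.coeff_map,
      coeff_hSeries]
    split_ifs
    · simp
    · change comul _ (_ • _) = (_ • _) ⊗ₜ 1 + 1 ⊗ₜ (_ • _)
      rw [map_smul, elt_eq_env, comul_env, smul_add, TensorProduct.smul_tmul',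
        TensorProduct.tmul_smul]
  have key : MvPowerSeries.map F (pSeries A h) =
      MvPowerSeries.map il (pSeries A h) * MvPowerSeries.map ir (pSeries A h) := by
    refine eq_of_euler_eq (N := -MvPowerSeries.map F (hSeries A h)) ?_ ?_ ?_ ?_
    · rw [map_neg, MvPowerSeries.coeff_map, coeff_hSeries, if_pos rfl, map_zero, neg_zero]
    · rw [euler_map, euler_pSeries, map_mul, map_neg]
    · rw [euler_mul, euler_map, euler_map, euler_pSeries, map_mul, map_mul, map_neg, map_neg, hN,
        neg_mul, neg_mul, neg_mul, mul_neg, ← mul_assoc _ _ (MvPowerSeries.map ir (pSeries A h)),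
        ← hcomm.eq, neg_add, add_mul]
      simp only [neg_mul, mul_assoc]
    · rw [MvPowerSeries.coeff_map, coeff_pSeries, pOne_zero, map_one]
      have h1 : MvPowerSeries.constantCoeff (pSeries A h) = 1 := pOne_zero h
      simp [h1]
  have := congrArg (MvPowerSeries.coeff χ) key
  rw [MvPowerSeries.coeff_map, MvPowerSeries.coeff_mul] at this
  refine this.trans (Finset.sum_congr rfl fun p _ => ?_)
  rw [MvPowerSeries.coeff_map, MvPowerSeries.coeff_map, coeff_pSeries, coeff_pSeries]
  simp [il, ir]

/-- `p(χ)` acts on a weight vector of integral weight `k` by an integral multiple of `π(χ)`. -/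
theorem exists_pOne_apply (k : ℤ) : ∃ z : (A →₀ ℕ) → ℤ, ∀ (h : 𝔨) {M : Type*} [AddCommGroup M]
    [Module ℂ M] (ρ : MapEnv A 𝔨 →ₐ[ℂ] Module.End ℂ M) (j : A → M)
    (_ : ∀ a c, ρ (elt h a) (j c) = (k : ℂ) • j (a * c)) (χ : A →₀ ℕ) (c : A),
    ρ (pOne h χ) (j c) = (z χ : ℂ) • j (multisetProd χ * c) := by
  classical
  -- On weight `k`, the series of the `h ⊗ π(ψ)` acts through `k` times the multinomial series, so
  -- the scalars by which the `p(χ)` act satisfy the recursion for the coefficients of `(1 - ∑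
  -- variables)^k`.
  obtain ⟨z, hz0, hz⟩ := exists_euler_eq (σ := A) k
  refine ⟨fun χ => MvPowerSeries.coeff χ z, fun h M _ _ ρ j hj χ c => ?_⟩
  generalize hd : χ.degree = d
  induction d using Nat.strong_induction_on generalizing χ with
  | _ d ih =>
    by_cases hχ : χ = 0
    · change _ = ((MvPowerSeries.coeff χ z : ℤ) : ℂ) • _
      rw [hχ, pOne_zero, map_one, Module.End.one_apply, hz0, multisetProd_zero, one_mul,
        Int.cast_one, one_smul]
    have hd0 : (χ.degree : ℂ) ≠ 0 :=
      Nat.cast_ne_zero.mpr fun h => hχ ((Finsupp.degree_eq_zero_iff χ).mp h)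
    refine smul_right_injective M hd0 ?_
    have h1 : (χ.degree : ℤ) * MvPowerSeries.coeff χ z =
        -(k * ∑ ψ ∈ Finset.Ioc 0 χ, (ψ.multinomial : ℤ) * MvPowerSeries.coeff (χ - ψ) z) := by
      have := congrArg (MvPowerSeries.coeff χ) hz
      rw [coeff_euler, nsmul_eq_mul, map_neg, map_zsmul, MvPowerSeries.coeff_mul,
        sum_antidiagonal_eq_sum_Iic χ (fun p q => MvPowerSeries.coeff p (multinomialSeries A) *
        MvPowerSeries.coeff q z), smul_eq_mul] at this
      rw [this]
      congr 2
      symm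
      refine Finset.sum_subset_zero_on_sdiff Finset.Ioc_subset_Iic_self ?_ ?_
      · intro ψ hψ
        obtain ⟨h1, h2⟩ := Finset.mem_sdiff.mp hψ
        have : ψ = 0 := by
          by_contra h0
          exact h2 (Finset.mem_Ioc.mpr ⟨pos_iff_ne_zero.mpr h0, Finset.mem_Iic.mp h1⟩)
        rw [this, coeff_multinomialSeries, if_pos rfl, zero_mul]
      · intro ψ hψ
        rw [coeff_multinomialSeries, if_neg (Finset.mem_Ioc.mp hψ).1.ne']
    change (χ.degree : ℂ) • _ = (χ.degree : ℂ) • _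
    rw [← LinearMap.smul_apply, ← map_smul, degree_smul_pOne, smul_smul]
    have h2 : (χ.degree : ℂ) * ((MvPowerSeries.coeff χ z : ℤ) : ℂ) =
        -(k * ∑ ψ ∈ Finset.Ioc 0 χ, (ψ.multinomial : ℂ) * ((MvPowerSeries.coeff (χ - ψ) z : ℤ) : ℂ)) := by
      exact_mod_cast h1
    rw [h2, map_neg, map_sum, LinearMap.neg_apply, LinearMap.sum_apply, Finset.mul_sum, neg_smul,
      Finset.sum_smul]
    congr 1
    refine Finset.sum_congr rfl fun ψ hψ => ?_
    obtain ⟨h0, hle⟩ := Finset.mem_Ioc.mp hψ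
    have h3 : (χ - ψ).degree + ψ.degree = χ.degree := by
      rw [← map_add, tsub_add_cancel_of_le hle]
    have h4 : ψ.degree ≠ 0 := fun h => h0.ne' ((Finsupp.degree_eq_zero_iff _).mp h)
    rw [map_smul, LinearMap.smul_apply, map_mul, Module.End.mul_apply,
      ih (χ - ψ).degree (by omega) _ rfl, map_smul, hj, smul_smul, smul_smul, ← mul_assoc,
      ← multisetProd_add, add_tsub_cancel_of_le hle]
    congr 1
    ring

theorem pOne_mem_filt (h : 𝔨) (χ : A →₀ ℕ) : pOne h χ ∈ filt (A ⊗[ℂ] 𝔨) χ.degree := by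
  classical
  generalize hd : χ.degree = d
  induction d using Nat.strong_induction_on generalizing χ with
  | _ d ih =>
    by_cases hχ : χ = 0
    · rw [hχ, pOne_zero]; exact one_mem_filt _
    have hd0 : (χ.degree : ℂ) ≠ 0 :=
      Nat.cast_ne_zero.mpr fun h => hχ ((Finsupp.degree_eq_zero_iff χ).mp h)
    refine (Submodule.smul_mem_iff _ hd0).mp ?_
    rw [degree_smul_pOne]
    refine neg_mem (sum_mem fun ψ hψ => Submodule.smul_mem _ _ ?_)
    obtain ⟨h0, hle⟩ := Finset.mem_Ioc.mp hψ
    have h1 : (χ - ψ).degree + ψ.degree = χ.degree := by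
      rw [← map_add, tsub_add_cancel_of_le hle]
    have h2 : ψ.degree ≠ 0 := fun h => h0.ne' ((Finsupp.degree_eq_zero_iff _).mp h)
    exact filt_mono (by omega)
      (mul_mem_filt (elt_mem_filt _ _) (ih (χ - ψ).degree (by omega) _ rfl))

theorem counit_pOne (h : 𝔨) {χ : A →₀ ℕ} (hχ : χ ≠ 0) : counit (A ⊗[ℂ] 𝔨) (pOne h χ) = 0 := by
  classical
  have hd0 : (χ.degree : ℂ) ≠ 0 :=
    Nat.cast_ne_zero.mpr fun h => hχ ((Finsupp.degree_eq_zero_iff χ).mp h)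
  have h1 := congrArg (counit (A ⊗[ℂ] 𝔨)) (degree_smul_pOne h χ)
  rw [map_smul, map_neg, map_sum, Finset.sum_eq_zero, neg_zero, smul_eq_zero] at h1
  · exact h1.resolve_left hd0
  · intro ψ _
    rw [map_smul, map_mul, elt_eq_env, counit_env, zero_mul, smul_zero]

/-- The elements `p(χ)` with the sign of their symbol removed. -/
def pSigned (h : 𝔨) (χ : A →₀ ℕ) : MapEnv A 𝔨 := (-1 : ℂ) ^ χ.degree • pOne h χ

theorem pSigned_mem_filt (h : 𝔨) (χ : A →₀ ℕ) : pSigned h χ ∈ filt (A ⊗[ℂ] 𝔨) χ.degree :=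
  Submodule.smul_mem _ _ (pOne_mem_filt h χ)

/-- In the recursion a submultiset of size at least two contributes a single factor of degree one,
hence lower degree. Only the singletons reach the leading term. -/
theorem degree_smul_pSigned_sub_mem (h : 𝔨) {χ : A →₀ ℕ} {d : ℕ} (hd : χ.degree = d + 1) :
    ((d : ℂ) + 1) • pSigned h χ - ∑ a ∈ χ.support, elt h a * pSigned h (χ - Finsupp.single a 1) ∈
      filt (A ⊗[ℂ] 𝔨) d := by
  classical
  have hinj : Set.InjOn (fun a : A => Finsupp.single a 1) χ.support :=
    fun a _ b _ h => (Finsupp.single_left_inj one_ne_zero).mp h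
  have hsub : χ.support.image (fun a : A => Finsupp.single a 1) ⊆ Finset.Ioc 0 χ := by
    intro ψ hψ
    obtain ⟨a, ha, rfl⟩ := Finset.mem_image.mp hψ
    rw [Finset.mem_Ioc, Finsupp.single_le_iff]
    exact ⟨pos_iff_ne_zero.mpr (by simp), Nat.one_le_iff_ne_zero.mpr (Finsupp.mem_support_iff.mp ha)⟩
  have h1 : ((d : ℂ) + 1) • pSigned h χ = ∑ ψ ∈ Finset.Ioc 0 χ, -(-1 : ℂ) ^ χ.degree •
      ((ψ.multinomial : ℂ) • (elt h (multisetProd ψ) * pOne h (χ - ψ))) := by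
    rw [pSigned, smul_comm, show (d : ℂ) + 1 = (χ.degree : ℂ) by rw [hd]; push_cast; rfl,
      degree_smul_pOne, smul_neg, ← neg_smul, Finset.smul_sum]
  rw [h1, ← Finset.sum_sdiff hsub, Finset.sum_image hinj, add_sub_assoc, ← Finset.sum_sub_distrib]
  refine add_mem (sum_mem fun ψ hψ => ?_) (sum_mem fun a ha => ?_)
  · obtain ⟨hψ1, hψ2⟩ := Finset.mem_sdiff.mp hψ
    obtain ⟨h0, hle⟩ := Finset.mem_Ioc.mp hψ1
    have h3 : (χ - ψ).degree + ψ.degree = χ.degree := by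
      rw [← map_add, tsub_add_cancel_of_le hle]
    have h4 : ψ.degree ≠ 0 := fun h => h0.ne' ((Finsupp.degree_eq_zero_iff _).mp h)
    have h5 : ψ.degree ≠ 1 := by
      intro h
      obtain ⟨a, rfl⟩ := eq_single_of_degree_eq_one h
      refine hψ2 (Finset.mem_image.mpr ⟨a, ?_, rfl⟩)
      rw [Finsupp.single_le_iff] at hle
      rw [Finsupp.mem_support_iff]
      omega
    exact Submodule.smul_mem _ _ (Submodule.smul_mem _ _ (filt_mono (by omega)
      (mul_mem_filt (elt_mem_filt _ _) (pOne_mem_filt h (χ - ψ)))))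
  · have hle : Finsupp.single a 1 ≤ χ := by
      rw [Finsupp.single_le_iff]
      exact Nat.one_le_iff_ne_zero.mpr (Finsupp.mem_support_iff.mp ha)
    have h3 := degree_add_single (χ - Finsupp.single a 1) a
    rw [tsub_add_cancel_of_le hle] at h3
    rw [multinomial_single, multisetProd_single, pow_one, Nat.cast_one, one_smul, pSigned, h3,
      mul_smul_comm, pow_succ]
    simp

/-- The symbol of `p(χ)` is, up to sign, a product of divided powers. -/
theorem elt_mul_pSigned_sub_mem (h : 𝔨) (χ : A →₀ ℕ) (b : A) :
    elt h b * pSigned h χ - ((χ b : ℂ) + 1) • pSigned h (χ + Finsupp.single b 1) ∈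
      filt (A ⊗[ℂ] 𝔨) χ.degree := by
  classical
  generalize hd : χ.degree = d
  induction d using Nat.strong_induction_on generalizing χ b with
  | _ d ih =>
    have hc : ((d : ℂ) + 1) ≠ 0 := Nat.cast_add_one_ne_zero _
    have hcb : ((χ b : ℂ) + 1) ≠ 0 := Nat.cast_add_one_ne_zero _
    refine (Submodule.smul_mem_iff _ hc).mp ?_
    have h1 := Submodule.smul_mem _ ((χ b : ℂ) + 1) (degree_smul_pSigned_sub_mem h
      (χ := χ + Finsupp.single b 1) (d := d) (by rw [degree_add_single, hd]))
    have hsupp : (χ + Finsupp.single b 1).support = insert b (χ.support.erase b) := by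
      ext a
      by_cases hab : a = b
      · simp [hab]
      · simp [hab, Finsupp.single_eq_of_ne hab]
    rw [hsupp, Finset.sum_insert (Finset.notMem_erase b _), add_tsub_cancel_right] at h1
    -- With `χ = φ + a`, the induction hypothesis at `φ` shows that both terms have the leading part
    -- of `(χ b + 1) (χ a)` times `pSigned h (χ + b)` multiplied by nothing but commuting factors
    -- removed: each is congruent to `(h ⊗ a)(h ⊗ b) pSigned h φ`.
    have h2 : ∀ a ∈ χ.support.erase b, ((χ b : ℂ) + 1) •
        (elt h a * pSigned h (χ + Finsupp.single b 1 - Finsupp.single a 1)) -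
        (χ a : ℂ) • (elt h b * pSigned h χ) ∈ filt (A ⊗[ℂ] 𝔨) d := by
      intro a ha
      obtain ⟨hab, ha⟩ := Finset.mem_erase.mp ha
      obtain ⟨φ, rfl⟩ : ∃ φ, χ = φ + Finsupp.single a 1 :=
        ⟨χ - Finsupp.single a 1, (tsub_add_cancel_of_le (by
          rw [Finsupp.single_le_iff]
          exact Nat.one_le_iff_ne_zero.mpr (Finsupp.mem_support_iff.mp ha))).symm⟩
      rw [degree_add_single] at hd
      have hφb : (φ + Finsupp.single a 1 : A →₀ ℕ) b = φ b := by
        rw [Finsupp.add_apply, Finsupp.single_eq_of_ne (Ne.symm hab), add_zero]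
      rw [add_right_comm, add_tsub_cancel_right, hφb, Finsupp.add_apply, Finsupp.single_eq_same]
      have h3 := ih φ.degree (by omega) φ b rfl
      have h4 : elt h a * pSigned h φ - ((φ a : ℂ) + 1) • pSigned h (φ + Finsupp.single a 1) ∈
          filt (A ⊗[ℂ] 𝔨) φ.degree := ih φ.degree (by omega) φ a rfl
      have h5 := sub_mem (mul_mem_filt (elt_mem_filt h b) h4) (mul_mem_filt (elt_mem_filt h a) h3)
      rw [show 1 + φ.degree = d by omega] at h5
      convert h5 using 1
      have hab' := (commute_elt h a b).eq
      rw [mul_sub, mul_sub, ← mul_assoc, ← mul_assoc, hab', mul_smul_comm, mul_smul_comm]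
      push_cast
      abel
    have h3 := sub_mem (neg_mem h1) (sum_mem h2)
    -- The multiples `χ a` produced by `h2`, together with `χ b + 1` from the term of `b`, add up to
    -- `d + 1`, which cancels the factor introduced at the start.
    have hsum : (d : ℂ) = χ b + ∑ a ∈ χ.support.erase b, (χ a : ℂ) := by
      rw [← hd, Finsupp.degree_apply]
      push_cast
      by_cases hb : b ∈ χ.support
      · exact (Finset.add_sum_erase _ (fun a => (χ a : ℂ)) hb).symm
      · rw [Finset.erase_eq_of_notMem hb, Finsupp.notMem_support_iff.mp hb]
        simp
    convert h3 using 1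
    rw [Finset.sum_sub_distrib, ← Finset.smul_sum, ← Finset.sum_smul]
    rw [hsum]
    module

theorem map_pOne {𝔩 : Type*} [LieRing 𝔩] [LieAlgebra ℂ 𝔩] (F : MapEnv A 𝔨 →ₐ[ℂ] MapEnv A 𝔩)
    (h : 𝔨) (h' : 𝔩) (hF : ∀ a : A, F (elt h a) = elt h' a) (χ : A →₀ ℕ) :
    F (pOne h χ) = pOne h' χ := map_pElt F h h' hF _ _

end POne

end MapAlgebra

end

noncomputable section

namespace MapAlgebra

/-! ### Divided powers -/

section DividedPowers

variable {U : Type*} [Ring U] [Algebra ℂ U]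

@[simp] theorem dpow_zero (u : U) : dpow u 0 = 1 := by simp [dpow]

theorem dpow_one (u : U) : dpow u 1 = u := by simp [dpow]

theorem succ_smul_dpow_succ (u : U) (r : ℕ) :
    ((r : ℂ) + 1) • dpow u (r + 1) = u * dpow u r := by
  rw [dpow, dpow, mul_smul_comm, ← pow_succ', smul_smul, Nat.factorial_succ]
  congr 1
  push_cast
  rw [mul_inv, ← mul_assoc, mul_inv_cancel₀ (Nat.cast_add_one_ne_zero r), one_mul]

theorem map_dpow {V : Type*} [Ring V] [Algebra ℂ V] (F : U →ₐ[ℂ] V) (u : U) (r : ℕ) :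
    F (dpow u r) = dpow (F u) r := by
  rw [dpow, dpow, map_smul, map_pow]

theorem dpow_add {u v : U} (h : Commute u v) (r : ℕ) :
    dpow (u + v) r = ∑ p ∈ Finset.HasAntidiagonal.antidiagonal r, dpow u p.1 * dpow v p.2 := by
  rw [dpow, h.add_pow', Finset.smul_sum]
  refine Finset.sum_congr rfl fun p hp => ?_
  rw [dpow, dpow, smul_mul_smul_comm, ← Nat.cast_smul_eq_nsmul ℂ, smul_smul]
  congr 1
  have h1 : p.1 + p.2 = r := Finset.HasAntidiagonal.mem_antidiagonal.mp hp
  rw [← h1, Nat.cast_add_choose ℂ]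
  have := Nat.cast_ne_zero (R := ℂ).mpr (Nat.factorial_ne_zero (p.1 + p.2))
  field_simp

theorem dpow_smul (c : ℂ) (u : U) (r : ℕ) : dpow (c • u) r = c ^ r • dpow u r := by
  rw [dpow, dpow, smul_pow, smul_comm]

variable {𝔞 : Type*} [LieRing 𝔞] [LieAlgebra ℂ 𝔞]

theorem comul_dpow (x : 𝔞) (r : ℕ) : comul 𝔞 (dpow (env x) r) =
    ∑ p ∈ Finset.HasAntidiagonal.antidiagonal r, dpow (env x) p.1 ⊗ₜ dpow (env x) p.2 := by
  have hl : ∀ i, dpow (env x ⊗ₜ[ℂ] (1 : Env 𝔞)) i = dpow (env x) i ⊗ₜ 1 := fun i =>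
    (map_dpow (Algebra.TensorProduct.includeLeft : Env 𝔞 →ₐ[ℂ] Env 𝔞 ⊗[ℂ] Env 𝔞) (env x) i).symm
  have hr : ∀ i, dpow ((1 : Env 𝔞) ⊗ₜ[ℂ] env x) i = 1 ⊗ₜ dpow (env x) i := fun i =>
    (map_dpow (Algebra.TensorProduct.includeRight : Env 𝔞 →ₐ[ℂ] Env 𝔞 ⊗[ℂ] Env 𝔞) (env x) i).symm
  rw [map_dpow, comul_env, dpow_add (by simp [Commute, SemiconjBy])]
  exact Finset.sum_congr rfl fun p _ => by simp [hl, hr]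

theorem counit_dpow (x : 𝔞) {r : ℕ} (hr : r ≠ 0) : counit 𝔞 (dpow (env x) r) = 0 := by
  rw [map_dpow, counit_env, dpow, zero_pow hr, smul_zero]

end DividedPowers

/-! ### Multisets supported in a given set -/

section MultisetsIn

variable {A : Type*} {B : Set A}

theorem add_mem_multisetsIn {φ ψ : A →₀ ℕ} (hφ : φ ∈ multisetsIn B) (hψ : ψ ∈ multisetsIn B) :
    φ + ψ ∈ multisetsIn B := by
  classical
  intro a ha
  rcases Finset.mem_union.mp (Finsupp.support_add ha) with h | h
  exacts [hφ h, hψ h]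

theorem mem_multisetsIn_of_le {φ ψ : A →₀ ℕ} (h : φ ≤ ψ) (hψ : ψ ∈ multisetsIn B) :
    φ ∈ multisetsIn B :=
  fun _ ha => hψ (Finsupp.support_mono h ha)

theorem single_mem_multisetsIn {b : A} (hb : b ∈ B) (k : ℕ) :
    Finsupp.single b k ∈ multisetsIn B := by
  intro a ha
  rw [Finset.mem_singleton.mp (Finsupp.support_single_subset ha)]
  exact hb

theorem zero_mem_multisetsIn : (0 : A →₀ ℕ) ∈ multisetsIn B := by
  intro a ha
  simp at ha

end MultisetsIn

/-! ### Integral forms and their lattices -/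

section IntForm

variable {A 𝔨 : Type*} [CommRing A] [Algebra ℂ A] [LieRing 𝔨] [LieAlgebra ℂ 𝔨]

/-- The divided powers of the elements `e ⊗ b`, for `e ∈ E` and `b ∈ B`, and the elements `p(χ)`
attached to the elements of `T`. -/
def intGen (E T : Set 𝔨) (B : Set A) : Set (MapEnv A 𝔨) :=
  {u | ∃ e ∈ E, ∃ b ∈ B, ∃ r : ℕ, u = dpow (elt e b) r} ∪
    {u | ∃ t ∈ T, ∃ χ ∈ multisetsIn B, u = pOne t χ}

/-- The subring generated by `intGen E T B`. -/
def intForm (E T : Set 𝔨) (B : Set A) : Subalgebra ℤ (MapEnv A 𝔨) :=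
  Algebra.adjoin ℤ (intGen E T B)

variable {E T : Set 𝔨} {B : Set A}

theorem dpow_mem_intForm {e : 𝔨} (he : e ∈ E) {b : A} (hb : b ∈ B) (r : ℕ) :
    dpow (elt e b) r ∈ intForm E T B :=
  Algebra.subset_adjoin (Or.inl ⟨e, he, b, hb, r, rfl⟩)

theorem pOne_mem_intForm {t : 𝔨} (ht : t ∈ T) {χ : A →₀ ℕ} (hχ : χ ∈ multisetsIn B) :
    pOne t χ ∈ intForm E T B :=
  Algebra.subset_adjoin (Or.inr ⟨t, ht, χ, hχ, rfl⟩)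

/-- Both families of generators behave as divided powers under the coproduct, which splits an index
into two parts in all ways with coefficient one. -/
theorem comul_mem_intForm {r : MapEnv A 𝔨} (hr : r ∈ intForm E T B) :
    comul (A ⊗[ℂ] 𝔨) r ∈ tensorSpan (intForm E T B) := by
  classical
  refine comul_mem_tensorSpan ?_ hr
  rintro _ (⟨e, he, b, hb, r, rfl⟩ | ⟨t, ht, χ, hχ, rfl⟩)
  · rw [elt_eq_env, comul_dpow]
    exact sum_mem fun p _ => tmul_mem_tensorSpan (dpow_mem_intForm he hb _)
      (dpow_mem_intForm he hb _)
  · rw [comul_pOne]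
    refine sum_mem fun p hp => ?_
    have h1 := Finset.HasAntidiagonal.mem_antidiagonal.mp hp
    exact tmul_mem_tensorSpan
      (pOne_mem_intForm ht (mem_multisetsIn_of_le (h1 ▸ le_self_add) hχ))
      (pOne_mem_intForm ht (mem_multisetsIn_of_le (h1 ▸ le_add_self) hχ))

theorem IsMulClosedBasis.pow_mem (hB : IsMulClosedBasis B) {b : A} (hb : b ∈ B) {k : ℕ}
    (hk : k ≠ 0) : b ^ k ∈ B := by
  obtain ⟨k, rfl⟩ := Nat.exists_eq_succ_of_ne_zero hk
  induction k with
  | zero => simpa using hb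
  | succ k ih =>
    rw [pow_succ]
    exact hB.mul_mem _ (ih (by omega)) _ hb

theorem IsMulClosedBasis.multisetProd_mem (hB : IsMulClosedBasis B) {χ : A →₀ ℕ}
    (hχ : χ ∈ multisetsIn B) (h0 : χ ≠ 0) : multisetProd χ ∈ B :=
  Finset.prod_induction_nonempty _ (· ∈ B) (fun a b ha hb => hB.mul_mem a ha b hb)
    (Finsupp.support_nonempty_iff.mpr h0)
    fun _ ha => hB.pow_mem (hχ ha) (Finsupp.mem_support_iff.mp ha)

/-- The basis given by a multiplicatively closed basis. -/
def IsMulClosedBasis.basis (hB : IsMulClosedBasis B) : Module.Basis B ℂ A :=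
  Module.Basis.mk hB.linearIndepOn (by simpa using hB.span_eq_top.ge)

theorem IsMulClosedBasis.basis_apply (hB : IsMulClosedBasis B) (b : B) : hB.basis b = b := by
  simp [IsMulClosedBasis.basis]

theorem IsMulClosedBasis.coord_apply [DecidableEq B] (hB : IsMulClosedBasis B) (b c : B) :
    hB.basis.coord b (c : A) = if c = b then 1 else 0 := by
  rw [← hB.basis_apply c, Module.Basis.coord_apply, Module.Basis.repr_self,
    Finsupp.single_apply]

/-- The module `A ⊗ V` for the map algebra. -/
def MapMod (A V : Type*) [CommRing A] [Algebra ℂ A] [AddCommGroup V] [Module ℂ V] : Type _ :=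
  A ⊗[ℂ] V

/-! ### The representation of the map algebra on `A ⊗ V` -/

section MapMod

variable {V : Type*} [AddCommGroup V] [Module ℂ V]

instance : AddCommGroup (MapMod A V) := inferInstanceAs (AddCommGroup (A ⊗[ℂ] V))

instance : Module ℂ (MapMod A V) := inferInstanceAs (Module ℂ (A ⊗[ℂ] V))

/-- The pure tensors. -/
def mtmul : A →ₗ[ℂ] V →ₗ[ℂ] MapMod A V := TensorProduct.mk ℂ A V

/-- The linear map out of `A ⊗ V` attached to a bilinear map. -/
def mapModLift {W : Type*} [AddCommGroup W] [Module ℂ W] (f : A →ₗ[ℂ] V →ₗ[ℂ] W) :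
    MapMod A V →ₗ[ℂ] W := TensorProduct.lift f

@[simp] theorem mapModLift_mtmul {W : Type*} [AddCommGroup W] [Module ℂ W]
    (f : A →ₗ[ℂ] V →ₗ[ℂ] W) (a : A) (v : V) : mapModLift f (mtmul a v) = f a v :=
  TensorProduct.lift.tmul a v

theorem mapMod_hom_ext {W : Type*} [AddCommGroup W] [Module ℂ W] {f g : MapMod A V →ₗ[ℂ] W}
    (h : ∀ a v, f (mtmul a v) = g (mtmul a v)) : f = g := TensorProduct.ext' h

/-- The action of a map algebra on `A ⊗ V`. -/
def mapAct (τ : 𝔨 →ₗ[ℂ] Module.End ℂ V) : A ⊗[ℂ] 𝔨 →ₗ[ℂ] Module.End ℂ (MapMod A V) :=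
  TensorProduct.lift (LinearMap.mk₂ ℂ
    (fun a z => mapModLift ((mtmul ∘ₗ LinearMap.mulLeft ℂ a).compl₂ (τ z)))
    (fun a b z => mapMod_hom_ext fun c v => by simp [add_mul])
    (fun k a z => mapMod_hom_ext fun c v => by simp)
    (fun a z w => mapMod_hom_ext fun c v => by simp)
    (fun k a z => mapMod_hom_ext fun c v => by simp))

theorem mapAct_tmul (τ : 𝔨 →ₗ[ℂ] Module.End ℂ V) (a : A) (z : 𝔨) (c : A) (v : V) :
    mapAct τ (a ⊗ₜ z) (mtmul c v) = mtmul (a * c) (τ z v) := by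
  simp [mapAct]

theorem mapAct_lie {τ : 𝔨 →ₗ[ℂ] Module.End ℂ V} (hτ : ∀ x y, τ ⁅x, y⁆ = τ x * τ y - τ y * τ x)
    (x y : A ⊗[ℂ] 𝔨) :
    mapAct τ ⁅x, y⁆ = mapAct τ x * mapAct τ y - mapAct τ y * mapAct τ x := by
  induction x with
  | zero => simp
  | add x x' hx hx' => simp only [add_lie, map_add, add_mul, mul_add, hx, hx']; abel
  | tmul a x =>
    induction y with
    | zero => simp
    | add y y' hy hy' => simp only [lie_add, map_add, add_mul, mul_add, hy, hy']; abel
    | tmul b y =>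
      rw [LieAlgebra.ExtendScalars.bracket_tmul]
      refine mapMod_hom_ext fun c v => ?_
      simp only [mapAct_tmul, LinearMap.sub_apply, Module.End.mul_apply, hτ, map_sub]
      rw [← mul_assoc, ← mul_assoc, mul_comm b a]

/-- The action of the enveloping algebra of a map algebra on `A ⊗ V`. -/
def mapRep (τ : 𝔨 →ₗ[ℂ] Module.End ℂ V) (hτ : ∀ x y, τ ⁅x, y⁆ = τ x * τ y - τ y * τ x) :
    MapEnv A 𝔨 →ₐ[ℂ] Module.End ℂ (MapMod A V) :=
  envLift (mapAct τ) (mapAct_lie hτ)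

theorem mapRep_elt (τ : 𝔨 →ₗ[ℂ] Module.End ℂ V)
    (hτ : ∀ x y, τ ⁅x, y⁆ = τ x * τ y - τ y * τ x) (z : 𝔨) (a c : A) (v : V) :
    mapRep τ hτ (elt z a) (mtmul c v) = mtmul (a * c) (τ z v) := by
  rw [elt_eq_env, mapRep, envLift_env, mapAct_tmul]

theorem mapRep_dpow (τ : 𝔨 →ₗ[ℂ] Module.End ℂ V)
    (hτ : ∀ x y, τ ⁅x, y⁆ = τ x * τ y - τ y * τ x) (z : 𝔨) (a c : A) (r : ℕ) (v : V) :
    mapRep τ hτ (dpow (elt z a) r) (mtmul c v) = mtmul (a ^ r * c) (dpow (τ z) r v) := by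
  have h : ∀ r, (mapRep τ hτ (elt z a) ^ r) (mtmul c v) = mtmul (a ^ r * c) ((τ z ^ r) v) := by
    intro r
    induction r with
    | zero => simp
    | succ r ih => rw [pow_succ', Module.End.mul_apply, ih, mapRep_elt, pow_succ' a, mul_assoc,
        pow_succ' (τ z), Module.End.mul_apply]
  rw [map_dpow, dpow, dpow, LinearMap.smul_apply, LinearMap.smul_apply, h, map_smul]

end MapMod

/-- A lattice in a representation, stable under the divided powers of the elements of `E` and
spanned by weight vectors of integral weight for the elements of `T`. -/
structure IsAdmissibleLattice {V : Type*} [AddCommGroup V] [Module ℂ V]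
    (τ : 𝔨 →ₗ[ℂ] Module.End ℂ V) (E T : Set 𝔨) (N : Submodule ℤ V) : Prop where
  dpow_mem : ∀ e ∈ E, ∀ r, ∀ v ∈ N, dpow (τ e) r v ∈ N
  le_span : ∀ t ∈ T, N ≤ Submodule.span ℤ {v | v ∈ N ∧ ∃ k : ℤ, τ t v = (k : ℂ) • v}

/-- Matrix coefficients of an admissible lattice take integral values on the integral form. -/
theorem exists_integral_functional (hB : IsMulClosedBasis B) {V : Type*} [AddCommGroup V]
    [Module ℂ V] {τ : 𝔨 →ₗ[ℂ] Module.End ℂ V} (hτ : ∀ x y, τ ⁅x, y⁆ = τ x * τ y - τ y * τ x)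
    {N : Submodule ℤ V} (hN : IsAdmissibleLattice τ E T N) {v : V} (hv : v ∈ N)
    (φ : V →ₗ[ℂ] ℂ) (hφ : ∀ w ∈ N, φ w ∈ intC) (b : B) :
    ∃ f : MapEnv A 𝔨 →ₗ[ℂ] ℂ, f 1 = 0 ∧
      (∀ z c, f (elt z c) = hB.basis.coord b c * φ (τ z v)) ∧
      ∀ r ∈ intForm E T B, f r ∈ intC := by
  classical
  set ρ := mapRep (A := A) τ hτ
  set ε := counit (A ⊗[ℂ] 𝔨)
  let Λ : Submodule ℤ (MapMod A V) := Submodule.span ℤ {t | ∃ c ∈ B, ∃ w ∈ N, t = mtmul c w}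
  have hΛ : ∀ c ∈ B, ∀ w ∈ N, mtmul c w ∈ Λ := fun c hc w hw =>
    Submodule.subset_span ⟨c, hc, w, hw, rfl⟩
  -- Since `1` need not belong to `B`, the vector `1 ⊗ w` need not lie in `Λ`. Subtracting the
  -- counit removes the only obstruction: any generator other than a scalar multiplies the
  -- `A`-component by an element of `B`.
  have key : ∀ r ∈ intForm E T B, ε r ∈ intC ∧ ∀ c, (c = 1 ∨ c ∈ B) → ∀ w ∈ N,
      ρ r (mtmul c w) - ε r • (mtmul c w) ∈ Λ := by
    intro r hr
    induction hr using Algebra.adjoin_induction with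
    | mem g hg =>
      rcases hg with ⟨e, he, a, ha, r, rfl⟩ | ⟨t, ht, χ, hχ, rfl⟩
      · by_cases hr : r = 0
        · subst hr
          simp [intC, one_mem, ε]
        · have h0 : ε (dpow (elt e a) r) = 0 := counit_dpow _ hr
          rw [h0]
          refine ⟨zero_mem _, fun c hc w hw => ?_⟩
          rw [zero_smul, sub_zero, mapRep_dpow]
          refine hΛ _ ?_ _ (hN.dpow_mem e he r w hw)
          rcases hc with rfl | hc
          · rw [mul_one]; exact hB.pow_mem ha hr
          · exact hB.mul_mem _ (hB.pow_mem ha hr) _ hc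
      · by_cases hχ0 : χ = 0
        · subst hχ0
          simp [intC, one_mem, ε]
        · have h0 : ε (pOne t χ) = 0 := counit_pOne t hχ0
          rw [h0]
          refine ⟨zero_mem _, fun c hc w hw => ?_⟩
          rw [zero_smul, sub_zero]
          have h1 : multisetProd χ * c ∈ B := by
            rcases hc with rfl | hc
            · rw [mul_one]; exact hB.multisetProd_mem hχ hχ0
            · exact hB.mul_mem _ (hB.multisetProd_mem hχ hχ0) _ hc
          refine Submodule.span_induction (p := fun w _ => ρ (pOne t χ) (mtmul c w) ∈ Λ)
            ?_ (by simp) ?_ ?_ (hN.le_span t ht hw)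
          · rintro w ⟨hw, k, hk⟩
            obtain ⟨z, hz⟩ := exists_pOne_apply (A := A) (𝔨 := 𝔨) k
            rw [hz t ρ (fun c => mtmul c w) ?_ χ c]
            · exact zsmul_eq_of_mem_intC (intCast_mem_intC _) (hΛ _ h1 _ hw)
            · intro a c
              rw [mapRep_elt, hk, map_smul]
          · intro x y _ _ hx hy
            rw [map_add, map_add]
            exact add_mem hx hy
          · intro k x _ hx
            rw [map_zsmul, map_zsmul]
            exact Submodule.smul_mem _ _ hx
    | algebraMap z =>
      rw [eq_intCast, map_intCast, map_intCast]
      refine ⟨intCast_mem_intC z, fun c _ w _ => ?_⟩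
      rw [Module.End.intCast_apply, Int.cast_smul_eq_zsmul ℂ, sub_self]
      exact zero_mem _
    | add x y _ _ hx hy =>
      refine ⟨by rw [map_add]; exact add_mem hx.1 hy.1, fun c hc w hw => ?_⟩
      rw [map_add, map_add, LinearMap.add_apply, add_smul, add_sub_add_comm]
      exact add_mem (hx.2 c hc w hw) (hy.2 c hc w hw)
    | mul x y _ _ hx hy =>
      refine ⟨by rw [map_mul]; exact mul_mem hx.1 hy.1, fun c hc w hw => ?_⟩
      have hstable : ∀ t ∈ Λ, ρ x t ∈ Λ := by
        intro t ht
        refine Submodule.span_induction (p := fun t _ => ρ x t ∈ Λ) ?_ (by simp) ?_ ?_ ht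
        · rintro _ ⟨c, hc, w, hw, rfl⟩
          exact mem_of_sub_mem (hx.2 c (Or.inr hc) w hw) (zsmul_eq_of_mem_intC hx.1 (hΛ c hc w hw))
        · intro s t _ _ hs ht
          rw [map_add]; exact add_mem hs ht
        · intro k t _ ht
          rw [map_zsmul]; exact Submodule.smul_mem _ _ ht
      -- Uses `x y t - ε(x) ε(y) t = x (y t - ε(y) t) + ε(y) (x t - ε(x) t)`.
      have h1 := add_mem (hstable _ (hy.2 c hc w hw))
        (zsmul_eq_of_mem_intC hy.1 (hx.2 c hc w hw))
      convert h1 using 1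
      rw [map_mul, map_mul, Module.End.mul_apply, map_sub, map_smul, smul_sub, smul_smul,
        mul_comm (ε x)]
      abel
  let F : MapMod A V →ₗ[ℂ] ℂ := mapModLift ((LinearMap.mul ℂ ℂ).compl₁₂ (hB.basis.coord b) φ)
  -- The matrix coefficient at `1 ⊗ v`, with the counit part removed so that it vanishes at `1` and
  -- takes the values controlled by `key`.
  refine ⟨F ∘ₗ (LinearMap.applyₗ (mtmul (1 : A) v) ∘ₗ ρ.toLinearMap -
    ε.toLinearMap.smulRight (mtmul (1 : A) v)), by simp, fun z c => ?_, fun r hr => ?_⟩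
  · have h0 : ε (elt z c) = 0 := counit_env _
    have h1 : ρ (elt z c) (mtmul (1 : A) v) = mtmul c (τ z v) := by rw [mapRep_elt, mul_one]
    simp [F, h0, h1]
  · have h1 := (key r hr).2 1 (Or.inl rfl) v hv
    change F (ρ r (mtmul (1 : A) v) - ε r • (mtmul (1 : A) v)) ∈ intC
    refine Submodule.span_induction (p := fun t _ => F t ∈ intC) ?_ (by simp [zero_mem]) ?_ ?_ h1
    · rintro _ ⟨c, hc, w, hw, rfl⟩
      rw [mapModLift_mtmul]
      change hB.basis.coord b c * φ w ∈ intC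
      refine mul_mem ?_ (hφ w hw)
      rw [hB.coord_apply b ⟨c, hc⟩]
      split_ifs
      exacts [one_mem _, zero_mem _]
    · intro s t _ _ hs ht
      rw [map_add]; exact add_mem hs ht
    · intro k t _ ht
      rw [map_zsmul]; exact zsmul_mem ht k

theorem counit_mem_intForm {r : MapEnv A 𝔨} (hr : r ∈ intForm E T B) :
    counit (A ⊗[ℂ] 𝔨) r ∈ intC := by
  induction hr using Algebra.adjoin_induction with
  | mem g hg =>
    rcases hg with ⟨e, he, a, ha, r, rfl⟩ | ⟨t, ht, χ, hχ, rfl⟩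
    · by_cases hr : r = 0
      · simp [hr, one_mem]
      · rw [elt_eq_env, counit_dpow _ hr]
        exact zero_mem _
    · by_cases hχ0 : χ = 0
      · simp [hχ0, one_mem]
      · rw [counit_pOne t hχ0]
        exact zero_mem _
  | algebraMap z =>
    rw [eq_intCast, map_intCast]
    exact intCast_mem_intC z
  | add x y _ _ hx hy => rw [map_add]; exact add_mem hx hy
  | mul x y _ _ hx hy => rw [map_mul]; exact mul_mem hx hy

end IntForm

end MapAlgebra

end

noncomputable section

namespace MapAlgebra

/-! ### Ordered monomials -/

section Blocks

variable {A 𝔨 : Type*} [CommRing A] [Algebra ℂ A] [LieRing 𝔨] [LieAlgebra ℂ 𝔨]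

/-- The elements `u ψ` have the symbols of the products of divided powers `(z ⊗ b)^(ψ(b))`. -/
structure IsBlock (z : 𝔨) (u : (A →₀ ℕ) → MapEnv A 𝔨) : Prop where
  zero : u 0 = 1
  mem : ∀ ψ, u ψ ∈ filt (A ⊗[ℂ] 𝔨) ψ.degree
  mul_sub_mem : ∀ ψ b, elt z b * u ψ - ((ψ b : ℂ) + 1) • u (ψ + Finsupp.single b 1) ∈
    filt (A ⊗[ℂ] 𝔨) ψ.degree

theorem isBlock_pSigned (h : 𝔨) : IsBlock h (pSigned (A := A) h) where
  zero := by simp [pSigned]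
  mem := pSigned_mem_filt h
  mul_sub_mem := elt_mul_pSigned_sub_mem h

theorem dpow_commute (z : 𝔨) (ψ : A →₀ ℕ) (S : Set A) :
    S.Pairwise (Function.onFun Commute fun a => dpow (elt z a) (ψ a)) :=
  fun a _ b _ _ => commute_dpow (commute_elt z a b) _ _

theorem dpowProd_eq_of_subset (z : 𝔨) (ψ : A →₀ ℕ) {S : Finset A} (hS : ψ.support ⊆ S) :
    dpowProd z ψ = S.noncommProd (fun a => dpow (elt z a) (ψ a)) (dpow_commute z ψ _) := by
  classical
  have h1 : S = ψ.support ∪ (S \ ψ.support) := (Finset.union_sdiff_of_subset hS).symm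
  have h2 := Finset.noncommProd_union_of_disjoint (s := ψ.support) (t := S \ ψ.support)
    Finset.disjoint_sdiff (fun a => dpow (elt z a) (ψ a)) (dpow_commute z ψ _)
  rw [Finset.noncommProd_eq_pow_card (S \ ψ.support) _ _ 1, one_pow, mul_one] at h2
  · rw [dpowProd, ← h2]
    exact Finset.noncommProd_congr h1.symm (fun _ _ => rfl) _
  · intro a ha
    rw [Finset.mem_sdiff, Finsupp.notMem_support_iff] at ha
    rw [ha.2, dpow_zero]

theorem dpowProd_zero (z : 𝔨) : dpowProd z (0 : A →₀ ℕ) = 1 := by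
  simp [dpowProd]

theorem elt_mul_dpowProd (z : 𝔨) (ψ : A →₀ ℕ) (b : A) :
    elt z b * dpowProd z ψ = ((ψ b : ℂ) + 1) • dpowProd z (ψ + Finsupp.single b 1) := by
  classical
  have h1 : (ψ + Finsupp.single b 1).support ⊆ insert b ψ.support := by
    intro a ha
    by_contra h
    simp only [Finset.mem_insert, not_or, Finsupp.notMem_support_iff] at h
    simp [h.2, Finsupp.single_eq_of_ne h.1] at ha
  rw [dpowProd_eq_of_subset z _ h1, dpowProd_eq_of_subset z ψ (Finset.subset_insert b _),
    ← Finset.mul_noncommProd_erase _ (Finset.mem_insert_self b _) _ (dpow_commute z ψ _),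
    ← Finset.mul_noncommProd_erase _ (Finset.mem_insert_self b _) _ (dpow_commute z _ _),
    ← smul_mul_assoc, Finsupp.add_apply, Finsupp.single_eq_same, succ_smul_dpow_succ, mul_assoc]
  congr 2
  refine Finset.noncommProd_congr rfl (fun a ha => ?_) _
  rw [Finsupp.add_apply, Finsupp.single_eq_of_ne (Finset.ne_of_mem_erase ha), add_zero]

theorem dpowProd_mem_filt (z : 𝔨) (ψ : A →₀ ℕ) : dpowProd z ψ ∈ filt (A ⊗[ℂ] 𝔨) ψ.degree := by
  generalize hd : ψ.degree = d
  induction d generalizing ψ with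
  | zero =>
    rw [(Finsupp.degree_eq_zero_iff ψ).mp hd, dpowProd_zero]
    exact one_mem_filt 0
  | succ d ih =>
    obtain ⟨φ, a, rfl⟩ := exists_eq_add_single (ψ := ψ) (by rintro rfl; simp at hd)
    rw [degree_add_single, Nat.succ_inj] at hd
    refine (Submodule.smul_mem_iff _ (Nat.cast_add_one_ne_zero (R := ℂ) (φ a))).mp ?_
    rw [← elt_mul_dpowProd]
    exact env_mul_mem_filt _ (ih φ hd)

theorem isBlock_dpowProd (z : 𝔨) : IsBlock z (dpowProd (A := A) z) where
  zero := dpowProd_zero z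
  mem := dpowProd_mem_filt z
  mul_sub_mem ψ b := by rw [elt_mul_dpowProd, sub_self]; exact zero_mem _

theorem dpowProd_mem {S : Subalgebra ℤ (MapEnv A 𝔨)} {B : Set A} {z : 𝔨}
    (h : ∀ b ∈ B, ∀ r, dpow (elt z b) r ∈ S) {ψ : A →₀ ℕ} (hψ : ψ ∈ multisetsIn B) :
    dpowProd z ψ ∈ S :=
  S.toSubmonoid.noncommProd_mem _ _ _ fun a ha => h a (hψ ha) _

variable {ι : Type*}

theorem list_prod_mem_filt {𝔞 : Type*} [LieRing 𝔞] [LieAlgebra ℂ 𝔞] (l : List ι) {f : ι → Env 𝔞}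
    {d : ι → ℕ} (h : ∀ i ∈ l, f i ∈ filt 𝔞 (d i)) : (l.map f).prod ∈ filt 𝔞 (l.map d).sum := by
  induction l with
  | nil => exact one_mem_filt 0
  | cons i l ih =>
    simp only [List.map_cons, List.prod_cons, List.sum_cons]
    exact mul_mem_filt (h i (by simp)) (ih fun j hj => h j (by simp [hj]))

variable [DecidableEq ι] {z : ι → 𝔨} {u : ι → (A →₀ ℕ) → MapEnv A 𝔨}

/-- Moving the new factor to its own block past the earlier ones produces commutators, which have
lower degree; within its block the defining relation of `IsBlock` applies. -/
theorem elt_mul_prod_sub_mem (hu : ∀ i, IsBlock (z i) (u i)) (ψ : ι → A →₀ ℕ) (j : ι) (b : A)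
    {l : List ι} (hl : l.Nodup) (hj : j ∈ l) :
    elt (z j) b * (l.map fun i => u i (ψ i)).prod - ((ψ j b : ℂ) + 1) •
      (l.map fun i => u i (Function.update ψ j (ψ j + Finsupp.single b 1) i)).prod ∈
      filt (A ⊗[ℂ] 𝔨) (l.map fun i => (ψ i).degree).sum := by
  induction l with
  | nil => simp at hj
  | cons i l ih =>
    simp only [List.map_cons, List.prod_cons, List.sum_cons]
    obtain ⟨hil, hl⟩ := List.nodup_cons.mp hl
    have hrest : (l.map fun i => u i (ψ i)).prod ∈
        filt (A ⊗[ℂ] 𝔨) (l.map fun i => (ψ i).degree).sum :=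
      list_prod_mem_filt l fun i _ => (hu i).mem _
    by_cases hij : i = j
    · subst hij
      have h1 : (l.map fun k => u k (Function.update ψ i (ψ i + Finsupp.single b 1) k)) =
          l.map fun k => u k (ψ k) := by
        refine List.map_congr_left fun k hk => ?_
        rw [Function.update_of_ne]
        rintro rfl
        exact hil hk
      rw [h1, Function.update_self, ← mul_assoc, ← smul_mul_assoc, ← sub_mul]
      exact mul_mem_filt ((hu i).mul_sub_mem _ _) hrest
    · have hj' : j ∈ l := (List.mem_cons.mp hj).resolve_left (Ne.symm hij)
      have h1 := mul_mem_filt ((hu i).mem (ψ i)) (ih hl hj')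
      have h2 := mul_mem_filt (env_commutator_mem_filt (b ⊗ₜ[ℂ] z j) ((hu i).mem (ψ i))) hrest
      rw [Function.update_of_ne hij]
      convert add_mem h1 h2 using 1
      rw [← elt_eq_env, mul_sub, mul_smul_comm, sub_mul]
      simp only [mul_assoc]
      abel

/-- The multiset attached to an index. -/
def part {B : Set A} (n : (ι × B) →₀ ℕ) (i : ι) : A →₀ ℕ := (n.curry i).mapDomain Subtype.val

omit [CommRing A] [Algebra ℂ A] [DecidableEq ι] in
theorem part_apply {B : Set A} (n : (ι × B) →₀ ℕ) (i : ι) (b : B) : part n i b = n (i, b) := by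
  rw [part, Finsupp.mapDomain_apply Subtype.val_injective, Finsupp.curry_apply]

omit [CommRing A] [Algebra ℂ A] [DecidableEq ι] in
theorem part_apply_of_notMem {B : Set A} (n : (ι × B) →₀ ℕ) (i : ι) {a : A} (ha : a ∉ B) :
    part n i a = 0 := by
  rw [part, Finsupp.mapDomain_of_notMem_range]
  simpa using ha

omit [CommRing A] [Algebra ℂ A] [DecidableEq ι] in
theorem part_mem {B : Set A} (n : (ι × B) →₀ ℕ) (i : ι) : part n i ∈ multisetsIn B := by
  intro a ha
  by_contra h
  exact Finsupp.mem_support_iff.mp ha (part_apply_of_notMem n i h)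

omit [CommRing A] [Algebra ℂ A] [DecidableEq ι] in
theorem part_ext {B : Set A} {φ ψ : A →₀ ℕ} (hφ : φ ∈ multisetsIn B) (hψ : ψ ∈ multisetsIn B)
    (h : ∀ b : B, φ b = ψ b) : φ = ψ := by
  ext a
  by_cases ha : a ∈ B
  · exact h ⟨a, ha⟩
  · rw [Finsupp.notMem_support_iff.mp fun h' => ha (hφ h'),
      Finsupp.notMem_support_iff.mp fun h' => ha (hψ h')]

omit [CommRing A] [Algebra ℂ A] [DecidableEq ι] in
theorem part_zero {B : Set A} (i : ι) : part (0 : (ι × B) →₀ ℕ) i = 0 :=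
  part_ext (part_mem _ _) zero_mem_multisetsIn fun b => by rw [part_apply]; rfl

omit [CommRing A] [Algebra ℂ A] [DecidableEq ι] in
theorem part_add {B : Set A} (m n : (ι × B) →₀ ℕ) (i : ι) :
    part (m + n) i = part m i + part n i :=
  part_ext (part_mem _ _) (add_mem_multisetsIn (part_mem _ _) (part_mem _ _)) fun b => by
    rw [Finsupp.add_apply, part_apply, part_apply, part_apply, Finsupp.add_apply]

omit [CommRing A] [Algebra ℂ A] in
theorem part_single {B : Set A} (j i : ι) (b : B) (k : ℕ) :
    part (Finsupp.single (j, b) k) i = if i = j then Finsupp.single (b : A) k else 0 := by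
  classical
  refine part_ext (part_mem _ _) ?_ fun c => ?_
  · split_ifs
    exacts [single_mem_multisetsIn b.2 k, zero_mem_multisetsIn]
  · rw [part_apply, Finsupp.single_apply]
    by_cases hij : i = j
    · rw [if_pos hij, Finsupp.single_apply]
      refine if_congr ?_ rfl rfl
      simp [Prod.ext_iff, hij, Subtype.ext_iff]
    · rw [if_neg hij, if_neg]
      · rfl
      · exact fun h => hij (Prod.ext_iff.mp h).1.symm

omit [CommRing A] [Algebra ℂ A] in
theorem sum_degree_part {B : Set A} {l : List ι} (hl : l.Nodup) (hl' : ∀ i, i ∈ l)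
    (n : (ι × B) →₀ ℕ) : (l.map fun i => (part n i).degree).sum = n.degree := by
  rw [← List.sum_toFinset _ hl]
  induction n using Finsupp.induction_linear with
  | zero => simp [part_zero]
  | add m n hm hn => simp only [part_add, map_add, Finset.sum_add_distrib, hm, hn]
  | single p k =>
    obtain ⟨j, b⟩ := p
    simp only [part_single]
    rw [Finset.sum_eq_single j]
    · simp
    · intro i _ hij
      simp [hij]
    · intro h
      exact absurd (List.mem_toFinset.mpr (hl' j)) h

omit [DecidableEq ι] in
theorem span_tmul_eq_top {B : Set A} (hB : IsMulClosedBasis B) {z : ι → 𝔨}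
    (hz : Submodule.span ℂ (Set.range z) = ⊤) :
    Submodule.span ℂ (Set.range fun k : ι × B => (k.2 : A) ⊗ₜ[ℂ] z k.1) = ⊤ := by
  refine Submodule.eq_top_iff'.mpr fun x => ?_
  set S := Submodule.span ℂ (Set.range fun k : ι × B => (k.2 : A) ⊗ₜ[ℂ] z k.1)
  induction x with
  | zero => exact zero_mem _
  | add x y hx hy => exact add_mem hx hy
  | tmul a y =>
    have ha : a ∈ Submodule.span ℂ B := hB.span_eq_top ▸ Submodule.mem_top
    have hy : y ∈ Submodule.span ℂ (Set.range z) := hz ▸ Submodule.mem_top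
    induction ha, hy using Submodule.span_induction₂ with
    | mem_mem a y ha hy =>
      obtain ⟨i, rfl⟩ := hy
      exact Submodule.subset_span ⟨(i, ⟨a, ha⟩), rfl⟩
    | zero_left => rw [TensorProduct.zero_tmul]; exact zero_mem _
    | zero_right => rw [TensorProduct.tmul_zero]; exact zero_mem _
    | add_left x y z _ _ _ hx hy => rw [TensorProduct.add_tmul]; exact add_mem hx hy
    | add_right x y z _ _ _ hx hy => rw [TensorProduct.tmul_add]; exact add_mem hx hy
    | smul_left r x y _ _ h => rw [← TensorProduct.smul_tmul']; exact Submodule.smul_mem _ _ h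
    | smul_right r x y _ _ h => rw [TensorProduct.tmul_smul]; exact Submodule.smul_mem _ _ h

/-- An integral form with dual integral functionals is spanned by ordered monomials. -/
theorem intForm_mem_span {E T : Set 𝔨} {B : Set A} (hB : IsMulClosedBasis B)
    (hu : ∀ i, IsBlock (z i) (u i)) (hz : Submodule.span ℂ (Set.range z) = ⊤) {l : List ι}
    (hl : l.Nodup) (hl' : ∀ i, i ∈ l) (huR : ∀ i, ∀ ψ ∈ multisetsIn B, u i ψ ∈ intForm E T B)
    (hf : ∀ (i : ι) (b : B), ∃ f : MapEnv A 𝔨 →ₗ[ℂ] ℂ, f 1 = 0 ∧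
      (∀ j c, f (elt (z j) c) = hB.basis.coord b c * if j = i then 1 else 0) ∧
      ∀ r ∈ intForm E T B, f r ∈ intC) {d : ℕ} {r : MapEnv A 𝔨} (hr : r ∈ intForm E T B)
    (hrd : r ∈ filt (A ⊗[ℂ] 𝔨) d) :
    r ∈ Submodule.span ℤ {v | ∃ ψ : ι → A →₀ ℕ, (∀ i, ψ i ∈ multisetsIn B) ∧
      (l.map fun i => (ψ i).degree).sum ≤ d ∧ v = (l.map fun i => u i (ψ i)).prod} := by
  classical
  have hfam : IsMonomialFamily (fun k : ι × B => (k.2 : A) ⊗ₜ[ℂ] z k.1)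
      (fun n => (l.map fun i => u i (part n i)).prod) := by
    constructor
    · have h1 : (l.map fun i => u i (part (0 : (ι × B) →₀ ℕ) i)) = l.map fun _ => 1 :=
        List.map_congr_left fun i _ => by
          rw [part_zero i, (hu i).zero]
      simp only [h1]
      simp
    · intro n
      rw [← sum_degree_part hl hl' n]
      exact list_prod_mem_filt l fun i _ => (hu i).mem _
    · rintro n ⟨j, b⟩
      rw [← sum_degree_part hl hl' n]
      have h1 := elt_mul_prod_sub_mem hu (part n) j b hl (hl' j)
      rw [part_apply] at h1
      have h2 : part (n + Finsupp.single (j, b) 1) =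
          Function.update (part n) j (part n j + Finsupp.single (b : A) 1) := by
        funext i
        rw [part_add, part_single]
        by_cases hij : i = j
        · rw [hij, if_pos rfl, Function.update_self]
        · rw [if_neg hij, Function.update_of_ne hij, add_zero]
      rw [h2]
      exact h1
  refine Submodule.span_mono ?_ (hfam.mem_span_int (span_tmul_eq_top hB hz)
    (R := intForm E T B) ?_ (fun r hr => comul_mem_intForm hr)
    (fun r hr => counit_mem_intForm hr) ?_ hr hrd)
  · rintro v ⟨n, hn, rfl⟩
    exact ⟨part n, part_mem n, (sum_degree_part hl hl' n).trans_le hn, rfl⟩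
  · refine fun n => Subalgebra.list_prod_mem _ fun v hv => ?_
    obtain ⟨i, _, rfl⟩ := List.mem_map.mp hv
    exact huR i _ (part_mem n i)
  · rintro ⟨i, b⟩
    obtain ⟨f, hf1, hf2, hf3⟩ := hf i b
    refine ⟨f, hf1, ?_, ?_, hf3⟩
    · have := hf2 i b
      rw [hB.coord_apply] at this
      simpa [← elt_eq_env] using this
    · rintro ⟨j, c⟩ hne
      have := hf2 j c
      rw [hB.coord_apply] at this
      rw [← elt_eq_env, this]
      by_cases hij : j = i
      · rw [if_neg, zero_mul]
        rintro rfl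
        exact hne (by rw [hij])
      · rw [if_neg hij, mul_zero]

end Blocks

end MapAlgebra

end

noncomputable section

namespace MapAlgebra

open LieAlgebra LieAlgebra.IsKilling LieModule

/-! ### Chevalley bases: brackets, coordinates and the coweight lattice -/

section ChevalleyFacts

variable {L : Type*} [LieRing L] [LieAlgebra ℂ L] [FiniteDimensional ℂ L] [IsKilling ℂ L]
  {H : LieSubalgebra ℂ L} [H.IsCartanSubalgebra] {x : H.root → L}

theorem root_eq_of_coe_eq {α β : H.root} (h : (rootSystem H).root α = (rootSystem H).root β) :
    α = β := (rootSystem H).root.injective h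

theorem root_negRoot (α : H.root) :
    (rootSystem H).root (negRoot α) = -(rootSystem H).root α := rfl

theorem negRoot_negRoot (α : H.root) : negRoot (negRoot α) = α :=
  root_eq_of_coe_eq (by rw [root_negRoot, root_negRoot, neg_neg])

omit [IsKilling ℂ L] in
theorem coe_ne_zero (α : H.root) : ((α.1 : Weight ℂ H L) : H → ℂ) ≠ 0 :=
  LieSubalgebra.isNonZero_coe_root α

theorem ne_negRoot (α : H.root) : α ≠ negRoot α := fun h => by
  have h1 := congrArg (fun γ : H.root => γ.1 (coroot α.1)) h
  have h2 : (negRoot α).1 (coroot α.1) = -α.1 (coroot α.1) := rfl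
  simp only [h2, root_apply_coroot (LieSubalgebra.isNonZero_coe_root α)] at h1
  norm_num at h1

theorem exists_int_apply_coroot (α γ : H.root) : ∃ k : ℤ, γ.1 (coroot α.1) = (k : ℂ) :=
  ⟨_, apply_coroot_eq_cast α.1 γ.1⟩

theorem root_apply_coroot_self (α : H.root) : α.1 (coroot α.1) = (2 : ℂ) :=
  root_apply_coroot (LieSubalgebra.isNonZero_coe_root α)

theorem root_coe_add {α β γ : H.root}
    (h : ((γ.1 : Weight ℂ H L) : H → ℂ) = (α.1 : H → ℂ) + (β.1 : H → ℂ)) :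
    (rootSystem H).root γ = (rootSystem H).root α + (rootSystem H).root β := by
  ext y
  exact congrFun h y

theorem eq_negRoot_of_add_eq_zero {α β : H.root}
    (h : ((α.1 : Weight ℂ H L) : H → ℂ) + (β.1 : H → ℂ) = 0) : β = negRoot α := by
  refine root_eq_of_coe_eq ?_
  ext y
  exact eq_neg_of_add_eq_zero_right (congrFun h y)

namespace IsChevalleyBasis

variable (hx : IsChevalleyBasis H x)
include hx

theorem coroot_lie (h : H) (α : H.root) : ⁅(h : L), x α⁆ = α.1 h • x α :=
  lie_eq_smul_of_mem_rootSpace (hx.mem_rootSpace α) h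

theorem lie_coe (h : H) (α : H.root) : ⁅x α, (h : L)⁆ = (-(α.1 h)) • x α := by
  rw [← lie_skew, hx.coroot_lie, neg_smul]

/-- The bracket lies in the weight space of the sum, which is zero unless the sum is zero or a root.
-/
theorem lie_cases (α β : H.root) : β = negRoot α ∨ ⁅x α, x β⁆ = 0 ∨
    ∃ γ, (rootSystem H).root γ = (rootSystem H).root α + (rootSystem H).root β := by
  by_cases h0 : ((α.1 : Weight ℂ H L) : H → ℂ) + (β.1 : H → ℂ) = 0
  · exact Or.inl (eq_negRoot_of_add_eq_zero h0)
  refine Or.inr ?_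
  have h1 := lie_mem_genWeightSpace_of_mem_genWeightSpace (hx.mem_rootSpace α)
    (hx.mem_rootSpace β)
  by_cases h2 : rootSpace H ((α.1 : H → ℂ) + (β.1 : H → ℂ)) = ⊥
  · have h3 : ⁅x α, x β⁆ ∈ (⊥ : LieSubmodule ℂ H L) := h2 ▸ h1
    exact Or.inl h3
  · let w : Weight ℂ H L := ⟨_, h2⟩
    have hw : w ∈ H.root := by
      simp only [LieSubalgebra.root, Finset.mem_filter, Finset.mem_univ, true_and]
      exact h0
    exact Or.inr ⟨⟨w, hw⟩, root_coe_add rfl⟩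

theorem killingForm_neg_ne_zero (α : H.root) : killingForm ℂ L (x α) (x (negRoot α)) ≠ 0 := by
  intro h
  have h1 := lie_eq_killingForm_smul_of_mem_rootSpace_of_mem_rootSpace_neg (hx.mem_rootSpace α)
    (hx.mem_rootSpace (negRoot α))
  rw [h, zero_smul, hx.lie_neg] at h1
  have h2 : coroot α.1 = (0 : H) := Subtype.ext h1
  exact LieSubalgebra.isNonZero_coe_root α (coroot_eq_zero_iff.mp h2)

/-- The coordinate of a root vector. -/
theorem exists_coord (α : H.root) : ∃ φ : L →ₗ[ℂ] ℂ, φ (x α) = 1 ∧ (∀ β, β ≠ α → φ (x β) = 0) ∧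
    ∀ h : H, φ h = 0 := by
  refine ⟨(killingForm ℂ L (x α) (x (negRoot α)))⁻¹ • (killingForm ℂ L).flip (x (negRoot α)),
    ?_, ?_, ?_⟩
  · simp [hx.killingForm_neg_ne_zero α]
  · intro β hβ
    have h1 := killingForm_apply_eq_zero_of_mem_rootSpace_of_add_ne_zero ℂ L H
      (hx.mem_rootSpace β) (hx.mem_rootSpace (negRoot α)) (fun h => hβ ?_)
    · simp [h1]
    · rw [eq_comm, ← negRoot_negRoot α]
      rw [add_comm] at h
      exact (eq_negRoot_of_add_eq_zero h).symm
  · intro h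
    have h1 := killingForm_apply_eq_zero_of_mem_rootSpace_of_add_ne_zero ℂ L H
      (α := 0) (x := (h : L)) (by
        have : (h : L) ∈ (rootSpace H (0 : H → ℂ)).toSubmodule := by
          rw [rootSpace_zero_eq]; exact h.2
        exact this) (hx.mem_rootSpace (negRoot α)) (by
        rw [zero_add]; exact coe_ne_zero _)
    simp [h1]

/-- The extension by zero of a linear form on the Cartan subalgebra. -/
theorem exists_extend (ξ : Module.Dual ℂ H) : ∃ φ : L →ₗ[ℂ] ℂ, (∀ h : H, φ h = ξ h) ∧
    ∀ β, φ (x β) = 0 := by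
  refine ⟨killingForm ℂ L ((cartanEquivDual H).symm ξ : H), fun h => ?_, fun β => ?_⟩
  · conv_rhs => rw [← (cartanEquivDual H).apply_symm_apply ξ]
    rfl
  · refine killingForm_apply_eq_zero_of_mem_rootSpace_of_add_ne_zero ℂ L H (α := 0) ?_
      (hx.mem_rootSpace β) (by rw [zero_add]; exact coe_ne_zero _)
    have : (((cartanEquivDual H).symm ξ : H) : L) ∈ (rootSpace H (0 : H → ℂ)).toSubmodule := by
      rw [rootSpace_zero_eq]; exact ((cartanEquivDual H).symm ξ).2
    exact this

end IsChevalleyBasis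

/-- The coweight lattice. -/
def coweights (H : LieSubalgebra ℂ L) [H.IsCartanSubalgebra] : AddSubgroup H where
  carrier := {h | ∀ γ : H.root, ∃ k : ℤ, γ.1 h = (k : ℂ)}
  zero_mem' γ := ⟨0, by simp⟩
  add_mem' {g h} hg hh γ := by
    obtain ⟨a, ha⟩ := hg γ
    obtain ⟨b, hb⟩ := hh γ
    refine ⟨a + b, ?_⟩
    have := map_add γ.1.toLinear g h
    simp only [LieModule.Weight.toLinear_apply] at this
    rw [this, ha, hb]; push_cast; rfl
  neg_mem' {g} hg γ := by
    obtain ⟨a, ha⟩ := hg γ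
    refine ⟨-a, ?_⟩
    have := map_neg γ.1.toLinear g
    simp only [LieModule.Weight.toLinear_apply] at this
    rw [this, ha]; push_cast; rfl

theorem coroot_mem_coweights (α : H.root) : coroot α.1 ∈ coweights H :=
  fun γ => exists_int_apply_coroot α γ

/-- Every root takes the value `1` on the coweight lattice. -/
theorem exists_coweight_apply_eq_one (β : (rootSystem H).Base) (μ : H.root) :
    ∃ h ∈ coweights H, μ.1 h = 1 := by
  have hrefl : ∀ i j : H.root, (∃ h ∈ coweights H, i.1 h = 1) →
      ∃ h ∈ coweights H, ((rootSystem H).reflectionPerm j i).1 h = 1 := by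
    rintro i j ⟨h, hh, hi⟩
    obtain ⟨k, hk⟩ := hh j
    -- The reflection of `h` in `j`: the reflected root takes on it the value that the original root
    -- takes on `h`.
    refine ⟨h - k • coroot j.1, sub_mem hh (zsmul_mem (coroot_mem_coweights j) k), ?_⟩
    have h1 : (rootSystem H).root ((rootSystem H).reflectionPerm j i) =
        (rootSystem H).root i - (rootSystem H).pairing i j • (rootSystem H).root j := by
      rw [RootPairing.root_reflectionPerm, RootPairing.reflection_apply_root]
    have h2 : ((rootSystem H).reflectionPerm j i).1 (h - k • coroot j.1) =
        ((rootSystem H).root ((rootSystem H).reflectionPerm j i)) (h - k • coroot j.1) := rfl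
    rw [h2, h1, ← Int.cast_smul_eq_zsmul ℂ]
    have h3 := root_apply_coroot_self j
    simp only [LinearMap.sub_apply, map_sub, LinearMap.smul_apply, map_smul,
      rootSystem_root_apply, LieModule.Weight.toLinear_apply, rootSystem_pairing_apply, hi, hk, h3,
      smul_eq_mul]
    ring
  refine β.induction_reflect μ (fun i => hrefl i i) (fun i hi => ?_) fun i j h _ => hrefl i j h
  -- For a simple root, the fundamental coweight.
  obtain ⟨h, hh⟩ := (Module.evalEquiv ℂ H).surjective (β.toWeightBasis.coord ⟨i, hi⟩)
  have h0 : ∀ γ : H.root, γ.1 h = β.toWeightBasis.coord ⟨i, hi⟩ ((rootSystem H).root γ) := by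
    intro γ
    rw [← hh]
    rfl
  refine ⟨h, fun γ => ?_, ?_⟩
  · rw [h0]
    refine Submodule.span_induction (p := fun v _ => ∃ k : ℤ, β.toWeightBasis.coord ⟨i, hi⟩ v = k)
      ?_ ⟨0, by simp⟩ ?_ ?_ (β.root_mem_span_int γ)
    · classical
      rintro _ ⟨j, hj, rfl⟩
      refine ⟨if (⟨j, hj⟩ : β.support) = ⟨i, hi⟩ then 1 else 0, ?_⟩
      have := β.toWeightBasis_repr_root ⟨j, hj⟩
      simp only at this
      rw [Module.Basis.coord_apply, this, Finsupp.single_apply]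
      split_ifs <;> simp
    · rintro v w _ _ ⟨a, ha⟩ ⟨b, hb⟩
      exact ⟨a + b, by rw [map_add, ha, hb]; push_cast; rfl⟩
    · rintro a v _ ⟨b, hb⟩
      exact ⟨a * b, by rw [map_zsmul, hb]; simp⟩
  · rw [h0, Module.Basis.coord_apply]
    have := β.toWeightBasis_repr_root ⟨i, hi⟩
    simp only at this
    rw [this, Finsupp.single_eq_same]

open scoped Classical in
/-- The fundamental weights take integral values on coroots. -/
theorem exists_fundamental_weight (β : (rootSystem H).Base) (i : β.support) :
    ∃ ξ : Module.Dual ℂ H, (∀ j : β.support, ξ (coroot j.1.1) = if j = i then 1 else 0) ∧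
      ∀ α : H.root, ∃ k : ℤ, ξ (coroot α.1) = k := by
  classical
  have h1 : ∀ j : β.support, β.toCoweightBasis.coord i ((rootSystem H).coroot j) =
      if j = i then 1 else 0 := fun j => by
    rw [Module.Basis.coord_apply, β.toCoweightBasis_repr_coroot, Finsupp.single_apply]
  refine ⟨β.toCoweightBasis.coord i, fun j => ?_, fun α => ?_⟩
  · exact h1 j
  · refine Submodule.span_induction (p := fun v _ => ∃ k : ℤ, β.toCoweightBasis.coord i v = k)
      ?_ ⟨0, by simp⟩ ?_ ?_ (β.coroot_mem_span_int α)
    · rintro _ ⟨j, hj, rfl⟩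
      exact ⟨if (⟨j, hj⟩ : β.support) = i then 1 else 0, by rw [h1 ⟨j, hj⟩]; split_ifs <;> simp⟩
    · rintro v w _ _ ⟨a, ha⟩ ⟨b, hb⟩
      exact ⟨a + b, by rw [map_add, ha, hb]; push_cast; rfl⟩
    · rintro a v _ ⟨b, hb⟩
      exact ⟨a * b, by rw [map_zsmul, hb]; simp⟩

end ChevalleyFacts

end MapAlgebra

end

noncomputable section

namespace MapAlgebra

open LieAlgebra LieAlgebra.IsKilling LieModule

/-! ### The adjoint lattice -/

section AdjointLattice

variable {L : Type*} [LieRing L] [LieAlgebra ℂ L] [FiniteDimensional ℂ L] [IsKilling ℂ L]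
  {H : LieSubalgebra ℂ L} [H.IsCartanSubalgebra] {x : H.root → L}

/-- The lattice spanned by the root vectors and the coweights. -/
def adLattice (x : H.root → L) : Submodule ℤ L :=
  Submodule.span ℤ ({y | ∃ h ∈ coweights H, y = (h : L)} ∪ Set.range x)

omit [IsKilling ℂ L] in
theorem coe_mem_adLattice {h : H} (hh : h ∈ coweights H) : (h : L) ∈ adLattice x :=
  Submodule.subset_span (Or.inl ⟨h, hh, rfl⟩)

omit [IsKilling ℂ L] in
theorem root_mem_adLattice (α : H.root) : x α ∈ adLattice x :=
  Submodule.subset_span (Or.inr ⟨α, rfl⟩)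

omit [FiniteDimensional ℂ L] [IsKilling ℂ L] in
theorem succ_smul_dpow_ad (y v : L) (r : ℕ) :
    ((r : ℂ) + 1) • dpow (ad ℂ L y) (r + 1) v = ⁅y, dpow (ad ℂ L y) r v⁆ := by
  rw [← LinearMap.smul_apply, succ_smul_dpow_succ, Module.End.mul_apply, ad_apply]

omit [FiniteDimensional ℂ L] [IsKilling ℂ L] in
theorem dpow_ad_succ_eq_of_lie {y v w : L} {r : ℕ} (h : ⁅y, dpow (ad ℂ L y) r v⁆ =
    ((r : ℂ) + 1) • w) : dpow (ad ℂ L y) (r + 1) v = w := by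
  rw [← succ_smul_dpow_ad] at h
  exact smul_right_injective L (Nat.cast_add_one_ne_zero (R := ℂ) r) h

omit [FiniteDimensional ℂ L] [IsKilling ℂ L] in
theorem dpow_ad_eq_zero_of_le {y v : L} {r s : ℕ} (h : dpow (ad ℂ L y) r v = 0) (hrs : r ≤ s) :
    dpow (ad ℂ L y) s v = 0 := by
  induction s, hrs using Nat.le_induction with
  | base => exact h
  | succ s _ ih => exact dpow_ad_succ_eq_of_lie (by rw [ih, lie_zero, smul_zero])

namespace IsChevalleyBasis

variable (hx : IsChevalleyBasis H x)
include hx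

/-- Along the root string each bracket multiplies by `±(p + 1)`, and `p` grows by one at each step.
After `r` steps the product is `±(p + 1)⋯(p + r)`, which is `r!` times a binomial coefficient up to
sign. -/
theorem dpow_ad_root {μ ν : H.root}
    (hi : LinearIndependent ℂ ![(rootSystem H).root μ, (rootSystem H).root ν]) (r : ℕ) :
    dpow (ad ℂ L (x μ)) r (x ν) = 0 ∨ ∃ (γ : H.root) (k : ℤ),
      LinearIndependent ℂ ![(rootSystem H).root μ, (rootSystem H).root γ] ∧
      (rootSystem H).chainBotCoeff μ γ = (rootSystem H).chainBotCoeff μ ν + r ∧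
      (k = ((rootSystem H).chainBotCoeff μ γ).choose r ∨
        k = -((rootSystem H).chainBotCoeff μ γ).choose r) ∧
      dpow (ad ℂ L (x μ)) r (x ν) = (k : ℂ) • x γ := by
  induction r with
  | zero => exact Or.inr ⟨ν, 1, hi, rfl, by simp, by simp [dpow_zero]⟩
  | succ r ih =>
    rcases ih with h | ⟨γ, k, hγ, hp, hk, h⟩
    · exact Or.inl (dpow_ad_eq_zero_of_le h (Nat.le_succ r))
    rcases hx.lie_cases μ γ with rfl | h0 | ⟨δ, hδ⟩
    · rw [root_negRoot] at hγ
      have h1 := LinearIndependent.pair_iff.mp hγ 1 1 (by simp)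
      exact absurd h1.1 one_ne_zero
    · exact Or.inl (dpow_ad_succ_eq_of_lie (by rw [h, lie_smul, h0, smul_zero, smul_zero]))
    · have hδ' : (rootSystem H).root δ = (rootSystem H).root γ + (rootSystem H).root μ := by
        rw [hδ, add_comm]
      have hq := RootPairing.chainBotCoeff_of_add hγ hδ'
      have hchoose : (((rootSystem H).chainBotCoeff μ γ : ℂ) + 1) *
          (((rootSystem H).chainBotCoeff μ γ).choose r : ℂ) =
          ((r : ℂ) + 1) * (((rootSystem H).chainBotCoeff μ δ).choose (r + 1) : ℂ) := by
        rw [hq, mul_comm ((r : ℂ) + 1)]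
        exact_mod_cast Nat.add_one_mul_choose_eq _ _
      have hδi : LinearIndependent ℂ ![(rootSystem H).root μ, (rootSystem H).root δ] := by
        rw [hδ']
        simpa [add_comm] using hγ
      obtain ⟨ε, hε, hlie⟩ : ∃ ε : ℤ, (ε = 1 ∨ ε = -1) ∧ ⁅x μ, x γ⁆ =
          ((ε : ℂ) * (((rootSystem H).chainBotCoeff μ γ : ℂ) + 1)) • x δ := by
        rcases hx.lie_add μ γ δ hδ with h1 | h1
        · exact ⟨1, Or.inl rfl, by rw [h1]; simp⟩
        · exact ⟨-1, Or.inr rfl, by rw [h1]; push_cast; rw [neg_one_mul, neg_smul]⟩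
      obtain ⟨ε', hε', hk'⟩ : ∃ ε' : ℤ, (ε' = 1 ∨ ε' = -1) ∧
          k = ε' * ((rootSystem H).chainBotCoeff μ γ).choose r := by
        rcases hk with h1 | h1
        · exact ⟨1, Or.inl rfl, by rw [h1]; simp⟩
        · exact ⟨-1, Or.inr rfl, by rw [h1]; simp⟩
      refine Or.inr ⟨δ, ε * ε' * ((rootSystem H).chainBotCoeff μ δ).choose (r + 1), hδi,
        by rw [hq, hp, add_assoc], ?_, ?_⟩
      · rcases hε with rfl | rfl <;> rcases hε' with rfl | rfl <;> simp
      · refine dpow_ad_succ_eq_of_lie ?_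
        rw [h, lie_smul, hlie, smul_smul, smul_smul, hk']
        congr 1
        push_cast
        linear_combination (ε : ℂ) * ε' * hchoose

/-- Coweights are taken in place of coroots so that the lattice contains, for each root, an element
on which that root is `1`. Stability survives, because `ad (x μ)` sends a coweight to an integral
multiple of `x μ` and then to `0`. -/
theorem dpow_ad_mem_adLattice (μ : H.root) (r : ℕ) {v : L} (hv : v ∈ adLattice x) :
    dpow (ad ℂ L (x μ)) r v ∈ adLattice x := by
  refine Submodule.span_induction (p := fun v _ => dpow (ad ℂ L (x μ)) r v ∈ adLattice x)
    ?_ (by simp) ?_ ?_ hv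
  · rintro _ (⟨h, hh, rfl⟩ | ⟨ν, rfl⟩)
    · rcases r with _ | r
      · simpa [dpow_zero] using coe_mem_adLattice hh
      obtain ⟨k, hk⟩ := hh μ
      have h1 : dpow (ad ℂ L (x μ)) 1 (h : L) = ((-k : ℤ) : ℂ) • x μ := by
        rw [dpow_one, ad_apply, hx.lie_coe, hk]; push_cast; rfl
      rcases r with _ | r
      · rw [h1, Int.cast_smul_eq_zsmul]
        exact Submodule.smul_mem _ _ (root_mem_adLattice μ)
      · have h2 : dpow (ad ℂ L (x μ)) 2 (h : L) = 0 :=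
          dpow_ad_succ_eq_of_lie (by rw [h1, lie_smul, lie_self, smul_zero, smul_zero])
        rw [dpow_ad_eq_zero_of_le h2 (by omega)]
        exact zero_mem _
    · by_cases hi : LinearIndependent ℂ ![(rootSystem H).root μ, (rootSystem H).root ν]
      · rcases hx.dpow_ad_root hi r with h | ⟨γ, k, -, -, -, h⟩
        · rw [h]; exact zero_mem _
        · rw [h, Int.cast_smul_eq_zsmul]
          exact Submodule.smul_mem _ _ (root_mem_adLattice γ)
      · rcases r with _ | r
        · simpa [dpow_zero] using root_mem_adLattice ν
        rcases RootPairing.IsReduced.eq_or_eq_neg (P := rootSystem H) μ ν hi with h | h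
        · obtain rfl := root_eq_of_coe_eq h
          have h1 : dpow (ad ℂ L (x μ)) 1 (x μ) = 0 := by rw [dpow_one, ad_apply, lie_self]
          rw [dpow_ad_eq_zero_of_le h1 (by omega)]
          exact zero_mem _
        · obtain rfl : ν = negRoot μ := root_eq_of_coe_eq (by rw [root_negRoot, h, neg_neg])
          have h1 : dpow (ad ℂ L (x μ)) 1 (x (negRoot μ)) = (coroot μ.1 : H) := by
            rw [dpow_one, ad_apply, hx.lie_neg]
          -- Here the divided power matters: the plain square of `ad (x μ)` gives `-2 x μ`.
          have h2 : dpow (ad ℂ L (x μ)) 2 (x (negRoot μ)) = -x μ := by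
            refine dpow_ad_succ_eq_of_lie ?_
            rw [h1, hx.lie_coe, root_apply_coroot_self]
            norm_num
          have h3 : dpow (ad ℂ L (x μ)) 3 (x (negRoot μ)) = 0 :=
            dpow_ad_succ_eq_of_lie (by rw [h2, _root_.lie_neg, lie_self, neg_zero, smul_zero])
          rcases r with _ | _ | r
          · rw [h1]; exact coe_mem_adLattice (coroot_mem_coweights μ)
          · rw [h2]; exact neg_mem (root_mem_adLattice μ)
          · rw [dpow_ad_eq_zero_of_le h3 (by omega)]
            exact zero_mem _
  · intro v w _ _ hv hw
    rw [map_add]; exact add_mem hv hw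
  · intro k v _ hv
    rw [map_zsmul]; exact Submodule.smul_mem _ _ hv

theorem adLattice_le_span (α : H.root) : adLattice x ≤ Submodule.span ℤ
    {v | v ∈ adLattice x ∧ ∃ k : ℤ, ad ℂ L (coroot α.1 : H) v = (k : ℂ) • v} := by
  refine Submodule.span_le.mpr ?_
  rintro _ (⟨h, hh, rfl⟩ | ⟨ν, rfl⟩)
  · refine Submodule.subset_span ⟨coe_mem_adLattice hh, 0, ?_⟩
    have : ⁅(coroot α.1 : H), h⁆ = 0 := trivial_lie_zero H H _ _
    rw [ad_apply, Int.cast_zero, zero_smul, ← LieSubalgebra.coe_bracket, this]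
    rfl
  · obtain ⟨k, hk⟩ := exists_int_apply_coroot α ν
    exact Submodule.subset_span ⟨root_mem_adLattice ν, k, by rw [ad_apply, hx.coroot_lie, hk]⟩

end IsChevalleyBasis

end AdjointLattice

end MapAlgebra

end

noncomputable section

namespace MapAlgebra

open LieAlgebra LieAlgebra.IsKilling LieModule

theorem pSigned_mem_intForm {A 𝔨 : Type*} [CommRing A] [Algebra ℂ A] [LieRing 𝔨]
    [LieAlgebra ℂ 𝔨] {E T : Set 𝔨} {B : Set A} {t : 𝔨} (ht : t ∈ T) {χ : A →₀ ℕ}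
    (hχ : χ ∈ multisetsIn B) : pSigned t χ ∈ intForm E T B :=
  zsmul_eq_of_mem_intC (N := Subalgebra.toSubmodule (intForm E T B))
    (pow_mem (neg_mem (one_mem _)) _) (pOne_mem_intForm ht hχ)

/-! ### Functoriality -/

section Functoriality

variable {A 𝔨 𝔩 : Type*} [CommRing A] [Algebra ℂ A] [LieRing 𝔨] [LieAlgebra ℂ 𝔨] [LieRing 𝔩]
  [LieAlgebra ℂ 𝔩]

theorem env_lTensor_lie (f : 𝔨 →ₗ⁅ℂ⁆ 𝔩) (x y : A ⊗[ℂ] 𝔨) :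
    (env ∘ₗ (f : 𝔨 →ₗ[ℂ] 𝔩).lTensor A) ⁅x, y⁆ =
      (env ∘ₗ (f : 𝔨 →ₗ[ℂ] 𝔩).lTensor A) x * (env ∘ₗ (f : 𝔨 →ₗ[ℂ] 𝔩).lTensor A) y -
      (env ∘ₗ (f : 𝔨 →ₗ[ℂ] 𝔩).lTensor A) y * (env ∘ₗ (f : 𝔨 →ₗ[ℂ] 𝔩).lTensor A) x := by
  simp only [LinearMap.comp_apply]
  rw [← env_lie]
  congr 1
  induction x with
  | zero => simp
  | add x x' hx hx' => simp only [add_lie, map_add, hx, hx']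
  | tmul a x =>
    induction y with
    | zero => simp
    | add y y' hy hy' => simp only [lie_add, map_add, hy, hy']
    | tmul b y => simp [LieAlgebra.ExtendScalars.bracket_tmul]

/-- The homomorphism of enveloping algebras of map algebras induced by a homomorphism of Lie
algebras. -/
def mapEnvMap (A : Type*) [CommRing A] [Algebra ℂ A] (f : 𝔨 →ₗ⁅ℂ⁆ 𝔩) :
    MapEnv A 𝔨 →ₐ[ℂ] MapEnv A 𝔩 :=
  envLift (env ∘ₗ (f : 𝔨 →ₗ[ℂ] 𝔩).lTensor A) (env_lTensor_lie f)

theorem mapEnvMap_elt (f : 𝔨 →ₗ⁅ℂ⁆ 𝔩) (z : 𝔨) (a : A) :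
    mapEnvMap A f (elt z a) = elt (f z) a := by
  rw [elt_eq_env, mapEnvMap, envLift_env]
  rfl

theorem mapEnvMap_pOne (f : 𝔨 →ₗ⁅ℂ⁆ 𝔩) (z : 𝔨) (χ : A →₀ ℕ) :
    mapEnvMap A f (pOne z χ) = pOne (f z) χ :=
  map_pOne _ _ _ (mapEnvMap_elt f z) χ

theorem mapEnvMap_pSigned (f : 𝔨 →ₗ⁅ℂ⁆ 𝔩) (z : 𝔨) (χ : A →₀ ℕ) :
    mapEnvMap A f (pSigned z χ) = pSigned (f z) χ := by
  rw [pSigned, pSigned, map_smul, mapEnvMap_pOne]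

theorem mapEnvMap_dpow_elt (f : 𝔨 →ₗ⁅ℂ⁆ 𝔩) (z : 𝔨) (a : A) (r : ℕ) :
    mapEnvMap A f (dpow (elt z a) r) = dpow (elt (f z) a) r := by
  rw [map_dpow, mapEnvMap_elt]

theorem mapEnvMap_dpowProd (f : 𝔨 →ₗ⁅ℂ⁆ 𝔩) (z : 𝔨) (ψ : A →₀ ℕ) :
    mapEnvMap A f (dpowProd z ψ) = dpowProd (f z) ψ :=
  (Finset.map_noncommProd ψ.support _ (dpow_commute z ψ _) (mapEnvMap A f)).trans
    (Finset.noncommProd_congr rfl (fun a _ => mapEnvMap_dpow_elt f z a _) _)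

end Functoriality

/-! ### Solvable subalgebras containing the Cartan subalgebra -/

section Borel

variable {L : Type*} [LieRing L] [LieAlgebra ℂ L] [FiniteDimensional ℂ L] [IsKilling ℂ L]
  {H : LieSubalgebra ℂ L} [H.IsCartanSubalgebra] {x : H.root → L}

/-- A closed set of roots containing no two opposite roots. -/
structure IsSpecial (S : Set H.root) : Prop where
  add_mem : ∀ α ∈ S, ∀ β ∈ S, ∀ γ, (rootSystem H).root γ = (rootSystem H).root α +
    (rootSystem H).root β → γ ∈ S
  neg_notMem : ∀ α ∈ S, negRoot α ∉ S

theorem isSpecial_empty : IsSpecial (∅ : Set H.root) := ⟨by simp, by simp⟩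

/-- The roots that are nonnegative combinations of two given roots that are not opposite form a
special set. -/
theorem isSpecial_pair {γ δ : H.root} (h : δ ≠ negRoot γ) :
    IsSpecial {μ : H.root | ∃ i j : ℕ, (rootSystem H).root μ =
      i • (rootSystem H).root γ + j • (rootSystem H).root δ} where
  add_mem := by
    rintro α ⟨i, j, hα⟩ β ⟨k, l, hβ⟩ μ hμ
    exact ⟨i + k, j + l, by rw [hμ, hα, hβ]; module⟩
  neg_notMem := by
    rintro α ⟨i, j, hα⟩ ⟨k, l, hα'⟩
    rw [root_negRoot, hα] at hα'
    have h1 : ((i + k : ℕ) : ℂ) • (rootSystem H).root γ + ((j + l : ℕ) : ℂ) •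
        (rootSystem H).root δ = 0 := by
      have h0 := neg_eq_iff_add_eq_zero.mp hα'
      simp only [Nat.cast_add, add_smul, Nat.cast_smul_eq_nsmul]
      rw [← h0]
      abel
    have h2 : (i + k : ℕ) = 0 ∧ (j + l : ℕ) = 0 := by
      by_cases hi : LinearIndependent ℂ ![(rootSystem H).root γ, (rootSystem H).root δ]
      · have h3 := LinearIndependent.pair_iff.mp hi _ _ h1
        exact_mod_cast h3
      -- In a reduced root system, dependent roots are equal or opposite. Opposite ones are
      -- excluded, and for equal ones a vanishing nonnegative multiple has all coefficients zero.
      · rcases RootPairing.IsReduced.eq_or_eq_neg (P := rootSystem H) γ δ hi with h3 | h3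
        · rw [← h3, ← add_smul] at h1
          have h4 := (smul_eq_zero.mp h1).resolve_right ((rootSystem H).ne_zero γ)
          have h5 : i + k + (j + l) = 0 := by exact_mod_cast h4
          omega
        · exact absurd (root_eq_of_coe_eq (by rw [root_negRoot, h3, neg_neg])) h
    have h3 : i = 0 ∧ j = 0 := by omega
    rw [h3.1, h3.2, zero_smul, zero_smul, add_zero] at hα
    exact (rootSystem H).ne_zero α hα

/-- The span of the Cartan subalgebra and the root vectors of a special set of roots. -/
def borel (hx : IsChevalleyBasis H x) {S : Set H.root} (hS : IsSpecial S) : LieSubalgebra ℂ L where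
  toSubmodule := Submodule.span ℂ ((H : Set L) ∪ x '' S)
  lie_mem' {y z} hy hz := by
    have hy' : y ∈ Submodule.span ℂ ((H : Set L) ∪ x '' S) := hy
    have hz' : z ∈ Submodule.span ℂ ((H : Set L) ∪ x '' S) := hz
    have hxm : ∀ μ ∈ S, x μ ∈ Submodule.span ℂ ((H : Set L) ∪ x '' S) :=
      fun μ hμ => Submodule.subset_span (Or.inr ⟨μ, hμ, rfl⟩)
    change ⁅y, z⁆ ∈ Submodule.span ℂ ((H : Set L) ∪ x '' S)
    clear hy hz
    induction hy', hz' using Submodule.span_induction₂ with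
    | mem_mem y z hy hz =>
      rcases hy with hy | ⟨μ, hμ, rfl⟩ <;> rcases hz with hz | ⟨ν, hν, rfl⟩
      · exact Submodule.subset_span (Or.inl (H.lie_mem hy hz))
      · have h1 := hx.coroot_lie ⟨y, hy⟩ ν
        simp only at h1
        rw [h1]
        exact Submodule.smul_mem _ _ (hxm ν hν)
      · have h1 := hx.lie_coe ⟨z, hz⟩ μ
        simp only at h1
        rw [h1]
        exact Submodule.smul_mem _ _ (hxm μ hμ)
      · rcases hx.lie_cases μ ν with rfl | h | ⟨γ, hγ⟩
        · exact absurd hν (hS.neg_notMem μ hμ)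
        · rw [h]; exact zero_mem _
        · have h1 := hxm γ (hS.add_mem μ hμ ν hν γ hγ)
          rcases hx.lie_add μ ν γ hγ with h | h
          · rw [h]; exact Submodule.smul_mem _ _ h1
          · rw [h]; exact neg_mem (Submodule.smul_mem _ _ h1)
    | zero_left => rw [zero_lie]; exact zero_mem _
    | zero_right => rw [lie_zero]; exact zero_mem _
    | add_left x y z _ _ _ hx hy =>
      rw [add_lie]; exact add_mem hx hy
    | add_right x y z _ _ _ hx hy =>
      rw [lie_add]; exact add_mem hx hy
    | smul_left r x y _ _ h =>
      rw [smul_lie]; exact Submodule.smul_mem _ _ h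
    | smul_right r x y _ _ h =>
      rw [lie_smul]; exact Submodule.smul_mem _ _ h

variable (hx : IsChevalleyBasis H x) {S : Set H.root} (hS : IsSpecial S)

theorem coe_mem_borel (h : H) : (h : L) ∈ borel hx hS :=
  Submodule.subset_span (Or.inl h.2)

theorem root_mem_borel {μ : H.root} (hμ : μ ∈ S) : x μ ∈ borel hx hS :=
  Submodule.subset_span (Or.inr ⟨μ, hμ, rfl⟩)

/-- The root vectors of a special set of roots, inside the corresponding subalgebra. -/
def borelRoots : Set (borel hx hS) := {e | ∃ μ ∈ S, (e : L) = x μ}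

/-- The coroots, inside the subalgebra attached to a special set of roots. -/
def borelCoroots : Set (borel hx hS) := {t | ∃ α : H.root, (t : L) = (coroot α.1 : H)}

/-- The basis of the subalgebra attached to a special set of roots. -/
def borelBasis (β : (rootSystem H).Base) : S ⊕ β.support → borel hx hS
  | Sum.inl μ => ⟨x μ.1, root_mem_borel hx hS μ.2⟩
  | Sum.inr i => ⟨(coroot i.1.1 : H), coe_mem_borel hx hS _⟩

theorem coe_borelBasis_inl (β : (rootSystem H).Base) (μ : S) :
    (borelBasis hx hS β (Sum.inl μ) : L) = x μ.1 := rfl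

theorem coe_borelBasis_inr (β : (rootSystem H).Base) (i : β.support) :
    (borelBasis hx hS β (Sum.inr i) : L) = (coroot i.1.1 : H) := rfl

theorem span_borelBasis (β : (rootSystem H).Base) :
    Submodule.span ℂ (Set.range (borelBasis hx hS β)) = ⊤ := by
  refine Submodule.map_injective_of_injective
    (f := ((borel hx hS).toSubmodule.subtype)) Subtype.val_injective ?_
  rw [Submodule.map_top, Submodule.range_subtype, Submodule.map_span]
  refine le_antisymm (Submodule.span_le.mpr ?_) (Submodule.span_le.mpr ?_)
  · rintro _ ⟨y, _, rfl⟩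
    exact y.2
  · have hmem : ∀ i, (borelBasis hx hS β i : L) ∈ Submodule.span ℂ
        ((borel hx hS).toSubmodule.subtype '' Set.range (borelBasis hx hS β)) :=
      fun i => Submodule.subset_span ⟨_, ⟨i, rfl⟩, rfl⟩
    rintro y (hy | ⟨μ, hμ, rfl⟩)
    · have h1 : (⟨y, hy⟩ : H) ∈ Submodule.span ℂ (Set.range β.toCoweightBasis) :=
        β.toCoweightBasis.span_eq ▸ Submodule.mem_top
      refine Submodule.span_induction (p := fun (y : H) _ => (y : L) ∈ Submodule.span ℂ
        ((borel hx hS).toSubmodule.subtype '' Set.range (borelBasis hx hS β))) ?_ ?_ ?_ ?_ h1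
      · rintro _ ⟨i, rfl⟩
        rw [β.toCoweightBasis_apply]
        exact hmem (Sum.inr i)
      · exact zero_mem _
      · exact fun y z _ _ hy hz => add_mem hy hz
      · exact fun c y _ hy => Submodule.smul_mem _ c hy
    · exact hmem (Sum.inl ⟨μ, hμ⟩)

variable {A : Type*} [CommRing A] [Algebra ℂ A] {B : Set A}

/-- The adjoint representation restricted to a subalgebra. -/
def borelAd : borel hx hS →ₗ[ℂ] Module.End ℂ L :=
  (ad ℂ L : L →ₗ[ℂ] Module.End ℂ L) ∘ₗ (borel hx hS).toSubmodule.subtype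

theorem borelAd_apply (y : borel hx hS) (v : L) : borelAd hx hS y v = ⁅(y : L), v⁆ := rfl

theorem borelAd_lie (y z : borel hx hS) : borelAd hx hS ⁅y, z⁆ =
    borelAd hx hS y * borelAd hx hS z - borelAd hx hS z * borelAd hx hS y := by
  ext v
  simp [borelAd_apply]

theorem isAdmissibleLattice_adLattice : IsAdmissibleLattice (borelAd hx hS) (borelRoots hx hS)
    (borelCoroots hx hS) (adLattice x) where
  dpow_mem := by
    rintro ⟨e, he⟩ ⟨μ, hμ, h⟩ r v hv
    obtain rfl : e = x μ := h
    exact hx.dpow_ad_mem_adLattice μ r hv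
  le_span := by
    rintro ⟨t, ht⟩ ⟨α, h⟩
    obtain rfl : t = (coroot α.1 : H) := h
    exact hx.adLattice_le_span α

open scoped Classical in
-- Apply the adjoint representation to a coweight `h` with `μ(h) = 1` and read off minus the
-- coordinate of `x μ`. From `⁅x ν, h⁆ = -ν(h) x ν` the value is `1` at `x μ` and `0` at the other
-- root vectors; it is `0` on the Cartan subalgebra because that is abelian.
theorem exists_functional_root (β : (rootSystem H).Base) (hB : IsMulClosedBasis B) (μ : S)
    (b : B) : ∃ f : MapEnv A (borel hx hS) →ₗ[ℂ] ℂ, f 1 = 0 ∧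
      (∀ j c, f (elt (borelBasis hx hS β j) c) =
        hB.basis.coord b c * if j = Sum.inl μ then 1 else 0) ∧
      ∀ r ∈ intForm (borelRoots hx hS) (borelCoroots hx hS) B, f r ∈ intC := by
  obtain ⟨h, hh, hμ⟩ := exists_coweight_apply_eq_one β μ.1
  obtain ⟨φ, h1, h2, h3⟩ := hx.exists_coord μ.1
  obtain ⟨f, hf1, hf2, hf3⟩ := exists_integral_functional hB (borelAd_lie hx hS)
    (isAdmissibleLattice_adLattice hx hS) (coe_mem_adLattice hh) (-φ) (fun w hw => by
      refine Submodule.span_induction (p := fun w _ => (-φ) w ∈ intC) ?_ (by simp [zero_mem])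
        ?_ ?_ hw
      · rintro _ (⟨h, _, rfl⟩ | ⟨ν, rfl⟩)
        · simp [h3, zero_mem]
        · by_cases hν : ν = μ.1
          · subst hν
            rw [LinearMap.neg_apply, h1]; exact neg_mem (one_mem _)
          · rw [LinearMap.neg_apply, h2 ν hν, neg_zero]; exact zero_mem _
      · intro v w _ _ hv hw
        rw [map_add]; exact add_mem hv hw
      · intro k v _ hv
        rw [map_zsmul]; exact zsmul_mem hv k) b
  refine ⟨f, hf1, fun j c => ?_, hf3⟩
  rw [hf2, borelAd_apply]
  congr 1
  rcases j with ν | i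
  · rw [coe_borelBasis_inl, hx.lie_coe, map_smul, LinearMap.neg_apply]
    by_cases hν : ν = μ
    · subst hν
      rw [if_pos rfl, h1, hμ]; simp
    · rw [if_neg (by simpa using hν), h2 ν.1 (fun h => hν (Subtype.ext h))]; simp
  · have : ⁅(coroot i.1.1 : H), h⁆ = 0 := trivial_lie_zero H H _ _
    rw [coe_borelBasis_inr, ← LieSubalgebra.coe_bracket, this]
    simp

open scoped Classical in
-- A fundamental weight extended by zero is a character of the subalgebra, since brackets lie in the
-- span of root vectors. This uses that no two roots of `S` are opposite. The lattice is `ℤ` in the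
-- one-dimensional representation, where coroots act by integers and root vectors by zero.
theorem exists_functional_coroot (β : (rootSystem H).Base) (hB : IsMulClosedBasis B)
    (i : β.support) (b : B) : ∃ f : MapEnv A (borel hx hS) →ₗ[ℂ] ℂ, f 1 = 0 ∧
      (∀ j c, f (elt (borelBasis hx hS β j) c) =
        hB.basis.coord b c * if j = Sum.inr i then 1 else 0) ∧
      ∀ r ∈ intForm (borelRoots hx hS) (borelCoroots hx hS) B, f r ∈ intC := by
  obtain ⟨ξ, hξ, hξ'⟩ := exists_fundamental_weight β i
  obtain ⟨ω, hω, hω'⟩ := hx.exists_extend ξ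
  let τ : borel hx hS →ₗ[ℂ] Module.End ℂ ℂ :=
    (LinearMap.toSpanSingleton ℂ (Module.End ℂ ℂ) 1) ∘ₗ ω ∘ₗ (borel hx hS).toSubmodule.subtype
  have hτa : ∀ (y : borel hx hS) (v : ℂ), τ y v = ω y * v := fun y v => rfl
  have hτ0 : ∀ y z : borel hx hS, ω (⁅y, z⁆ : borel hx hS) = 0 := by
    rintro ⟨y, hy⟩ ⟨z, hz⟩
    change ω ⁅y, z⁆ = 0
    have hy' : y ∈ Submodule.span ℂ ((H : Set L) ∪ x '' S) := hy
    have hz' : z ∈ Submodule.span ℂ ((H : Set L) ∪ x '' S) := hz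
    clear hy hz
    induction hy', hz' using Submodule.span_induction₂ with
    | mem_mem y z hy hz =>
      rcases hy with hy | ⟨μ, hμ, rfl⟩ <;> rcases hz with hz | ⟨ν, hν, rfl⟩
      · have h1 : ⁅(⟨y, hy⟩ : H), (⟨z, hz⟩ : H)⁆ = 0 := trivial_lie_zero H H _ _
        have h2 : ⁅y, z⁆ = 0 := congrArg Subtype.val h1
        rw [h2, map_zero]
      · have h1 := hx.coroot_lie ⟨y, hy⟩ ν
        simp only at h1
        rw [h1, map_smul, hω', smul_zero]
      · have h1 := hx.lie_coe ⟨z, hz⟩ μ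
        simp only at h1
        rw [h1, map_smul, hω', smul_zero]
      · rcases hx.lie_cases μ ν with rfl | h | ⟨γ, hγ⟩
        · exact absurd hν (hS.neg_notMem μ hμ)
        · rw [h, map_zero]
        · rcases hx.lie_add μ ν γ hγ with h | h
          · rw [h, map_smul, hω', smul_zero]
          · rw [h, map_neg, map_smul, hω', smul_zero, neg_zero]
    | zero_left => rw [zero_lie, map_zero]
    | zero_right => rw [lie_zero, map_zero]
    | add_left x y z _ _ _ hx hy => rw [add_lie, map_add, hx, hy, add_zero]
    | add_right x y z _ _ _ hx hy => rw [lie_add, map_add, hx, hy, add_zero]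
    | smul_left r x y _ _ h => rw [smul_lie, map_smul, h, smul_zero]
    | smul_right r x y _ _ h => rw [lie_smul, map_smul, h, smul_zero]
  have hτ : ∀ y z, τ ⁅y, z⁆ = τ y * τ z - τ z * τ y := by
    intro y z
    ext
    simp only [hτa, hτ0, LinearMap.sub_apply, Module.End.mul_apply]
    ring
  have hN : IsAdmissibleLattice τ (borelRoots hx hS) (borelCoroots hx hS)
      (Submodule.span ℤ {(1 : ℂ)}) := by
    constructor
    · rintro ⟨e, he⟩ ⟨μ, hμ, h⟩ r v hv
      obtain rfl : e = x μ := h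
      have h1 : τ ⟨x μ, he⟩ = 0 := by
        ext
        rw [hτa, hω', zero_mul, LinearMap.zero_apply]
      rw [h1, dpow]
      rcases r with _ | r
      · simp [hv]
      · rw [zero_pow (by omega), smul_zero]; exact zero_mem _
    · rintro ⟨t, ht⟩ ⟨α, h⟩ v hv
      obtain rfl : t = (coroot α.1 : H) := h
      obtain ⟨k, hk⟩ := hξ' α
      exact Submodule.subset_span ⟨hv, k, by rw [hτa, hω, hk, smul_eq_mul]⟩
  obtain ⟨f, hf1, hf2, hf3⟩ := exists_integral_functional hB hτ hN
    (Submodule.mem_span_singleton_self 1) LinearMap.id (fun w hw => by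
      obtain ⟨k, rfl⟩ := Submodule.mem_span_singleton.mp hw
      simp) b
  refine ⟨f, hf1, fun j c => ?_, hf3⟩
  rw [hf2, hτa, mul_one, LinearMap.id_apply]
  congr 1
  rcases j with ν | j
  · rw [coe_borelBasis_inl, hω']; simp
  · rw [coe_borelBasis_inr, hω, hξ]; simp

/-- The blocks attached to the basis of the subalgebra of a special set of roots. -/
def borelBlock (β : (rootSystem H).Base) : S ⊕ β.support → (A →₀ ℕ) → MapEnv A (borel hx hS)
  | Sum.inl μ => dpowProd (borelBasis hx hS β (Sum.inl μ))
  | Sum.inr i => pSigned (borelBasis hx hS β (Sum.inr i))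

theorem intForm_borel_mem_span (β : (rootSystem H).Base) (hB : IsMulClosedBasis B)
    {l : List (S ⊕ β.support)} (hl : l.Nodup) (hl' : ∀ i, i ∈ l) {d : ℕ}
    {r : MapEnv A (borel hx hS)}
    (hr : r ∈ intForm (borelRoots hx hS) (borelCoroots hx hS) B)
    (hrd : r ∈ filt (A ⊗[ℂ] borel hx hS) d) :
    r ∈ Submodule.span ℤ {v | ∃ ψ : S ⊕ β.support → A →₀ ℕ, (∀ i, ψ i ∈ multisetsIn B) ∧
      (l.map fun i => (ψ i).degree).sum ≤ d ∧
      v = (l.map fun i => borelBlock hx hS β i (ψ i)).prod} := by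
  classical
  refine intForm_mem_span hB (z := borelBasis hx hS β) ?_ (span_borelBasis hx hS β) hl hl'
    ?_ ?_ hr hrd
  · rintro (μ | i)
    · exact isBlock_dpowProd _
    · exact isBlock_pSigned _
  · rintro (μ | i) ψ hψ
    · exact dpowProd_mem (fun b hb r => dpow_mem_intForm (E := borelRoots hx hS)
        ⟨μ.1, μ.2, rfl⟩ hb r) hψ
    · exact pSigned_mem_intForm (T := borelCoroots hx hS) ⟨i.1, rfl⟩ hψ
  · rintro (μ | i) b
    · obtain ⟨f, h1, h2, h3⟩ := exists_functional_root hx hS β hB μ b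
      exact ⟨f, h1, fun j c => by rw [h2], h3⟩
    · obtain ⟨f, h1, h2, h3⟩ := exists_functional_coroot hx hS β hB i b
      exact ⟨f, h1, fun j c => by rw [h2], h3⟩

end Borel

end MapAlgebra

end

noncomputable section

namespace MapAlgebra

/-! ### Straightening -/

section Straightening

variable {U G : Type*} [Ring U] {val : G → U} {deg : G → ℕ}

/-- The integral combinations of products of generators of total degree less than `d`. -/
def genSpanLT (val : G → U) (deg : G → ℕ) (d : ℕ) : Submodule ℤ U :=
  Submodule.span ℤ {u | ∃ w : List G, (w.map deg).sum < d ∧ u = (w.map val).prod}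

theorem prod_mem_genSpanLT {w : List G} {d : ℕ} (h : (w.map deg).sum < d) :
    (w.map val).prod ∈ genSpanLT val deg d :=
  Submodule.subset_span ⟨w, h, rfl⟩

theorem val_mem_genSpanLT (g : G) : val g ∈ genSpanLT val deg (deg g + 1) := by
  simpa using prod_mem_genSpanLT (val := val) (deg := deg) (w := [g]) (d := deg g + 1) (by simp)

theorem genSpanLT_mono {c d : ℕ} (h : c ≤ d) : genSpanLT val deg c ≤ genSpanLT val deg d := by
  refine Submodule.span_mono ?_
  rintro _ ⟨w, hw, rfl⟩
  exact ⟨w, by omega, rfl⟩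

/-- The index `c + 1` encodes total degree at most `c`, so the product has degree less than `c + d`.
-/
theorem mul_mem_genSpanLT {c d : ℕ} {u v : U} (hu : u ∈ genSpanLT val deg (c + 1))
    (hv : v ∈ genSpanLT val deg d) : u * v ∈ genSpanLT val deg (c + d) := by
  induction hu, hv using Submodule.span_induction₂ with
  | mem_mem u v hu hv =>
    obtain ⟨w, hw, rfl⟩ := hu
    obtain ⟨w', hw', rfl⟩ := hv
    refine Submodule.subset_span ⟨w ++ w', ?_, by simp⟩
    simp only [List.map_append, List.sum_append]
    omega
  | zero_left => rw [zero_mul]; exact zero_mem _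
  | zero_right => rw [mul_zero]; exact zero_mem _
  | add_left x y z _ _ _ hx hy => rw [add_mul]; exact add_mem hx hy
  | add_right x y z _ _ _ hx hy => rw [mul_add]; exact add_mem hx hy
  | smul_left r x y _ _ h => rw [smul_mul_assoc]; exact Submodule.smul_mem _ _ h
  | smul_right r x y _ _ h => rw [mul_smul_comm]; exact Submodule.smul_mem _ _ h

theorem mul_mem_genSpanLT' {c d : ℕ} {u v : U} (hu : u ∈ genSpanLT val deg c)
    (hv : v ∈ genSpanLT val deg (d + 1)) : u * v ∈ genSpanLT val deg (c + d) := by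
  induction hu, hv using Submodule.span_induction₂ with
  | mem_mem u v hu hv =>
    obtain ⟨w, hw, rfl⟩ := hu
    obtain ⟨w', hw', rfl⟩ := hv
    refine Submodule.subset_span ⟨w ++ w', ?_, by simp⟩
    simp only [List.map_append, List.sum_append]
    omega
  | zero_left => rw [zero_mul]; exact zero_mem _
  | zero_right => rw [mul_zero]; exact zero_mem _
  | add_left x y z _ _ _ hx hy => rw [add_mul]; exact add_mem hx hy
  | add_right x y z _ _ _ hx hy => rw [mul_add]; exact add_mem hx hy
  | smul_left r x y _ _ h => rw [smul_mul_assoc]; exact Submodule.smul_mem _ _ h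
  | smul_right r x y _ _ h => rw [mul_smul_comm]; exact Submodule.smul_mem _ _ h

theorem one_mem_genSpanLT (d : ℕ) : (1 : U) ∈ genSpanLT val deg (d + 1) := by
  simpa using prod_mem_genSpanLT (val := val) (deg := deg) (w := []) (d := d + 1) (by simp)

theorem list_prod_mem_genSpanLT {ι : Type*} (l : List ι) {f : ι → U} {d : ι → ℕ}
    (h : ∀ i ∈ l, f i ∈ genSpanLT val deg (d i + 1)) :
    (l.map f).prod ∈ genSpanLT val deg ((l.map d).sum + 1) := by
  induction l with
  | nil => simpa using one_mem_genSpanLT 0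
  | cons i l ih =>
    simp only [List.map_cons, List.prod_cons, List.sum_cons, add_assoc]
    exact mul_mem_genSpanLT (h i (by simp)) (ih fun j hj => h j (by simp [hj]))

variable (hcomm : ∀ g h, val g * val h - val h * val g ∈ genSpanLT val deg (deg g + deg h))
include hcomm

/-- Permuting the factors of a product of generators changes it by terms of lower degree. -/
theorem perm_sub_mem_genSpanLT {w w' : List G} (h : w.Perm w') :
    (w.map val).prod - (w'.map val).prod ∈ genSpanLT val deg (w.map deg).sum := by
  induction h with
  | nil => simp
  | cons g h ih =>
    simp only [List.map_cons, List.prod_cons, List.sum_cons]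
    rw [← mul_sub]
    exact mul_mem_genSpanLT (val_mem_genSpanLT g) ih
  | swap g h l =>
    simp only [List.map_cons, List.prod_cons, List.sum_cons]
    rw [← mul_assoc, ← mul_assoc, ← sub_mul, ← add_assoc]
    exact mul_mem_genSpanLT' (hcomm h g) (prod_mem_genSpanLT (Nat.lt_succ_self _))
  | trans h1 _ ih1 ih2 =>
    rw [← sub_add_sub_cancel]
    refine add_mem ih1 ?_
    rw [(h1.map deg).sum_eq]
    exact ih2

omit hcomm

theorem perm_flatMap_filter {κ : Type*} [DecidableEq κ] (key : G → κ) {l : List κ} (hl : l.Nodup)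
    (hl' : ∀ k, k ∈ l) (w : List G) :
    w.Perm (l.flatMap fun k => w.filter fun g => key g = k) := by
  classical
  rw [List.perm_iff_count]
  intro g
  rw [List.count_flatMap]
  have h1 : ∀ k, List.count g (w.filter fun g => key g = k) =
      if key g = k then List.count g w else 0 := by
    intro k
    split_ifs with h
    · rw [List.count_filter]
      simpa using h
    · rw [List.count_eq_zero]
      simp [h]
  rw [← List.sum_toFinset _ hl]
  simp [h1, hl']

theorem list_prod_mem_span {κ : Type*} [DecidableEq κ] {Blk : κ → Set U} {f : κ → U}
    {l : List κ} (hl : l.Nodup) (h : ∀ k ∈ l, f k ∈ Submodule.span ℤ (Blk k)) :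
    (l.map f).prod ∈ Submodule.span ℤ
      {u | ∃ v : κ → U, (∀ k ∈ l, v k ∈ Blk k) ∧ u = (l.map v).prod} := by
  induction l with
  | nil => exact Submodule.subset_span ⟨1, by simp, by simp⟩
  | cons k l ih =>
    obtain ⟨hk, hl⟩ := List.nodup_cons.mp hl
    have h1 := h k (by simp)
    have h2 := ih hl fun j hj => h j (by simp [hj])
    simp only [List.map_cons, List.prod_cons]
    generalize f k = c, (l.map f).prod = d at h1 h2
    induction h1, h2 using Submodule.span_induction₂ with
    | mem_mem a b ha hb =>
      obtain ⟨v, hv, rfl⟩ := hb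
      refine Submodule.subset_span ⟨Function.update v k a, ?_, ?_⟩
      · intro j hj
        by_cases hjk : j = k
        · subst hjk
          rwa [Function.update_self]
        · rw [Function.update_of_ne hjk]
          exact hv j ((List.mem_cons.mp hj).resolve_left hjk)
      · rw [Function.update_self]
        congr 2
        refine List.map_congr_left fun j hj => ?_
        rw [Function.update_of_ne]
        rintro rfl
        exact hk hj
    | zero_left => rw [zero_mul]; exact zero_mem _
    | zero_right => rw [mul_zero]; exact zero_mem _
    | add_left x y z _ _ _ hx hy => rw [add_mul]; exact add_mem hx hy
    | add_right x y z _ _ _ hx hy => rw [mul_add]; exact add_mem hx hy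
    | smul_left r x y _ _ h => rw [smul_mul_assoc]; exact Submodule.smul_mem _ _ h
    | smul_right r x y _ _ h => rw [mul_smul_comm]; exact Submodule.smul_mem _ _ h

include hcomm in
/-- Products of generators are integral combinations of products of blocks in a given order. -/
theorem prod_mem_span_blocks {κ : Type*} [DecidableEq κ] (key : G → κ) {l : List κ} (hl : l.Nodup)
    (hl' : ∀ k, k ∈ l) {Blk : κ → Set U}
    (hblk : ∀ k, ∀ w : List G, (∀ g ∈ w, key g = k) → (w.map val).prod ∈
      Submodule.span ℤ (Blk k)) (w : List G) :
    (w.map val).prod ∈ Submodule.span ℤ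
      {u | ∃ v : κ → U, (∀ k ∈ l, v k ∈ Blk k) ∧ u = (l.map v).prod} := by
  induction hd : (w.map deg).sum using Nat.strong_induction_on generalizing w with
  | h d ih =>
    -- Grouping the letters by key is a permutation of the word. The error consists of words of
    -- smaller total degree, to which the induction hypothesis applies.
    have h1 := perm_sub_mem_genSpanLT hcomm (perm_flatMap_filter key hl hl' w)
    refine (Submodule.sub_mem_iff_left _ ?_).mp ((Submodule.span_le.mpr ?_) h1)
    · have h2 : ((l.flatMap fun k => w.filter fun g => key g = k).map val).prod =
          (l.map fun k => ((w.filter fun g => key g = k).map val).prod).prod := by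
        rw [List.map_flatMap, List.flatMap_def, List.prod_flatten, List.map_map]
        rfl
      rw [h2]
      exact list_prod_mem_span hl fun k _ => hblk k _ (by simp)
    · rintro _ ⟨w', hw', rfl⟩
      exact ih _ (hd ▸ hw') w' rfl

end Straightening

end MapAlgebra

end

noncomputable section

namespace MapAlgebra

open LieAlgebra LieAlgebra.IsKilling LieModule

/-! ### The generators of the integral form -/

section Generators

theorem dpow_mul_dpowProd {A 𝔨 : Type*} [CommRing A] [Algebra ℂ A] [LieRing 𝔨] [LieAlgebra ℂ 𝔨]
    (z : 𝔨) (b : A) (r : ℕ) (ψ : A →₀ ℕ) : dpow (elt z b) r * dpowProd z ψ =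
      ((ψ b + r).choose r : ℂ) • dpowProd z (ψ + Finsupp.single b r) := by
  induction r with
  | zero => simp
  | succ r ih =>
    have h1 : ((r : ℂ) + 1) • (dpow (elt z b) (r + 1) * dpowProd z ψ) = ((r : ℂ) + 1) •
        (((ψ b + (r + 1)).choose (r + 1) : ℂ) • dpowProd z (ψ + Finsupp.single b (r + 1))) := by
      rw [← smul_mul_assoc, succ_smul_dpow_succ, mul_assoc, ih, mul_smul_comm, elt_mul_dpowProd,
        smul_smul, smul_smul, add_assoc ψ, ← Finsupp.single_add, Finsupp.add_apply,
        Finsupp.single_eq_same]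
      congr 1
      have := Nat.add_one_mul_choose_eq (ψ b + r) r
      have h2 : ((ψ b + r + 1 : ℕ) : ℂ) * ((ψ b + r).choose r : ℕ) =
          ((ψ b + r + 1).choose (r + 1) : ℕ) * ((r + 1 : ℕ) : ℂ) := by exact_mod_cast this
      push_cast at h2
      rw [← add_assoc]
      push_cast
      linear_combination h2
    exact smul_right_injective _ (Nat.cast_add_one_ne_zero (R := ℂ) r) h1

variable {L : Type*} [LieRing L] [LieAlgebra ℂ L] [FiniteDimensional ℂ L] [IsKilling ℂ L]
  {H : LieSubalgebra ℂ L} [H.IsCartanSubalgebra] {x : H.root → L}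
  {A : Type*} [CommRing A] [Algebra ℂ A] {B : Set A}

/-- The divided powers of root vectors and the elements `p_i(χ)`. -/
def genVal (β : (rootSystem H).Base) (x : H.root → L) (B : Set A) :
    (H.root × B × ℕ) ⊕ (β.support × multisetsIn B) → MapEnv A L
  | Sum.inl g => dpow (elt (x g.1) g.2.1) g.2.2
  | Sum.inr g => pOne (coroot g.1.1.1 : H) g.2.1

/-- The degrees of the generators. -/
def genDeg (β : (rootSystem H).Base) (B : Set A) :
    (H.root × B × ℕ) ⊕ (β.support × multisetsIn B) → ℕ
  | Sum.inl g => g.2.2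
  | Sum.inr g => g.2.1.degree

/-- Products of generators of total degree less than `d`. -/
abbrev genSpan (β : (rootSystem H).Base) (x : H.root → L) (B : Set A) (d : ℕ) :
    Submodule ℤ (MapEnv A L) := genSpanLT (genVal β x B) (genDeg β B) d

variable (β : (rootSystem H).Base)

theorem dpow_mem_genSpan (γ : H.root) {b : A} (hb : b ∈ B) (r : ℕ) :
    dpow (elt (x γ) b) r ∈ genSpan β x B (r + 1) :=
  val_mem_genSpanLT (val := genVal β x B) (deg := genDeg β B) (Sum.inl (γ, ⟨b, hb⟩, r))

theorem pOne_simple_mem_genSpan (i : β.support) {χ : A →₀ ℕ} (hχ : χ ∈ multisetsIn B) :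
    pOne ((coroot i.1.1 : H) : L) χ ∈ genSpan β x B (χ.degree + 1) :=
  val_mem_genSpanLT (val := genVal β x B) (deg := genDeg β B) (Sum.inr (i, ⟨χ, hχ⟩))

theorem pSigned_simple_mem_genSpan (i : β.support) {χ : A →₀ ℕ} (hχ : χ ∈ multisetsIn B) :
    pSigned ((coroot i.1.1 : H) : L) χ ∈ genSpan β x B (χ.degree + 1) :=
  zsmul_eq_of_mem_intC (pow_mem (neg_mem (one_mem _)) _) (pOne_simple_mem_genSpan β i hχ)

theorem dpowProd_mem_genSpan (γ : H.root) {ψ : A →₀ ℕ} (hψ : ψ ∈ multisetsIn B) :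
    dpowProd (x γ) ψ ∈ genSpan β x B (ψ.degree + 1) := by
  classical
  induction ψ using Finsupp.induction with
  | zero => rw [dpowProd_zero]; exact one_mem_genSpanLT _
  | single_add b r ψ hb hr ih =>
    have h1 : b ∈ B := hψ (by simp [hr])
    have h2 : ψ ∈ multisetsIn B := mem_multisetsIn_of_le le_add_self hψ
    have h3 := dpow_mul_dpowProd (x γ) b r ψ
    rw [Finsupp.notMem_support_iff.mp hb, zero_add, Nat.choose_self, Nat.cast_one, one_smul,
      add_comm ψ] at h3
    rw [← h3, map_add, Finsupp.degree_single, add_assoc]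
    exact mul_mem_genSpanLT (dpow_mem_genSpan β γ h1 r) (ih h2)

variable (hx : IsChevalleyBasis H x) {S : Set H.root} (hS : IsSpecial S)

/-- Carries the integrality criterion for the subalgebra, with its degree bound, into the big
enveloping algebra. Only the homomorphism is needed, not its injectivity. -/
theorem map_borel_mem_genSpan (hB : IsMulClosedBasis B) {d : ℕ} {r : MapEnv A (borel hx hS)}
    (hr : r ∈ intForm (borelRoots hx hS) (borelCoroots hx hS) B)
    (hrd : r ∈ filt (A ⊗[ℂ] borel hx hS) d) :
    mapEnvMap A (borel hx hS).incl r ∈ genSpan β x B (d + 1) := by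
  classical
  refine Submodule.span_induction (p := fun r _ => mapEnvMap A (borel hx hS).incl r ∈
    genSpan β x B (d + 1)) ?_ (by rw [map_zero]; exact zero_mem _) ?_ ?_
    (intForm_borel_mem_span hx hS β hB (Finset.nodup_toList Finset.univ)
      (fun i => Finset.mem_toList.mpr (Finset.mem_univ i)) hr hrd)
  · rintro _ ⟨ψ, hψ, hd, rfl⟩
    rw [map_list_prod, List.map_map]
    refine genSpanLT_mono (Nat.succ_le_succ hd) (list_prod_mem_genSpanLT _ fun i _ => ?_)
    rcases i with μ | i
    · change mapEnvMap A _ (dpowProd _ _) ∈ _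
      rw [mapEnvMap_dpowProd]
      exact dpowProd_mem_genSpan β μ.1 (hψ _)
    · change mapEnvMap A _ (pSigned _ _) ∈ _
      rw [mapEnvMap_pSigned]
      exact pSigned_simple_mem_genSpan β i (hψ _)
  · intro u v _ _ hu hv
    rw [map_add]; exact add_mem hu hv
  · intro k v _ hv
    rw [map_zsmul]; exact Submodule.smul_mem _ _ hv

/-- The commutator lies in the integral form of the subalgebra and its degree drops, so its integral
expansion has total degree less than `c + d`. This stands in for explicit commutation formulas. -/
theorem commutator_mem_genSpan (hB : IsMulClosedBasis B) {c d : ℕ}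
    {u v : MapEnv A (borel hx hS)}
    (hu : u ∈ intForm (borelRoots hx hS) (borelCoroots hx hS) B)
    (hv : v ∈ intForm (borelRoots hx hS) (borelCoroots hx hS) B)
    (huc : u ∈ filt (A ⊗[ℂ] borel hx hS) c) (hvd : v ∈ filt (A ⊗[ℂ] borel hx hS) d) :
    mapEnvMap A (borel hx hS).incl u * mapEnvMap A (borel hx hS).incl v -
      mapEnvMap A (borel hx hS).incl v * mapEnvMap A (borel hx hS).incl u ∈
      genSpan β x B (c + d) := by
  have h1 := commutator_mem_filtLT huc hvd
  have h2 := sub_mem (mul_mem hu hv) (mul_mem hv hu)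
  rw [← map_mul, ← map_mul, ← map_sub]
  generalize c + d = n at h1
  rcases n with _ | n
  · rw [filtLT_zero, Submodule.mem_bot] at h1
    rw [h1, map_zero]
    exact zero_mem _
  · exact map_borel_mem_genSpan β hx hS hB h2 h1

/-- The elements of the integral form of the subalgebra attached to a special set of roots. -/
theorem exists_borel_lift_dpow {γ : H.root} (hγ : γ ∈ S) {b : A} (hb : b ∈ B) (r : ℕ) :
    ∃ u ∈ intForm (borelRoots hx hS) (borelCoroots hx hS) B,
      u ∈ filt (A ⊗[ℂ] borel hx hS) r ∧
      mapEnvMap A (borel hx hS).incl u = dpow (elt (x γ) b) r :=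
  ⟨dpow (elt (⟨x γ, root_mem_borel hx hS hγ⟩ : borel hx hS) b) r,
    dpow_mem_intForm (E := borelRoots hx hS) ⟨γ, hγ, rfl⟩ hb r, dpow_mem_filt (elt_mem_filt _ _) r,
    mapEnvMap_dpow_elt _ _ _ _⟩

theorem exists_borel_lift_pOne (α : H.root) {χ : A →₀ ℕ} (hχ : χ ∈ multisetsIn B) :
    ∃ u ∈ intForm (borelRoots hx hS) (borelCoroots hx hS) B,
      u ∈ filt (A ⊗[ℂ] borel hx hS) χ.degree ∧
      mapEnvMap A (borel hx hS).incl u = pOne ((coroot α.1 : H) : L) χ :=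
  ⟨pOne (⟨(coroot α.1 : H), coe_mem_borel hx hS _⟩ : borel hx hS) χ,
    pOne_mem_intForm (T := borelCoroots hx hS) ⟨α, rfl⟩ hχ, pOne_mem_filt _ _,
    mapEnvMap_pOne _ _ _⟩

include hx

/-- Only simple coroots occur among the generators. With the empty set of roots the subalgebra is
the Cartan subalgebra, and the criterion expresses the `p(χ)` of any coroot by those of the simple
ones. -/
theorem pOne_coroot_mem_genSpan (hB : IsMulClosedBasis B) (α : H.root) {χ : A →₀ ℕ}
    (hχ : χ ∈ multisetsIn B) :
    pOne ((coroot α.1 : H) : L) χ ∈ genSpan β x B (χ.degree + 1) := by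
  obtain ⟨u, h1, h2, h3⟩ := exists_borel_lift_pOne hx isSpecial_empty α hχ
  rw [← h3]
  exact map_borel_mem_genSpan β hx isSpecial_empty hB h1 h2

theorem pSigned_coroot_mem_genSpan (hB : IsMulClosedBasis B) (α : H.root) {χ : A →₀ ℕ}
    (hχ : χ ∈ multisetsIn B) :
    pSigned ((coroot α.1 : H) : L) χ ∈ genSpan β x B (χ.degree + 1) :=
  zsmul_eq_of_mem_intC (pow_mem (neg_mem (one_mem _)) _) (pOne_coroot_mem_genSpan β hx hB α hχ)

/-- Both root vectors lie in the subalgebra of the roots that are nonnegative combinations of `γ`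
and `δ`. -/
theorem dpow_commutator_mem_genSpan (hB : IsMulClosedBasis B) {γ δ : H.root}
    (h : δ ≠ negRoot γ) {b c : A} (hb : b ∈ B) (hc : c ∈ B) (r t : ℕ) :
    dpow (elt (x γ) b) r * dpow (elt (x δ) c) t - dpow (elt (x δ) c) t * dpow (elt (x γ) b) r ∈
      genSpan β x B (r + t) := by
  have hS := isSpecial_pair h
  obtain ⟨u, h1, h2, h3⟩ := exists_borel_lift_dpow hx hS (γ := γ) ⟨1, 0, by simp⟩ hb r
  obtain ⟨v, h4, h5, h6⟩ := exists_borel_lift_dpow hx hS (γ := δ) ⟨0, 1, by simp⟩ hc t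
  rw [← h3, ← h6]
  exact commutator_mem_genSpan β hx hS hB h1 h4 h2 h5

theorem dpow_pOne_commutator_mem_genSpan (hB : IsMulClosedBasis B) (γ α : H.root)
    {b : A} (hb : b ∈ B) {χ : A →₀ ℕ} (hχ : χ ∈ multisetsIn B) (r : ℕ) :
    dpow (elt (x γ) b) r * pOne ((coroot α.1 : H) : L) χ -
      pOne ((coroot α.1 : H) : L) χ * dpow (elt (x γ) b) r ∈
      genSpan β x B (r + χ.degree) := by
  have hS := isSpecial_pair (ne_negRoot γ)
  obtain ⟨u, h1, h2, h3⟩ := exists_borel_lift_dpow hx hS (γ := γ) ⟨1, 0, by simp⟩ hb r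
  obtain ⟨v, h4, h5, h6⟩ := exists_borel_lift_pOne hx hS α hχ
  rw [← h3, ← h6]
  exact commutator_mem_genSpan β hx hS hB h1 h4 h2 h5

theorem pOne_commutator_mem_genSpan (hB : IsMulClosedBasis B) (α α' : H.root)
    {χ χ' : A →₀ ℕ} (hχ : χ ∈ multisetsIn B) (hχ' : χ' ∈ multisetsIn B) :
    pOne ((coroot α.1 : H) : L) χ * pOne ((coroot α'.1 : H) : L) χ' -
      pOne ((coroot α'.1 : H) : L) χ' * pOne ((coroot α.1 : H) : L) χ ∈
      genSpan β x B (χ.degree + χ'.degree) := by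
  obtain ⟨u, h1, h2, h3⟩ := exists_borel_lift_pOne hx isSpecial_empty α hχ
  obtain ⟨v, h4, h5, h6⟩ := exists_borel_lift_pOne hx isSpecial_empty α' hχ'
  rw [← h3, ← h6]
  exact commutator_mem_genSpan β hx isSpecial_empty hB h1 h4 h2 h5

/-- Products of elements `p_i(χ)` are integral combinations of ordered products. -/
theorem prod_pOne_mem_span (hB : IsMulClosedBasis B) {n : ℕ} (s : Fin n ≃ β.support)
    (w : List (β.support × multisetsIn B)) :
    (w.map fun g => pOne ((coroot g.1.1.1 : H) : L) (g.2.1 : A →₀ ℕ)).prod ∈ Submodule.span ℤ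
      {u : MapEnv A L | ∃ χ : Fin n → A →₀ ℕ, (∀ i, χ i ∈ multisetsIn B) ∧
        u = (List.ofFn fun i => pOne ((coroot (s i).1.1 : H) : L) (χ i)).prod} := by
  classical
  have hS := isSpecial_empty (H := H)
  choose u h1 h2 h3 using fun g : β.support × multisetsIn B =>
    exists_borel_lift_pOne hx hS g.1.1 g.2.2
  have h4 : (w.map fun g => pOne ((coroot g.1.1.1 : H) : L) (g.2.1 : A →₀ ℕ)).prod =
      mapEnvMap A (borel hx hS).incl (w.map u).prod := by
    rw [map_list_prod, List.map_map]
    congr 2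
    funext g
    exact (h3 g).symm
  have hl : (List.ofFn fun i => (Sum.inr (s i) : (∅ : Set H.root) ⊕ β.support)).Nodup :=
    List.nodup_ofFn.mpr (Sum.inr_injective.comp s.injective)
  have hl' : ∀ i : (∅ : Set H.root) ⊕ β.support, i ∈ List.ofFn fun i => Sum.inr (s i) := by
    rintro (⟨_, h⟩ | i)
    · exact absurd h (Set.notMem_empty _)
    · rw [List.mem_ofFn]
      exact ⟨s.symm i, by simp⟩
  rw [h4]
  refine Submodule.span_induction (p := fun r _ => mapEnvMap A (borel hx hS).incl r ∈
    Submodule.span ℤ {u : MapEnv A L | ∃ χ : Fin n → A →₀ ℕ, (∀ i, χ i ∈ multisetsIn B) ∧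
        u = (List.ofFn fun i => pOne ((coroot (s i).1.1 : H) : L) (χ i)).prod})
    ?_ (by rw [map_zero]; exact zero_mem _) ?_ ?_
    (intForm_borel_mem_span hx hS β hB hl hl'
      (Subalgebra.list_prod_mem _ fun v hv => by
        obtain ⟨g, _, rfl⟩ := List.mem_map.mp hv
        exact h1 g) (list_prod_mem_filt w fun g _ => h2 g))
  · rintro _ ⟨ψ, hψ, -, rfl⟩
    rw [map_list_prod, List.map_map, List.map_ofFn]
    have h5 : ∀ i : Fin n, mapEnvMap A (borel hx hS).incl
        (borelBlock hx hS β (Sum.inr (s i)) (ψ (Sum.inr (s i)))) =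
        pSigned ((coroot (s i).1.1 : H) : L) (ψ (Sum.inr (s i))) := fun i =>
      mapEnvMap_pSigned _ _ _
    -- Passing from the signed elements back to the `p(χ)` changes the product only by a sign.
    have h6 : ∀ l : List (Fin n), ∃ c ∈ intC, (l.map fun i =>
        pSigned ((coroot (s i).1.1 : H) : L) (ψ (Sum.inr (s i)))).prod =
        c • (l.map fun i => pOne ((coroot (s i).1.1 : H) : L) (ψ (Sum.inr (s i)))).prod := by
      intro l
      induction l with
      | nil => exact ⟨1, one_mem _, by simp⟩
      | cons i l ih =>
        obtain ⟨c, hc, h⟩ := ih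
        refine ⟨(-1) ^ (ψ (Sum.inr (s i))).degree * c,
          mul_mem (pow_mem (neg_mem (one_mem _)) _) hc, ?_⟩
        rw [List.map_cons, List.prod_cons, h, List.map_cons, List.prod_cons, pSigned,
          smul_mul_smul_comm]
    obtain ⟨c, hc, h⟩ := h6 (List.finRange n)
    simp only [Function.comp_def, h5]
    rw [List.ofFn_eq_map, h]
    refine zsmul_eq_of_mem_intC hc (Submodule.subset_span
      ⟨fun i => ψ (Sum.inr (s i)), fun i => hψ _, ?_⟩)
    rw [List.ofFn_eq_map]
  · intro u v _ _ hu hv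
    rw [map_add]; exact add_mem hu hv
  · intro k v _ hv
    rw [map_zsmul]; exact Submodule.smul_mem _ _ hv

end Generators

end MapAlgebra

end

noncomputable section

namespace MapAlgebra

/-! ### The case of `sl₂` -/

section SL2

open Matrix

attribute [local instance] LieRing.ofAssociativeRing LieAlgebra.ofAssociativeAlgebra

/-- The Lie algebra `sl₂`. -/
abbrev SL2 : LieSubalgebra ℂ (Matrix (Fin 2) (Fin 2) ℂ) := LieAlgebra.SpecialLinear.sl (Fin 2) ℂ

theorem mem_SL2 {M : Matrix (Fin 2) (Fin 2) ℂ} : M ∈ SL2 ↔ M 1 1 = -M 0 0 := by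
  have h : M ∈ SL2 ↔ M.trace = 0 := LinearMap.mem_ker
  rw [h, Matrix.trace_fin_two, add_eq_zero_iff_eq_neg']

/-- The standard basis `f, h, e` of `sl₂`. -/
def sl2Basis : Fin 3 → SL2 :=
  ![⟨!![0, 0; 1, 0], mem_SL2.mpr (by simp)⟩, ⟨!![1, 0; 0, -1], mem_SL2.mpr (by simp)⟩,
    ⟨!![0, 1; 0, 0], mem_SL2.mpr (by simp)⟩]

theorem coe_sl2Basis_zero : (sl2Basis 0 : Matrix (Fin 2) (Fin 2) ℂ) = !![0, 0; 1, 0] := rfl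
theorem coe_sl2Basis_one : (sl2Basis 1 : Matrix (Fin 2) (Fin 2) ℂ) = !![1, 0; 0, -1] := rfl
theorem coe_sl2Basis_two : (sl2Basis 2 : Matrix (Fin 2) (Fin 2) ℂ) = !![0, 1; 0, 0] := rfl

theorem eq_sl2Basis (M : SL2) : M = M.1 1 0 • sl2Basis 0 + M.1 0 0 • sl2Basis 1 +
    M.1 0 1 • sl2Basis 2 := by
  have h := mem_SL2.mp M.2
  refine Subtype.ext ?_
  have h1 : ((M.1 1 0 • sl2Basis 0 + M.1 0 0 • sl2Basis 1 + M.1 0 1 • sl2Basis 2 : SL2) :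
      Matrix (Fin 2) (Fin 2) ℂ) = M.1 1 0 • !![0, 0; 1, 0] + M.1 0 0 • !![1, 0; 0, -1] +
      M.1 0 1 • !![0, 1; 0, 0] := rfl
  rw [h1]
  ext i j
  fin_cases i <;> fin_cases j <;> simp [h]

theorem span_sl2Basis : Submodule.span ℂ (Set.range sl2Basis) = ⊤ := by
  refine Submodule.eq_top_iff'.mpr fun M => ?_
  rw [eq_sl2Basis M]
  have h : ∀ i, sl2Basis i ∈ Submodule.span ℂ (Set.range sl2Basis) :=
    fun i => Submodule.subset_span ⟨i, rfl⟩
  exact add_mem (add_mem (Submodule.smul_mem _ _ (h 0)) (Submodule.smul_mem _ _ (h 1)))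
    (Submodule.smul_mem _ _ (h 2))

theorem lie_two_zero : ⁅sl2Basis 2, sl2Basis 0⁆ = sl2Basis 1 := by
  refine Subtype.ext ?_
  rw [LieSubalgebra.coe_bracket, coe_sl2Basis_two, coe_sl2Basis_zero, coe_sl2Basis_one,
    Ring.lie_def]
  ext i j
  fin_cases i <;> fin_cases j <;> simp

theorem lie_two_one : ⁅sl2Basis 2, sl2Basis 1⁆ = (-2 : ℂ) • sl2Basis 2 := by
  refine Subtype.ext ?_
  have h : (((-2 : ℂ) • sl2Basis 2 : SL2) : Matrix (Fin 2) (Fin 2) ℂ) =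
    (-2 : ℂ) • !![0, 1; 0, 0] := rfl
  rw [LieSubalgebra.coe_bracket, h, coe_sl2Basis_two, coe_sl2Basis_one, Ring.lie_def]
  ext i j
  fin_cases i <;> fin_cases j <;> simp
  norm_num

/-- The elements `e` and `f`. -/
def sl2Roots : Set SL2 := {sl2Basis 0, sl2Basis 2}

theorem zero_mem_sl2Roots : sl2Basis 0 ∈ sl2Roots := Or.inl rfl

theorem two_mem_sl2Roots : sl2Basis 2 ∈ sl2Roots := Or.inr rfl

/-- The element `h`. -/
def sl2Coroots : Set SL2 := {sl2Basis 1}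

/-- The natural representation of `sl₂`. -/
def sl2Rep : SL2 →ₗ[ℂ] Module.End ℂ (Fin 2 → ℂ) :=
  (Matrix.toLin' : Matrix (Fin 2) (Fin 2) ℂ ≃ₗ[ℂ] _).toLinearMap ∘ₗ SL2.toSubmodule.subtype

theorem sl2Rep_apply (M : SL2) (v : Fin 2 → ℂ) : sl2Rep M v = M.1 *ᵥ v := rfl

theorem sl2Rep_lie (M N : SL2) : sl2Rep ⁅M, N⁆ = sl2Rep M * sl2Rep N - sl2Rep N * sl2Rep M := by
  refine LinearMap.ext fun v => ?_
  simp only [LinearMap.sub_apply, Module.End.mul_apply, sl2Rep_apply, LieSubalgebra.coe_bracket,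
    Ring.lie_def, Matrix.sub_mulVec, Matrix.mulVec_mulVec]

/-- The standard lattice. -/
def sl2Lattice : Submodule ℤ (Fin 2 → ℂ) := Submodule.span ℤ {Pi.single 0 1, Pi.single 1 1}

theorem single_mem_sl2Lattice (i : Fin 2) : (Pi.single i 1 : Fin 2 → ℂ) ∈ sl2Lattice := by
  fin_cases i <;> exact Submodule.subset_span (by simp)

theorem sl2Rep_zero_zero : sl2Rep (sl2Basis 0) (Pi.single 0 1) = Pi.single 1 1 := by
  rw [sl2Rep_apply, coe_sl2Basis_zero]; ext i; fin_cases i <;> simp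
theorem sl2Rep_zero_one : sl2Rep (sl2Basis 0) (Pi.single 1 1) = 0 := by
  rw [sl2Rep_apply, coe_sl2Basis_zero]; ext i; fin_cases i <;> simp
theorem sl2Rep_one_zero : sl2Rep (sl2Basis 1) (Pi.single 0 1) = Pi.single 0 1 := by
  rw [sl2Rep_apply, coe_sl2Basis_one]; ext i; fin_cases i <;> simp
theorem sl2Rep_one_one : sl2Rep (sl2Basis 1) (Pi.single 1 1) = -Pi.single 1 1 := by
  rw [sl2Rep_apply, coe_sl2Basis_one]; ext i; fin_cases i <;> simp
theorem sl2Rep_two_zero : sl2Rep (sl2Basis 2) (Pi.single 0 1) = 0 := by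
  rw [sl2Rep_apply, coe_sl2Basis_two]; ext i; fin_cases i <;> simp
theorem sl2Rep_two_one : sl2Rep (sl2Basis 2) (Pi.single 1 1) = Pi.single 0 1 := by
  rw [sl2Rep_apply, coe_sl2Basis_two]; ext i; fin_cases i <;> simp

/-- In the natural representation `e` and `f` have square zero, so their divided powers beyond the
first vanish. -/
theorem isAdmissibleLattice_sl2Lattice :
    IsAdmissibleLattice sl2Rep sl2Roots sl2Coroots sl2Lattice where
  dpow_mem := by
    have key : ∀ e ∈ sl2Roots, (∀ i, sl2Rep e (Pi.single i 1) ∈ sl2Lattice) ∧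
        ∀ i, sl2Rep e (sl2Rep e (Pi.single i 1)) = 0 := by
      rintro e (rfl | rfl)
      · constructor <;> intro i <;> fin_cases i
        · exact sl2Rep_zero_zero ▸ single_mem_sl2Lattice 1
        · exact sl2Rep_zero_one ▸ zero_mem _
        · exact (congrArg _ sl2Rep_zero_zero).trans sl2Rep_zero_one
        · exact (congrArg _ sl2Rep_zero_one).trans (map_zero _)
      · constructor <;> intro i <;> fin_cases i
        · exact sl2Rep_two_zero ▸ zero_mem _
        · exact sl2Rep_two_one ▸ single_mem_sl2Lattice 0
        · exact (congrArg _ sl2Rep_two_zero).trans (map_zero _)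
        · exact (congrArg _ sl2Rep_two_one).trans sl2Rep_two_zero
    intro e he r v hv
    have h2 : sl2Rep e ^ 2 = 0 := by
      refine LinearMap.pi_ext' fun i => LinearMap.ext_ring ?_
      simpa [pow_two] using (key e he).2 i
    rcases r with _ | _ | r
    · simpa [dpow_zero] using hv
    · rw [dpow_one]
      refine Submodule.span_induction (p := fun v _ => sl2Rep e v ∈ sl2Lattice) ?_ (by simp)
        ?_ ?_ hv
      · rintro _ (rfl | rfl)
        exacts [(key e he).1 0, (key e he).1 1]
      · intro v w _ _ hv hw
        rw [map_add]; exact add_mem hv hw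
      · intro k v _ hv
        rw [map_zsmul]; exact Submodule.smul_mem _ _ hv
    · rw [dpow, pow_eq_zero_of_le (by omega) h2, smul_zero]
      exact zero_mem _
  le_span := by
    rintro _ rfl
    refine Submodule.span_le.mpr ?_
    rintro _ (rfl | rfl)
    · exact Submodule.subset_span ⟨single_mem_sl2Lattice 0, 1, by rw [sl2Rep_one_zero]; simp⟩
    · exact Submodule.subset_span ⟨single_mem_sl2Lattice 1, -1, by rw [sl2Rep_one_one]; simp⟩

variable {A : Type*} [CommRing A] [Algebra ℂ A] {B : Set A}

/-- The matrix coefficients of the natural representation are the entries of the matrix; three of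
them are the coordinates of `f`, `h` and `e`. -/
theorem exists_functional_sl2 (hB : IsMulClosedBasis B) (p q : Fin 2) (b : B) :
    ∃ f : MapEnv A SL2 →ₗ[ℂ] ℂ, f 1 = 0 ∧
      (∀ (M : SL2) c, f (elt M c) = hB.basis.coord b c * M.1 p q) ∧
      ∀ r ∈ intForm sl2Roots sl2Coroots B, f r ∈ intC := by
  obtain ⟨f, h1, h2, h3⟩ := exists_integral_functional hB sl2Rep_lie isAdmissibleLattice_sl2Lattice
    (single_mem_sl2Lattice q) (LinearMap.proj p) (fun w hw => by
      refine Submodule.span_induction (p := fun w _ => (LinearMap.proj p : (Fin 2 → ℂ) →ₗ[ℂ] ℂ) w ∈ intC) ?_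
        (by simp [zero_mem]) ?_ ?_ hw
      · rintro _ (rfl | rfl) <;> fin_cases p <;> simp [zero_mem, one_mem]
      · intro v w _ _ hv hw
        rw [map_add]; exact add_mem hv hw
      · intro k v _ hv
        rw [map_zsmul]; exact zsmul_mem hv k) b
  refine ⟨f, h1, fun M c => ?_, h3⟩
  rw [h2, sl2Rep_apply]
  simp

/-- The blocks for `sl₂`. -/
def sl2Block (i : Fin 3) : (A →₀ ℕ) → MapEnv A SL2 :=
  if i = 1 then pSigned (sl2Basis i) else dpowProd (sl2Basis i)

theorem intForm_sl2_mem_span (hB : IsMulClosedBasis B) {d : ℕ} {r : MapEnv A SL2}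
    (hr : r ∈ intForm sl2Roots sl2Coroots B) (hrd : r ∈ filt (A ⊗[ℂ] SL2) d) :
    r ∈ Submodule.span ℤ {v | ∃ ψ₀ ψ₁ ψ₂ : A →₀ ℕ, ψ₀ ∈ multisetsIn B ∧ ψ₁ ∈ multisetsIn B ∧
      ψ₂ ∈ multisetsIn B ∧ ψ₀.degree + (ψ₁.degree + ψ₂.degree) ≤ d ∧
      v = dpowProd (sl2Basis 0) ψ₀ * (pSigned (sl2Basis 1) ψ₁ * dpowProd (sl2Basis 2) ψ₂)} := by
  refine Submodule.span_mono ?_ (intForm_mem_span hB (z := sl2Basis) (u := sl2Block) ?_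
    span_sl2Basis (l := [0, 1, 2]) (by decide) (by decide) ?_ ?_ hr hrd)
  · rintro _ ⟨ψ, hψ, hd, rfl⟩
    refine ⟨ψ 0, ψ 1, ψ 2, hψ 0, hψ 1, hψ 2, by simpa using hd, by simp [sl2Block]⟩
  · intro i
    unfold sl2Block
    split_ifs
    exacts [isBlock_pSigned _, isBlock_dpowProd _]
  · intro i ψ hψ
    fin_cases i
    · exact dpowProd_mem (fun b hb r => dpow_mem_intForm (E := sl2Roots) (Or.inl rfl) hb r) hψ
    · exact pSigned_mem_intForm (T := sl2Coroots) rfl hψ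
    · exact dpowProd_mem (fun b hb r => dpow_mem_intForm (E := sl2Roots) (Or.inr rfl) hb r) hψ
  · intro i b
    obtain ⟨p, q, hpq⟩ : ∃ p q : Fin 2, ∀ j, (sl2Basis j).1 p q = if j = i then 1 else 0 := by
      fin_cases i
      · exact ⟨1, 0, fun j => by fin_cases j <;> simp [sl2Basis]⟩
      · exact ⟨0, 0, fun j => by fin_cases j <;> simp [sl2Basis]⟩
      · exact ⟨0, 1, fun j => by fin_cases j <;> simp [sl2Basis]⟩
    obtain ⟨f, h1, h2, h3⟩ := exists_functional_sl2 hB p q b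
    exact ⟨f, h1, fun j c => by rw [h2, hpq], h3⟩

/-- The homomorphism from `sl₂` defined by an `sl₂`-triple. -/
def sl2Lift {L : Type*} [LieRing L] [LieAlgebra ℂ L] {f h e : L} (hef : ⁅e, f⁆ = h)
    (hhe : ⁅h, e⁆ = (2 : ℂ) • e) (hhf : ⁅h, f⁆ = (-2 : ℂ) • f) : SL2 →ₗ⁅ℂ⁆ L where
  toFun M := M.1 1 0 • f + M.1 0 0 • h + M.1 0 1 • e
  map_add' M N := by
    change (M.1 1 0 + N.1 1 0) • f + (M.1 0 0 + N.1 0 0) • h + (M.1 0 1 + N.1 0 1) • e = _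
    module
  map_smul' c M := by
    change (c * M.1 1 0) • f + (c * M.1 0 0) • h + (c * M.1 0 1) • e = c • _
    module
  map_lie' {M N} := by
    have hM := mem_SL2.mp M.2
    have hN := mem_SL2.mp N.2
    have hfe : ⁅f, e⁆ = -h := by rw [← lie_skew, hef]
    have heh : ⁅e, h⁆ = (-2 : ℂ) • e := by rw [← lie_skew, hhe, neg_smul]
    have hfh : ⁅f, h⁆ = (2 : ℂ) • f := by rw [← lie_skew, hhf, neg_smul, neg_neg]
    simp only [LieSubalgebra.coe_bracket, Ring.lie_def, Matrix.sub_apply, Matrix.mul_apply,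
      Fin.sum_univ_two, hM, hN, add_lie, lie_add, smul_lie, lie_smul, lie_self, hef, hhe, hhf,
      hfe, heh, hfh]
    module

theorem sl2Lift_sl2Basis {L : Type*} [LieRing L] [LieAlgebra ℂ L] {f h e : L} (hef : ⁅e, f⁆ = h)
    (hhe : ⁅h, e⁆ = (2 : ℂ) • e) (hhf : ⁅h, f⁆ = (-2 : ℂ) • f) :
    sl2Lift hef hhe hhf (sl2Basis 0) = f ∧ sl2Lift hef hhe hhf (sl2Basis 1) = h ∧
      sl2Lift hef hhe hhf (sl2Basis 2) = e := by
  have h1 : ∀ M : SL2, sl2Lift hef hhe hhf M = M.1 1 0 • f + M.1 0 0 • h + M.1 0 1 • e :=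
    fun M => rfl
  refine ⟨?_, ?_, ?_⟩ <;> simp [h1, sl2Basis]

end SL2

end MapAlgebra

end

noncomputable section

namespace MapAlgebra

/-! ### Divided powers of inner derivations -/

section InnerDerivation

variable {U : Type*} [Ring U] [Algebra ℂ U]

/-- The divided powers of the inner derivation of an element. -/
def adPow (X : U) (r : ℕ) : U →ₗ[ℂ] U :=
  dpow (LinearMap.mulLeft ℂ X - LinearMap.mulRight ℂ X : Module.End ℂ U) r

theorem adPow_zero (X v : U) : adPow X 0 v = v := by simp [adPow]

theorem succ_smul_adPow_succ (X v : U) (r : ℕ) :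
    ((r : ℂ) + 1) • adPow X (r + 1) v = X * adPow X r v - adPow X r v * X := by
  rw [adPow, ← LinearMap.smul_apply, succ_smul_dpow_succ]
  rfl

theorem adPow_succ_eq {X v w : U} {r : ℕ}
    (h : X * adPow X r v - adPow X r v * X = ((r : ℂ) + 1) • w) : adPow X (r + 1) v = w := by
  rw [← succ_smul_adPow_succ] at h
  exact smul_right_injective U (Nat.cast_add_one_ne_zero (R := ℂ) r) h

theorem dpow_mulLeft (X v : U) (r : ℕ) : dpow (LinearMap.mulLeft ℂ X : Module.End ℂ U) r v =
    dpow X r * v := by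
  rw [dpow, dpow, LinearMap.smul_apply, LinearMap.pow_mulLeft, LinearMap.mulLeft_apply,
    smul_mul_assoc]

theorem dpow_mulRight (X v : U) (r : ℕ) : dpow (LinearMap.mulRight ℂ X : Module.End ℂ U) r v =
    v * dpow X r := by
  rw [dpow, dpow, LinearMap.smul_apply, LinearMap.pow_mulRight, LinearMap.mulRight_apply,
    mul_smul_comm]

theorem adPow_apply (X v : U) (r : ℕ) : adPow X r v =
    ∑ p ∈ Finset.HasAntidiagonal.antidiagonal r, (-1 : ℂ) ^ p.2 • (dpow X p.1 * (v * dpow X p.2)) := by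
  have h : Commute (LinearMap.mulLeft ℂ X : Module.End ℂ U)
      ((-1 : ℂ) • LinearMap.mulRight ℂ X : Module.End ℂ U) :=
    (LinearMap.commute_mulLeft_right X X).smul_right _
  rw [adPow, sub_eq_add_neg, ← neg_one_smul ℂ (LinearMap.mulRight ℂ X : Module.End ℂ U),
    dpow_add h, LinearMap.sum_apply]
  refine Finset.sum_congr rfl fun p _ => ?_
  rw [Module.End.mul_apply, dpow_smul, LinearMap.smul_apply, map_smul, dpow_mulRight, dpow_mulLeft]

/-- The factorials disappear on expanding into left and right multiplications by divided powers of
`X`. -/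
theorem adPow_mem {J : Subalgebra ℤ U} {X v : U} (hX : ∀ i, dpow X i ∈ J) (hv : v ∈ J) (r : ℕ) :
    adPow X r v ∈ J := by
  rw [adPow_apply]
  exact sum_mem fun p _ => zsmul_eq_of_mem_intC (N := Subalgebra.toSubmodule J)
    (pow_mem (neg_mem (one_mem _)) _)
    (show _ ∈ J from mul_mem (hX _) (mul_mem hv (hX _)))

/-- The sequence `0, f 0, f 1, …`. -/
def shift (f : ℕ → U) : ℕ → U
  | 0 => 0
  | r + 1 => f r

theorem commutator_shift (X v : U) (r : ℕ) :
    X * shift (fun k => adPow X k v) r - shift (fun k => adPow X k v) r * X =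
      (r : ℂ) • adPow X r v := by
  rcases r with _ | r
  · simp [shift]
  · simp only [shift, Nat.cast_add, Nat.cast_one, succ_smul_adPow_succ]

theorem commutator_shift_shift (X v : U) (r : ℕ) :
    X * shift (shift fun k => adPow X k v) r - shift (shift fun k => adPow X k v) r * X =
      ((r : ℂ) - 1) • shift (fun k => adPow X k v) r := by
  rcases r with _ | r
  · simp [shift]
  · change _ = (((r + 1 : ℕ) : ℂ) - 1) • adPow X r v
    rw [Nat.cast_succ, add_sub_cancel_right]
    exact commutator_shift X v r

variable {X Y H Z : U} (hXY : X * Y = Y * X + H) (hXH : X * H = H * X + (2 : ℂ) • Z)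
  (hXZ : X * Z = Z * X)
include hXY hXH hXZ

/-- The Leibniz rule for divided powers of the derivation `D = [X, ·]`: here `D Y = H`, half of `D²
Y` is `Z`, and `D³ Y = 0`, so three terms remain. -/
theorem adPow_mul (v : U) (r : ℕ) : adPow X r (Y * v) = Y * adPow X r v +
    H * shift (fun k => adPow X k v) r + Z * shift (shift fun k => adPow X k v) r := by
  induction r with
  | zero => simp [adPow_zero, shift]
  | succ r ih =>
    refine adPow_succ_eq ?_
    have h1 := eq_add_of_sub_eq' (succ_smul_adPow_succ X v r).symm
    have h2 := eq_add_of_sub_eq' (commutator_shift X v r)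
    have h3 := eq_add_of_sub_eq' (commutator_shift_shift X v r)
    change _ = ((r : ℂ) + 1) • (Y * adPow X (r + 1) v + H * adPow X r v +
      Z * shift (fun k => adPow X k v) r)
    rw [ih]
    simp only [mul_add, add_mul, ← mul_assoc, hXY, hXH, hXZ]
    simp only [mul_assoc, h1, h2, h3, mul_add, mul_smul_comm, smul_mul_assoc]
    module

/-- The elements of an integral form with symbol a divided power of the bracket. -/
def brPow (X Y : U) (r n : ℕ) : U := ∑ p ∈ Finset.HasAntidiagonal.antidiagonal n,
  (-1 : ℂ) ^ p.2 • (adPow X r (dpow Y p.1) * dpow Y p.2)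

omit hXY hXH hXZ in
theorem brPow_zero (X Y : U) (r : ℕ) : brPow X Y r 0 = adPow X r 1 := by
  simp [brPow]

omit hXY hXH hXZ in
theorem brPow_mem {J : Subalgebra ℤ U} (hX : ∀ i, dpow X i ∈ J) (hY : ∀ i, dpow Y i ∈ J)
    (r n : ℕ) : brPow X Y r n ∈ J :=
  sum_mem fun _ _ => zsmul_eq_of_mem_intC (N := Subalgebra.toSubmodule J)
    (pow_mem (neg_mem (one_mem _)) _)
    (show _ ∈ J from mul_mem (adPow_mem hX (hY _) r) (hY _))

omit hXY hXH hXZ in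
theorem shift_brPow (r n : ℕ) : shift (fun k => brPow X Y k n) r =
    ∑ p ∈ Finset.HasAntidiagonal.antidiagonal n,
      (-1 : ℂ) ^ p.2 • (shift (fun k => adPow X k (dpow Y p.1)) r * dpow Y p.2) := by
  rcases r with _ | r
  · simp [shift]
  · rfl

omit hXY hXH hXZ in
theorem shift_shift_brPow (r n : ℕ) : shift (shift fun k => brPow X Y k n) r =
    ∑ p ∈ Finset.HasAntidiagonal.antidiagonal n,
      (-1 : ℂ) ^ p.2 • (shift (shift fun k => adPow X k (dpow Y p.1)) r * dpow Y p.2) := by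
  rcases r with _ | r
  · simp [shift]
  · exact shift_brPow r n

omit hXY hXH hXZ in
theorem succ_smul_dpow_succ' (u : U) (r : ℕ) :
    ((r : ℂ) + 1) • dpow u (r + 1) = dpow u r * u := by
  rw [succ_smul_dpow_succ]
  simpa [dpow_one] using (commute_dpow (Commute.refl u) 1 r).eq

/-- Formally, the series of the `brPow X Y r n` in `tⁿ` is `D^(r)(exp(tY)) exp(-tY)` with `D = [X,
·]`. The recursion is its derivative in `t`, computed with the Leibniz rule. -/
theorem succ_smul_brPow_succ (r n : ℕ) : ((n : ℂ) + 1) • brPow X Y r (n + 1) =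
    (Y * brPow X Y r n - brPow X Y r n * Y) + H * shift (fun k => brPow X Y k n) r +
      Z * shift (shift fun k => brPow X Y k n) r := by
  have h1 : ((n : ℂ) + 1) • brPow X Y r (n + 1) =
      (∑ p ∈ Finset.HasAntidiagonal.antidiagonal (n + 1), (p.1 : ℂ) •
        (-1 : ℂ) ^ p.2 • (adPow X r (dpow Y p.1) * dpow Y p.2)) +
      ∑ p ∈ Finset.HasAntidiagonal.antidiagonal (n + 1), (p.2 : ℂ) •
        (-1 : ℂ) ^ p.2 • (adPow X r (dpow Y p.1) * dpow Y p.2) := by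
    rw [brPow, Finset.smul_sum, ← Finset.sum_add_distrib]
    refine Finset.sum_congr rfl fun p hp => ?_
    have h : p.1 + p.2 = n + 1 := Finset.HasAntidiagonal.mem_antidiagonal.mp hp
    have h' : (p.1 : ℂ) + p.2 = n + 1 := by exact_mod_cast h
    rw [← h', add_smul]
  rw [h1, Finset.Nat.sum_antidiagonal_succ, Finset.Nat.sum_antidiagonal_succ' (n := n)]
  simp only [Nat.cast_zero, zero_smul, zero_add, Nat.cast_add, Nat.cast_one]
  rw [shift_brPow, shift_shift_brPow, brPow, Finset.mul_sum, Finset.sum_mul, Finset.mul_sum,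
    Finset.mul_sum, ← Finset.sum_sub_distrib, ← Finset.sum_add_distrib, ← Finset.sum_add_distrib,
    ← Finset.sum_add_distrib]
  refine Finset.sum_congr rfl fun p _ => ?_
  have h2 : ((p.1 : ℂ) + 1) • adPow X r (dpow Y (p.1 + 1)) = adPow X r (Y * dpow Y p.1) := by
    rw [← map_smul, succ_smul_dpow_succ]
  have h3 : ((p.2 : ℂ) + 1) • (-1 : ℂ) ^ (p.2 + 1) •
      (adPow X r (dpow Y p.1) * dpow Y (p.2 + 1)) =
      -((-1 : ℂ) ^ p.2 • (adPow X r (dpow Y p.1) * dpow Y p.2) * Y) := by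
    rw [smul_comm, ← mul_smul_comm, succ_smul_dpow_succ', pow_succ, mul_neg_one, neg_smul,
      smul_mul_assoc, mul_assoc]
  rw [h3, smul_comm, ← smul_mul_assoc, h2, adPow_mul hXY hXH hXZ]
  simp only [mul_smul_comm, smul_mul_assoc, add_mul, smul_add, mul_assoc]
  abel

end InnerDerivation

/-! ### Symbols in `sl₂`, and the `p(χ)` as integral expressions in divided powers -/

section Symbols

variable {𝔞 : Type*} [LieRing 𝔞] [LieAlgebra ℂ 𝔞] {x y h z : 𝔞}

/-- In the recursion the commutator with `y` has lower degree. For `r = n + 1` the term with `z`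
involves `brPow` at index `n - 1 < n` and is also negligible, so the leading term is multiplied by
`h` at each step. -/
theorem brPow_mem_filt (hxy : ⁅x, y⁆ = h) (hxh : ⁅x, h⁆ = (2 : ℂ) • z) (hxz : ⁅x, z⁆ = 0)
    (n : ℕ) : (∀ r, brPow (env x) (env y) r n ∈ filt 𝔞 n) ∧
      (∀ r < n, brPow (env x) (env y) r n ∈ filtLT 𝔞 n) ∧
      brPow (env x) (env y) n n - dpow (env h) n ∈ filtLT 𝔞 n := by
  have hXY : env x * env y = env y * env x + env h := by rw [← hxy, env_lie]; abel
  have hXH : env x * env h = env h * env x + (2 : ℂ) • env z := by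
    rw [← map_smul, ← hxh, env_lie]; abel
  have hXZ : env x * env z = env z * env x := by
    rw [← sub_eq_zero, ← env_lie, hxz, map_zero]
  have hrec := succ_smul_brPow_succ hXY hXH hXZ
  have hinv : ∀ (N : Submodule ℂ (Env 𝔞)) (n : ℕ) (v : Env 𝔞), ((n : ℂ) + 1) • v ∈ N → v ∈ N :=
    fun N n v hv => (Submodule.smul_mem_iff _ (Nat.cast_add_one_ne_zero (R := ℂ) n)).mp hv
  induction n with
  | zero =>
    have h0 : brPow (env x) (env y) 0 0 = 1 := by rw [brPow_zero, adPow_zero]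
    refine ⟨fun r => ?_, by simp, by rw [h0, dpow_zero, sub_self]; exact zero_mem _⟩
    rcases r with _ | r
    · rw [h0]; exact one_mem_filt 0
    · have h1 : brPow (env x) (env y) (r + 1) 0 = 0 := by
        rw [brPow_zero]
        induction r with
        | zero => exact adPow_succ_eq (by rw [adPow_zero, mul_one, one_mul, sub_self, smul_zero])
        | succ r ih => exact adPow_succ_eq (by rw [ih, mul_zero, zero_mul, sub_self, smul_zero])
      rw [h1]; exact zero_mem _
  | succ n ih =>
    obtain ⟨ih1, ih2, ih3⟩ := ih
    have hY : ∀ r, env y * brPow (env x) (env y) r n - brPow (env x) (env y) r n * env y ∈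
        filtLT 𝔞 (n + 1) := fun r => env_commutator_mem_filt y (ih1 r)
    have hs : ∀ r, shift (fun k => brPow (env x) (env y) k n) r ∈ filt 𝔞 n := by
      rintro (_ | r)
      exacts [zero_mem _, ih1 r]
    have hss : ∀ r, shift (shift fun k => brPow (env x) (env y) k n) r ∈ filt 𝔞 n := by
      rintro (_ | _ | r)
      exacts [zero_mem _, zero_mem _, ih1 r]
    have hs' : ∀ r ≤ n, shift (fun k => brPow (env x) (env y) k n) r ∈ filtLT 𝔞 n := by
      rintro (_ | r) hr
      exacts [zero_mem _, ih2 r hr]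
    have hss' : ∀ r ≤ n + 1, shift (shift fun k => brPow (env x) (env y) k n) r ∈
        filtLT 𝔞 n := by
      rintro (_ | r) hr
      exacts [zero_mem _, hs' r (by omega)]
    refine ⟨fun r => ?_, fun r hr => ?_, ?_⟩
    · refine hinv _ n _ ?_
      rw [hrec]
      exact add_mem (add_mem (filtLT_le_filt _ (hY r)) (env_mul_mem_filt _ (hs r)))
        (env_mul_mem_filt _ (hss r))
    · refine hinv _ n _ ?_
      rw [hrec]
      exact add_mem (add_mem (hY r) (env_mul_mem_filtLT _ (hs' r (by omega))))
        (env_mul_mem_filtLT _ (hss' r (by omega)))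
    · refine hinv _ n _ ?_
      rw [smul_sub, hrec, succ_smul_dpow_succ]
      have h1 : env h * shift (fun k => brPow (env x) (env y) k n) (n + 1) - env h * dpow (env h) n
          ∈ filtLT 𝔞 (n + 1) := by
        rw [← mul_sub]
        exact env_mul_mem_filtLT _ ih3
      convert add_mem (add_mem (hY (n + 1)) h1)
        (env_mul_mem_filtLT z (hss' (n + 1) le_rfl)) using 1
      abel

variable {A 𝔨 : Type*} [CommRing A] [Algebra ℂ A] [LieRing 𝔨] [LieAlgebra ℂ 𝔨]

/-- The block relations determine the symbol recursively from `u 0 = 1`. -/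
theorem IsBlock.sub_mem {z : 𝔨} {u u' : (A →₀ ℕ) → MapEnv A 𝔨} (hu : IsBlock z u)
    (hu' : IsBlock z u') (ψ : A →₀ ℕ) : u ψ - u' ψ ∈ filtLT (A ⊗[ℂ] 𝔨) ψ.degree := by
  generalize hd : ψ.degree = d
  induction d generalizing ψ with
  | zero =>
    rw [(Finsupp.degree_eq_zero_iff ψ).mp hd, hu.zero, hu'.zero, sub_self]
    exact zero_mem _
  | succ d ih =>
    obtain ⟨φ, a, rfl⟩ := exists_eq_add_single (ψ := ψ) (by rintro rfl; simp at hd)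
    rw [degree_add_single, Nat.succ_inj] at hd
    refine (Submodule.smul_mem_iff _ (Nat.cast_add_one_ne_zero (R := ℂ) (φ a))).mp ?_
    have h1 := env_mul_mem_filtLT (a ⊗ₜ[ℂ] z) (ih φ hd)
    have h2 := hu.mul_sub_mem φ a
    have h3 := hu'.mul_sub_mem φ a
    rw [hd] at h2 h3
    rw [← elt_eq_env] at h1
    change _ ∈ filt (A ⊗[ℂ] 𝔨) d at h1
    change _ ∈ filt (A ⊗[ℂ] 𝔨) d
    convert add_mem (_root_.sub_mem h1 h2) h3 using 1
    rw [mul_sub, smul_sub]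
    abel

/-- A substitute for `1 ∈ B`, which may fail. Expanding `1` in `B` and multiplying by `c` would
otherwise put `c` in the span of the other basis elements. -/
theorem IsMulClosedBasis.exists_mul_eq {B : Set A} (hB : IsMulClosedBasis B) {c : A}
    (hc : c ∈ B) : ∃ s ∈ B, c * s = c := by
  by_contra! hne
  have h1 : (1 : A) ∈ Submodule.span ℂ B := hB.span_eq_top ▸ Submodule.mem_top
  have h2 : c ∈ Submodule.span ℂ (B \ {c}) := by
    have h3 : c * 1 ∈ Submodule.span ℂ (B \ {c}) := by
      refine Submodule.span_induction (p := fun a _ => c * a ∈ Submodule.span ℂ (B \ {c}))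
        ?_ (by simp) ?_ ?_ h1
      · exact fun s hs => Submodule.subset_span ⟨hB.mul_mem c hc s hs, hne s hs⟩
      · intro a b _ _ ha hb
        rw [mul_add]; exact add_mem ha hb
      · intro k a _ ha
        rw [mul_smul_comm]; exact Submodule.smul_mem _ _ ha
    rwa [mul_one] at h3
  have h3 := linearIndepOn_iff_notMem_span.mp hB.linearIndepOn c hc
  simp only [Set.image_id] at h3
  exact h3 h2

/-- The subring generated by the divided powers of `e ⊗ b` and `f ⊗ b`. -/
def sl2Sub (B : Set A) : Subalgebra ℤ (MapEnv A SL2) :=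
  Algebra.adjoin ℤ {u | ∃ e ∈ sl2Roots, ∃ b ∈ B, ∃ r : ℕ, u = dpow (elt e b) r}

theorem dpow_mem_sl2Sub {B : Set A} {e : SL2} (he : e ∈ sl2Roots) {b : A} (hb : b ∈ B) (r : ℕ) :
    dpow (elt e b) r ∈ sl2Sub B :=
  Algebra.subset_adjoin ⟨e, he, b, hb, r, rfl⟩

theorem sl2Sub_le_intForm (B : Set A) : sl2Sub B ≤ intForm sl2Roots sl2Coroots B :=
  Algebra.adjoin_mono fun _ h => Or.inl h

/-- Take `X = e ⊗ b` and `Y = f ⊗ s` with `b s = b`. Then `[X, Y] = h ⊗ b` and `[X, [X, Y]] = -2 e ⊗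
b²`, which commutes with `X`. -/
theorem exists_sl2Sub_symbol_dpow {B : Set A} (hB : IsMulClosedBasis B) {b : A} (hb : b ∈ B)
    (r : ℕ) : ∃ w ∈ sl2Sub B, w - dpow (elt (sl2Basis 1) b) r ∈ filtLT (A ⊗[ℂ] SL2) r := by
  obtain ⟨s, hs, hbs⟩ := hB.exists_mul_eq hb
  refine ⟨brPow (elt (sl2Basis 2) b) (elt (sl2Basis 0) s) r r,
    brPow_mem (fun i => dpow_mem_sl2Sub two_mem_sl2Roots hb i)
      (fun i => dpow_mem_sl2Sub zero_mem_sl2Roots hs i) r r, ?_⟩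
  refine (brPow_mem_filt (x := b ⊗ₜ[ℂ] sl2Basis 2) (y := s ⊗ₜ[ℂ] sl2Basis 0)
    (h := b ⊗ₜ[ℂ] sl2Basis 1) (z := -((b * b) ⊗ₜ[ℂ] sl2Basis 2)) ?_ ?_ ?_ r).2.2
  · rw [LieAlgebra.ExtendScalars.bracket_tmul, hbs, lie_two_zero]
  · rw [LieAlgebra.ExtendScalars.bracket_tmul, lie_two_one, TensorProduct.tmul_smul]
    module
  · rw [lie_neg, LieAlgebra.ExtendScalars.bracket_tmul, lie_self, TensorProduct.tmul_zero, neg_zero]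

theorem exists_sl2Sub_symbol_dpowProd {B : Set A} (hB : IsMulClosedBasis B) {χ : A →₀ ℕ}
    (hχ : χ ∈ multisetsIn B) :
    ∃ w ∈ sl2Sub B, w - dpowProd (sl2Basis 1) χ ∈ filtLT (A ⊗[ℂ] SL2) χ.degree := by
  classical
  induction χ using Finsupp.induction with
  | zero => exact ⟨1, one_mem _, by rw [dpowProd_zero, sub_self]; exact zero_mem _⟩
  | single_add b r ψ hb hr ih =>
    obtain ⟨w, hw, h1⟩ := ih (mem_multisetsIn_of_le le_add_self hχ)
    obtain ⟨w', hw', h2⟩ := exists_sl2Sub_symbol_dpow hB (hχ (show b ∈ _ by simp [hr])) r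
    have h3 := dpow_mul_dpowProd (sl2Basis 1) b r ψ
    rw [Finsupp.notMem_support_iff.mp hb, zero_add, Nat.choose_self, Nat.cast_one, one_smul,
      add_comm ψ] at h3
    refine ⟨w' * w, mul_mem hw' hw, ?_⟩
    rw [← h3, map_add, Finsupp.degree_single]
    have h4 : w' ∈ filt (A ⊗[ℂ] SL2) r :=
      mem_of_sub_mem (filtLT_le_filt _ h2) (dpow_mem_filt (elt_mem_filt _ _) r)
    convert add_mem (mul_mem_filtLT h4 h1) (mul_mem_filtLT' h2 (dpowProd_mem_filt (sl2Basis 1) ψ))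
      using 1
    noncomm_ring

/-- The elements `p(χ)` lie in the subring generated by the divided powers. -/
theorem pSigned_mem_sl2Sub {B : Set A} (hB : IsMulClosedBasis B) {χ : A →₀ ℕ}
    (hχ : χ ∈ multisetsIn B) : pSigned (sl2Basis 1) χ ∈ sl2Sub B := by
  induction hd : χ.degree using Nat.strong_induction_on generalizing χ with
  | h d ih =>
    obtain ⟨w, hw, h1⟩ := exists_sl2Sub_symbol_dpowProd hB hχ
    -- The element `w` built from divided powers and `pSigned` have the same symbol.
    have h2 := sub_mem h1 ((isBlock_pSigned (sl2Basis 1)).sub_mem (isBlock_dpowProd _) χ)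
    rw [sub_sub_sub_cancel_right, hd] at h2
    have h3 := sub_mem (sl2Sub_le_intForm B hw) (pSigned_mem_intForm (E := sl2Roots)
      (T := sl2Coroots) (t := sl2Basis 1) rfl hχ)
    rw [← Subalgebra.mem_toSubmodule]
    rw [← sub_sub_cancel w (pSigned (sl2Basis 1) χ)]
    refine sub_mem hw ?_
    rcases d with _ | d
    · rw [filtLT_zero, Submodule.mem_bot] at h2
      rw [h2]
      exact zero_mem _
    -- The difference expands integrally into ordered monomials of degree at most `d`, where the
    -- degree of `χ` is now `d + 1`. Their middle factors are covered by the induction hypothesis.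
    · refine (Submodule.span_le.mpr ?_) (intForm_sl2_mem_span hB h3 h2)
      rintro _ ⟨ψ₀, ψ₁, ψ₂, h4, h5, h6, h7, rfl⟩
      refine show _ ∈ sl2Sub B from mul_mem (dpowProd_mem (fun b hb r => dpow_mem_sl2Sub
        zero_mem_sl2Roots hb r) h4)
        (mul_mem (ih _ (by omega) h5 rfl)
          (dpowProd_mem (fun b hb r => dpow_mem_sl2Sub two_mem_sl2Roots hb r) h6))

end Symbols

end MapAlgebra

end

noncomputable section

namespace MapAlgebra

open LieAlgebra LieAlgebra.IsKilling LieModule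

/-! ### The integral form -/

section Main

variable {L : Type*} [LieRing L] [LieAlgebra ℂ L] [FiniteDimensional ℂ L] [IsKilling ℂ L]
  {H : LieSubalgebra ℂ L} [H.IsCartanSubalgebra] {x : H.root → L}
  {A : Type*} [CommRing A] [Algebra ℂ A] {B : Set A}

theorem isPos_or_isPos_negRoot (β : (rootSystem H).Base) (γ : H.root) :
    β.IsPos γ ∨ β.IsPos (negRoot γ) := by
  have h : negRoot γ = (rootSystem H).reflectionPerm γ γ := root_eq_of_coe_eq (by
    rw [RootPairing.root_reflectionPerm, RootPairing.reflection_apply_self, root_negRoot])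
  rw [h]
  exact RootPairing.Base.IsPos.or_neg β γ

theorem not_isPos_negRoot (β : (rootSystem H).Base) {γ : H.root} (hγ : β.IsPos γ) :
    ¬ β.IsPos (negRoot γ) := by
  have h : negRoot γ = (rootSystem H).reflectionPerm γ γ := root_eq_of_coe_eq (by
    rw [RootPairing.root_reflectionPerm, RootPairing.reflection_apply_self, root_negRoot])
  rw [h]
  exact fun h' => (RootPairing.Base.IsPos.neg_iff_not β γ).mp h' hγ

/-- The homomorphism from `sl₂` attached to a root. -/
theorem IsChevalleyBasis.exists_sl2Lift (hx : IsChevalleyBasis H x) (γ : H.root) :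
    ∃ F : SL2 →ₗ⁅ℂ⁆ L, F (sl2Basis 0) = x (negRoot γ) ∧
      F (sl2Basis 1) = ((coroot γ.1 : H) : L) ∧ F (sl2Basis 2) = x γ := by
  refine ⟨sl2Lift (hx.lie_neg γ) ?_ ?_, sl2Lift_sl2Basis _ _ _⟩
  · rw [hx.coroot_lie, root_apply_coroot_self]
  · have h : (negRoot γ).1 (coroot γ.1) = -γ.1 (coroot γ.1) := rfl
    rw [hx.coroot_lie, h, root_apply_coroot_self]

variable (β : (rootSystem H).Base)

theorem map_sl2_mem_genSpan (hx : IsChevalleyBasis H x) (hB : IsMulClosedBasis B)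
    {γ : H.root} {F : SL2 →ₗ⁅ℂ⁆ L} (hf : F (sl2Basis 0) = x (negRoot γ))
    (hh : F (sl2Basis 1) = ((coroot γ.1 : H) : L)) (he : F (sl2Basis 2) = x γ) {d : ℕ}
    {r : MapEnv A SL2} (hr : r ∈ intForm sl2Roots sl2Coroots B)
    (hrd : r ∈ filt (A ⊗[ℂ] SL2) d) : mapEnvMap A F r ∈ genSpan β x B (d + 1) := by
  have key : ∀ ψ₀ ∈ multisetsIn B, ∀ ψ₁ ∈ multisetsIn B, ∀ ψ₂ ∈ multisetsIn B,
      ψ₀.degree + (ψ₁.degree + ψ₂.degree) ≤ d →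
      mapEnvMap A F (dpowProd (sl2Basis 0) ψ₀ * (pSigned (sl2Basis 1) ψ₁ *
        dpowProd (sl2Basis 2) ψ₂)) ∈ genSpan β x B (d + 1) := by
    intro ψ₀ h3 ψ₁ h4 ψ₂ h5 h6
    have h : mapEnvMap A F (dpowProd (sl2Basis 0) ψ₀ * (pSigned (sl2Basis 1) ψ₁ *
        dpowProd (sl2Basis 2) ψ₂)) = dpowProd (x (negRoot γ)) ψ₀ *
        (pSigned ((coroot γ.1 : H) : L) ψ₁ * dpowProd (x γ) ψ₂) := by
      rw [map_mul, map_mul, mapEnvMap_dpowProd, mapEnvMap_dpowProd, mapEnvMap_pSigned, he, hf, hh]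
    have h7 := mul_mem_genSpanLT (pSigned_coroot_mem_genSpan β hx hB γ h4)
      (dpowProd_mem_genSpan β γ h5)
    rw [h]
    exact genSpanLT_mono (by omega)
      (mul_mem_genSpanLT (dpowProd_mem_genSpan β (negRoot γ) h3) h7)
  refine Submodule.span_induction (p := fun r _ => mapEnvMap A F r ∈ genSpan β x B (d + 1)) ?_
    (by rw [map_zero]; exact zero_mem _) ?_ ?_ (intForm_sl2_mem_span hB hr hrd)
  · rintro _ ⟨ψ₀, ψ₁, ψ₂, h3, h4, h5, h6, rfl⟩
    exact key ψ₀ h3 ψ₁ h4 ψ₂ h5 h6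
  · intro u v _ _ hu hv
    rw [map_add]; exact add_mem hu hv
  · intro k v _ hv
    rw [map_zsmul]; exact Submodule.smul_mem _ _ hv

/-- The one pair of root vectors that no special set contains. The argument is the same, with `sl₂`
as the auxiliary Lie algebra. -/
theorem dpow_opposite_commutator_mem_genSpan (hx : IsChevalleyBasis H x) (hB : IsMulClosedBasis B)
    (γ : H.root) {b c : A} (hb : b ∈ B) (hc : c ∈ B) (r t : ℕ) :
    dpow (elt (x γ) b) r * dpow (elt (x (negRoot γ)) c) t -
      dpow (elt (x (negRoot γ)) c) t * dpow (elt (x γ) b) r ∈ genSpan β x B (r + t) := by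
  obtain ⟨F, hf, hh, he⟩ := hx.exists_sl2Lift γ
  have hu : dpow (elt (sl2Basis 2) b) r ∈ intForm sl2Roots sl2Coroots B :=
    dpow_mem_intForm two_mem_sl2Roots hb r
  have hv : dpow (elt (sl2Basis 0) c) t ∈ intForm sl2Roots sl2Coroots B :=
    dpow_mem_intForm zero_mem_sl2Roots hc t
  have h1 := commutator_mem_filtLT (dpow_mem_filt (elt_mem_filt (sl2Basis 2) b) r)
    (dpow_mem_filt (elt_mem_filt (sl2Basis 0) c) t)
  have h2 := sub_mem (mul_mem hu hv) (mul_mem hv hu)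
  rw [← he, ← hf, ← mapEnvMap_dpow_elt, ← mapEnvMap_dpow_elt, ← map_mul, ← map_mul, ← map_sub]
  generalize r + t = n at h1 ⊢
  rcases n with _ | n
  · rw [filtLT_zero, Submodule.mem_bot] at h1
    rw [h1, map_zero]
    exact zero_mem _
  · exact map_sl2_mem_genSpan β hx hB hf hh he h2 h1

theorem gen_commutator_mem_genSpan (hx : IsChevalleyBasis H x) (hB : IsMulClosedBasis B)
    (g h : (H.root × B × ℕ) ⊕ (β.support × multisetsIn B)) :
    genVal β x B g * genVal β x B h - genVal β x B h * genVal β x B g ∈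
      genSpan β x B (genDeg β B g + genDeg β B h) := by
  rcases g with ⟨γ, b, r⟩ | ⟨i, χ⟩ <;> rcases h with ⟨δ, c, t⟩ | ⟨j, χ'⟩
  · by_cases h : δ = negRoot γ
    · subst h
      exact dpow_opposite_commutator_mem_genSpan β hx hB γ b.2 c.2 r t
    · exact dpow_commutator_mem_genSpan β hx hB h b.2 c.2 r t
  · exact dpow_pOne_commutator_mem_genSpan β hx hB γ j.1 b.2 χ'.2 r
  · have h1 := neg_mem (dpow_pOne_commutator_mem_genSpan β hx hB δ i.1 c.2 χ.2 t)
    rw [neg_sub, add_comm] at h1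
    exact h1
  · exact pOne_commutator_mem_genSpan β hx hB i.1 j.1 χ.2 χ'.2

/-- The root of a generator that is a divided power of a root vector. -/
def genKey : (H.root × B × ℕ) ⊕ (β.support × multisetsIn B) → Option H.root
  | Sum.inl g => some g.1
  | Sum.inr _ => none

/-- The factors of the ordered monomials. -/
def genBlock (x : H.root → L) (B : Set A) {n : ℕ} (s : Fin n ≃ β.support) :
    Option H.root → Set (MapEnv A L)
  | some γ => {u | ∃ ψ ∈ multisetsIn B, u = dpowProd (x γ) ψ}
  | none => {u | ∃ χ : Fin n → A →₀ ℕ, (∀ i, χ i ∈ multisetsIn B) ∧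
      u = (List.ofFn fun i => pOne ((coroot (s i).1.1 : H) : L) (χ i)).prod}

/-- Divided powers for one root merge with binomial coefficients; the Cartan factors are rearranged
by the criterion for the Cartan subalgebra. -/
theorem prod_mem_span_genBlock (hx : IsChevalleyBasis H x) (hB : IsMulClosedBasis B) {n : ℕ}
    (s : Fin n ≃ β.support) (k : Option H.root)
    (w : List ((H.root × B × ℕ) ⊕ (β.support × multisetsIn B))) (hw : ∀ g ∈ w, genKey β g = k) :
    (w.map (genVal β x B)).prod ∈ Submodule.span ℤ (genBlock β x B s k) := by
  rcases k with _ | γ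
  · obtain ⟨w', rfl⟩ : ∃ w' : List (β.support × multisetsIn B), w = w'.map Sum.inr := by
      induction w with
      | nil => exact ⟨[], rfl⟩
      | cons g w ih =>
        obtain ⟨w', rfl⟩ := ih fun g hg => hw g (List.mem_cons_of_mem _ hg)
        rcases g with g | g
        · simpa [genKey] using hw _ List.mem_cons_self
        · exact ⟨g :: w', rfl⟩
    rw [List.map_map]
    exact prod_pOne_mem_span β hx hB s w'
  · induction w with
    | nil => exact Submodule.subset_span ⟨0, zero_mem_multisetsIn, by simp [dpowProd_zero]⟩
    | cons g w ih =>
      have h1 := ih fun g hg => hw g (List.mem_cons_of_mem _ hg)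
      have h2 := hw g List.mem_cons_self
      rcases g with ⟨δ, b, r⟩ | g
      · obtain rfl : δ = γ := by simpa [genKey] using h2
        rw [List.map_cons, List.prod_cons]
        refine Submodule.span_induction (p := fun v _ => genVal β x B (Sum.inl (δ, b, r)) * v ∈
          Submodule.span ℤ (genBlock β x B s (some δ))) ?_ (by rw [mul_zero]; exact zero_mem _)
          ?_ ?_ h1
        · rintro _ ⟨ψ, hψ, rfl⟩
          have h3 := dpow_mul_dpowProd (x δ) (b : A) r ψ
          rw [show genVal β x B (Sum.inl (δ, b, r)) = dpow (elt (x δ) (b : A)) r from rfl, h3]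
          exact zsmul_eq_of_mem_intC (natCast_mem _ _) (Submodule.subset_span
            ⟨_, add_mem_multisetsIn hψ (single_mem_multisetsIn b.2 r), rfl⟩)
        · intro u v _ _ hu hv
          rw [mul_add]; exact add_mem hu hv
        · intro k v _ hv
          rw [mul_smul_comm]; exact Submodule.smul_mem _ _ hv
      · simp [genKey] at h2

variable {m n : ℕ} (e : Fin m ≃ {α : H.root // β.IsPos α}) (s : Fin n ≃ β.support)

/-- Products of generators are integral combinations of the ordered monomials. -/
theorem prod_mem_span_pbwSet (hx : IsChevalleyBasis H x) (hB : IsMulClosedBasis B)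
    (w : List ((H.root × B × ℕ) ⊕ (β.support × multisetsIn B))) :
    (w.map (genVal β x B)).prod ∈ Submodule.span ℤ (pbwSet β x B e s) := by
  classical
  -- The prescribed order: negative roots, then `none` for the whole Cartan block, then positive
  -- roots.
  set l : List (Option H.root) := (List.ofFn fun j => some (negRoot (e j).1)) ++ [none] ++
    List.ofFn fun j => some (e j).1 with hl
  have hl1 : l.Nodup := by
    rw [hl, List.nodup_append, List.nodup_append]
    refine ⟨⟨List.nodup_ofFn.mpr fun i j h => ?_, List.nodup_singleton _, ?_⟩,
      List.nodup_ofFn.mpr fun i j h => ?_, ?_⟩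
    · have h1 := congrArg negRoot (Option.some_injective _ h)
      rw [negRoot_negRoot, negRoot_negRoot] at h1
      exact e.injective (Subtype.ext h1)
    · simp [List.mem_ofFn]
    · exact e.injective (Subtype.ext (Option.some_injective _ h))
    · intro k hk k' hk'
      obtain ⟨j, rfl⟩ := List.mem_ofFn.mp hk'
      rcases List.mem_append.mp hk with hk | hk
      · obtain ⟨i, rfl⟩ := List.mem_ofFn.mp hk
        intro h
        refine not_isPos_negRoot β (e i).2 ?_
        rw [Option.some_injective _ h]
        exact (e j).2
      · simp only [List.mem_singleton] at hk
        rw [hk]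
        exact Option.some_ne_none _ |>.symm
  have hl2 : ∀ k, k ∈ l := by
    intro k
    simp only [hl, List.mem_append, List.mem_singleton, List.mem_ofFn]
    rcases k with _ | γ
    · exact Or.inl (Or.inr rfl)
    · rcases isPos_or_isPos_negRoot β γ with h | h
      · exact Or.inr ⟨e.symm ⟨γ, h⟩, by simp⟩
      · exact Or.inl (Or.inl ⟨e.symm ⟨_, h⟩, by simp [negRoot_negRoot]⟩)
  refine Submodule.span_mono ?_ (prod_mem_span_blocks (gen_commutator_mem_genSpan β hx hB)
    (genKey β) hl1 hl2 (prod_mem_span_genBlock β hx hB s) w)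
  rintro _ ⟨v, hv, rfl⟩
  choose ψ h1 h2 using fun γ => hv (some γ) (hl2 _)
  obtain ⟨χ, h3, h4⟩ := hv none (hl2 _)
  refine ⟨fun j => ψ (negRoot (e j).1), fun j => ψ (e j).1, χ, fun j => h1 _, fun j => h1 _, h3, ?_⟩
  rw [hl]
  simp only [List.map_append, List.prod_append, List.map_ofFn, List.map_cons, List.map_nil,
    List.prod_singleton, Function.comp_def, h2, h4, pRoot, hx.lie_neg]

theorem adjoin_range_genVal_le (hx : IsChevalleyBasis H x) (hB : IsMulClosedBasis B) :
    Subalgebra.toSubmodule (Algebra.adjoin ℤ (Set.range (genVal β x B))) ≤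
      Submodule.span ℤ (pbwSet β x B e s) := by
  rw [Algebra.adjoin_eq_span, Submodule.span_le]
  intro u hu
  obtain ⟨l, hl, rfl⟩ := Submonoid.exists_list_of_mem_closure hu
  obtain ⟨w, rfl⟩ : ∃ w : List ((H.root × B × ℕ) ⊕ (β.support × multisetsIn B)),
      l = w.map (genVal β x B) := by
    induction l with
    | nil => exact ⟨[], rfl⟩
    | cons v l ih =>
      obtain ⟨g, hg⟩ := hl v List.mem_cons_self
      obtain ⟨w, rfl⟩ := ih (fun v hv => hl v (List.mem_cons_of_mem _ hv))
        (Submonoid.list_prod_mem _ fun v hv => Submonoid.subset_closure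
          (hl v (List.mem_cons_of_mem _ hv)))
      exact ⟨g :: w, by rw [List.map_cons, hg]⟩
  exact prod_mem_span_pbwSet β e s hx hB w

/-- Sorting takes place in the larger ring in which the `p_i(χ)` are adjoined as generators, since
they appear in commutators of opposite root vectors. -/
theorem UZ_le_span (hx : IsChevalleyBasis H x) (hB : IsMulClosedBasis B) :
    Subalgebra.toSubmodule (UZ β x B) ≤ Submodule.span ℤ (pbwSet β x B e s) := by
  refine le_trans ?_ (adjoin_range_genVal_le β e s hx hB)
  refine Algebra.adjoin_mono ?_
  rintro _ (⟨α, _, b, hb, r, rfl⟩ | ⟨α, _, b, hb, r, rfl⟩)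
  · exact ⟨Sum.inl (α, ⟨b, hb⟩, r), rfl⟩
  · exact ⟨Sum.inl (negRoot α, ⟨b, hb⟩, r), rfl⟩

/-- The homomorphism from `sl₂` given by the root takes the divided powers of `e ⊗ b` and `f ⊗ b` to
generators of `U_ℤ`, so the statement reduces to `pSigned_mem_sl2Sub`. -/
theorem pRoot_mem_UZ (hx : IsChevalleyBasis H x) (hB : IsMulClosedBasis B) {α : H.root}
    (hα : β.IsPos α) {χ : A →₀ ℕ} (hχ : χ ∈ multisetsIn B) : pRoot x α χ ∈ UZ β x B := by
  obtain ⟨F, hf, hh, he⟩ := hx.exists_sl2Lift α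
  have h1 : ∀ u ∈ sl2Sub B, mapEnvMap A F u ∈ UZ β x B := by
    intro u hu
    induction hu using Algebra.adjoin_induction with
    | mem g hg =>
      obtain ⟨z, hz, b, hb, r, rfl⟩ := hg
      rw [mapEnvMap_dpow_elt]
      rcases hz with rfl | rfl
      · rw [hf]; exact Algebra.subset_adjoin (Or.inr ⟨α, hα, b, hb, r, rfl⟩)
      · rw [he]; exact Algebra.subset_adjoin (Or.inl ⟨α, hα, b, hb, r, rfl⟩)
    | algebraMap k =>
      rw [eq_intCast, map_intCast]
      exact intCast_mem _ k
    | add u v _ _ hu hv => rw [map_add]; exact add_mem hu hv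
    | mul u v _ _ hu hv => rw [map_mul]; exact mul_mem hu hv
  have h2 := h1 _ (pSigned_mem_sl2Sub hB hχ)
  rw [mapEnvMap_pSigned, hh] at h2
  have h3 : pRoot x α χ = (-1 : ℂ) ^ χ.degree • pSigned ((coroot α.1 : H) : L) χ := by
    rw [pRoot, hx.lie_neg, pSigned, smul_smul, ← mul_pow, neg_one_mul, neg_neg, one_pow, one_smul]
  rw [h3]
  exact zsmul_eq_of_mem_intC (N := Subalgebra.toSubmodule (UZ β x B))
    (pow_mem (neg_mem (one_mem _)) _) h2

theorem UZ_eq_mul (hx : IsChevalleyBasis H x) (hB : IsMulClosedBasis B)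
    (e : Fin m ≃ {α : H.root // β.IsPos α}) (s : Fin n ≃ β.support) :
    Subalgebra.toSubmodule (UZ β x B) = Subalgebra.toSubmodule (UZneg β x B) *
      Subalgebra.toSubmodule (UZzero β x B) * Subalgebra.toSubmodule (UZpos β x B) := by
  refine le_antisymm ((UZ_le_span β e s hx hB).trans (Submodule.span_le.mpr ?_)) ?_
  · rintro _ ⟨ψ, ψ', χ, hψ, hψ', hχ, rfl⟩
    refine Submodule.mul_mem_mul (Submodule.mul_mem_mul ?_ ?_) ?_
    · refine Subalgebra.list_prod_mem (UZneg β x B) fun u hu => ?_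
      obtain ⟨j, rfl⟩ := List.mem_ofFn.mp hu
      exact dpowProd_mem (S := UZneg β x B) (fun b hb r => Algebra.subset_adjoin
        ⟨(e j).1, (e j).2, b, hb, r, rfl⟩) (hψ j)
    · refine Subalgebra.list_prod_mem (UZzero β x B) fun u hu => ?_
      obtain ⟨i, rfl⟩ := List.mem_ofFn.mp hu
      exact Algebra.subset_adjoin ⟨(s i).1, (s i).2, χ i, hχ i, rfl⟩
    · refine Subalgebra.list_prod_mem (UZpos β x B) fun u hu => ?_
      obtain ⟨j, rfl⟩ := List.mem_ofFn.mp hu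
      exact dpowProd_mem (S := UZpos β x B) (fun b hb r => Algebra.subset_adjoin
        ⟨(e j).1, (e j).2, b, hb, r, rfl⟩) (hψ' j)
  · have hneg : UZneg β x B ≤ UZ β x B := Algebra.adjoin_mono fun _ h => Or.inr h
    have hpos : UZpos β x B ≤ UZ β x B := Algebra.adjoin_mono fun _ h => Or.inl h
    have hzero : UZzero β x B ≤ UZ β x B := by
      refine Algebra.adjoin_le ?_
      rintro _ ⟨i, hi, χ, hχ, rfl⟩
      exact pRoot_mem_UZ β hx hB (RootPairing.Base.isPos_of_mem_support hi) hχ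
    refine Submodule.mul_le.mpr fun u hu v hv => ?_
    refine show _ ∈ UZ β x B from mul_mem ?_ (hpos hv)
    refine (Submodule.mul_le.mpr fun u hu v hv => ?_ :
      _ ≤ Subalgebra.toSubmodule (UZ β x B)) hu
    exact show _ ∈ UZ β x B from mul_mem (hneg hu) (hzero hv)

/-- The two assertions have independent sources: integrality from the spanning of `U_ℤ` by ordered
monomials, the degree bound from commutativity of the associated graded algebra. -/
theorem commutator_mem_and_deg_lt (hx : IsChevalleyBasis H x) (hB : IsMulClosedBasis B)
    {c d : ℕ} {u v : MapEnv A L} (hu : u ∈ UZ β x B) (hv : v ∈ UZ β x B)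
    (huc : u ∈ filt (A ⊗[ℂ] L) c) (hvd : v ∈ filt (A ⊗[ℂ] L) d) :
    u * v - v * u ∈ Submodule.span ℤ (pbwSet β x B e s) ∧
      (0 < c + d → deg (u * v - v * u) < c + d) :=
  ⟨UZ_le_span β e s hx hB (show _ ∈ UZ β x B from sub_mem (mul_mem hu hv) (mul_mem hv hu)),
    fun h => deg_lt_of_mem_filtLT h (commutator_mem_filtLT huc hvd)⟩

end Main

end MapAlgebra

end

/-! ### The main theorem -/

theorem mainTheorem6 {L : Type*} [LieRing L] [LieAlgebra ℂ L] [FiniteDimensional ℂ L]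
    [LieAlgebra.IsSimple ℂ L] (H : LieSubalgebra ℂ L) [H.IsCartanSubalgebra]
    (β : (LieAlgebra.IsKilling.rootSystem H).Base) (x : H.root → L)
    (hx : MapAlgebra.IsChevalleyBasis H x)
    {A : Type*} [CommRing A] [Algebra ℂ A] (B : Set A) (hB : MapAlgebra.IsMulClosedBasis B)
    {m n : ℕ} (e : Fin m ≃ {α : H.root // β.IsPos α}) (s : Fin n ≃ β.support) :
    Subalgebra.toSubmodule (MapAlgebra.UZ β x B) =
        Subalgebra.toSubmodule (MapAlgebra.UZneg β x B) *
          Subalgebra.toSubmodule (MapAlgebra.UZzero β x B) *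
          Subalgebra.toSubmodule (MapAlgebra.UZpos β x B) ∧
    ∀ α : H.root, β.IsPos α → ∀ i ∈ β.support, ∀ a ∈ B, ∀ b ∈ B,
      ∀ χ ∈ MapAlgebra.multisetsIn B, ∀ k l : ℕ,
      (∀ u v w : MapAlgebra.MapEnv A L,
        u = MapAlgebra.dpow (MapAlgebra.elt (x α) a) k →
        v = MapAlgebra.dpow (MapAlgebra.elt (x (MapAlgebra.negRoot α)) b) l →
        w = MapAlgebra.pRoot x i χ →
        (u * v - v * u ∈ Submodule.span ℤ (MapAlgebra.pbwSet β x B e s) ∧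
          (0 < k + l → MapAlgebra.deg (u * v - v * u) < k + l)) ∧
        (u * w - w * u ∈ Submodule.span ℤ (MapAlgebra.pbwSet β x B e s) ∧
          (0 < k + χ.degree → MapAlgebra.deg (u * w - w * u) < k + χ.degree)) ∧
        (w * v - v * w ∈ Submodule.span ℤ (MapAlgebra.pbwSet β x B e s) ∧
          (0 < l + χ.degree → MapAlgebra.deg (w * v - v * w) < l + χ.degree))) := by
  refine ⟨MapAlgebra.UZ_eq_mul β hx hB e s, ?_⟩
  rintro α hα i hi a ha b hb χ hχ k l u v w rfl rfl rfl
  have hu : MapAlgebra.dpow (MapAlgebra.elt (x α) a) k ∈ MapAlgebra.UZ β x B :=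
    Algebra.subset_adjoin (Or.inl ⟨α, hα, a, ha, k, rfl⟩)
  have hv : MapAlgebra.dpow (MapAlgebra.elt (x (MapAlgebra.negRoot α)) b) l ∈
      MapAlgebra.UZ β x B :=
    Algebra.subset_adjoin (Or.inr ⟨α, hα, b, hb, l, rfl⟩)
  have hw : MapAlgebra.pRoot x i χ ∈ MapAlgebra.UZ β x B :=
    MapAlgebra.pRoot_mem_UZ β hx hB (RootPairing.Base.isPos_of_mem_support hi) hχ
  have hu' := MapAlgebra.dpow_mem_filt (MapAlgebra.elt_mem_filt (x α) a) k
  have hv' := MapAlgebra.dpow_mem_filt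
    (MapAlgebra.elt_mem_filt (x (MapAlgebra.negRoot α)) b) l
  have hw' : MapAlgebra.pRoot x i χ ∈ MapAlgebra.filt (A ⊗[ℂ] L) χ.degree :=
    MapAlgebra.pOne_mem_filt _ χ
  refine ⟨MapAlgebra.commutator_mem_and_deg_lt β e s hx hB hu hv hu' hv',
    MapAlgebra.commutator_mem_and_deg_lt β e s hx hB hu hw hu' hw', ?_⟩
  rw [add_comm l]
  exact MapAlgebra.commutator_mem_and_deg_lt β e s hx hB hw hv hw' hv'
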